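/- Let $d\ge 1$, $p\in\mathbb N_0$, let $\Omega\subset\mathbb R^d$ be a bounded open set (for instance a bounded Lipschitz domain), let $0<\alpha\le\beta<\infty$ and $\kappa>0$. There are constants $C_0>0$ and $C>0$, depending only on $d,p,\Omega,\alpha,\beta,\kappa$, such that the following holds for - every $H>0$ and every finite face-to-face decomposition $\mathcal T_H$ of $\Omega$ into closed axis-parallel $d$-rectangles (that is, $\bigcup_{K\in\mathcal T_H}K=\overline\Omega$, $\operatorname{int}K\subset\Omega$ for all $K$, distinct elements have disjoint interiors, and two elements that meet do so in a common face) all of whose side lengths $s$ satisfy $s\le\kappa H$ and $H\le\kappa s$; - every measurable scalar coefficient $A$ with $\alpha\le A\le\beta$ a.e. in $\Omega$. Put $a_S(u,w)=\int_{\Omega\cap S} A\nabla u\cdot\nabla w\,dx$ and $a=a_\Omega$. Let $V_H\subset L^2(\Omega)$ be the space of functions which on every $K\in\mathcal T_H$ are polynomials of degree at most $p$ in each variable, $\Pi_H$ the $L^2(\Omega)$-orthogonal projection onto $V_H$, and $W=\{w\in H^1_0(\Omega):\Pi_H w=0\}$. For $S\subset\overline\Omega$ let $W(S)$ be the set of $w\in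 W$ that vanish a.e. in $\Omega\setminus S$, let $\mathtt N(S)=\mathtt N^1(S)=\bigcup\{K\in\mathcal T_H: K\cap\overline S\ne\emptyset\}$, and $\mathtt N^{\ell}(S)=\mathtt N(\mathtt N^{\ell-1}(S))$ for $\ell\ge2$. For every $G\in\mathcal T_H$, every integer $\lambda_G\ge1$ and every $v\in L^2(\Omega)$ the problems $$\mathcal D_G^{[\lambda_G]}v\in W(\mathtt N^{\lambda_G}(G)),\quad a_{\mathtt N^{\lambda_G}(G)}\big(\mathcal D_G^{[\lambda_G]}v,w\big)=-(v,w)_{L^2(G)}\ \text{ for all } w\in W(\mathtt N^{\lambda_G}(G)),$$ $$\mathcal D_Gv\in W,\quad a(\mathcal D_Gv,w)=-(v,w)_{L^2(G)}\ \text{ for all } w\in W,$$ have unique solutions, and for all $v\in H^1_0(\Omega)$ and $w\in W$ $$a\big((\mathcal D_G^{[\lambda_G]}-\mathcal D_G)v,\,w\big)\le C_0\,H^2\,e^{-C\lambda_G}\,\|\nabla v\|_{L^2(G)}\,\|\nabla w\|_{L^2(\mathtt N^{\lambda_G+1}(G))}.$$ -/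

import Mathlib

open MeasureTheory Set

/-- Euclidean space `ℝ^d`. -/
abbrev Euc (d : ℕ) : Type := EuclideanSpace ℝ (Fin d)

noncomputable section

/-! ### The Sobolev space `H¹₀(Ω)` -/

/-- Smooth real functions with compact support contained in `Ω`. -/
def IsTestFunction {d : ℕ} (Ω : Set (Euc d)) (φ : Euc d → ℝ) : Prop :=
  ContDiff ℝ (⊤ : ℕ∞) φ ∧ HasCompactSupport φ ∧ tsupport φ ⊆ Ω

/-- `L²(Ω)` for real-valued functions. -/
abbrev L2 {d : ℕ} (Ω : Set (Euc d)) : Type := Lp ℝ 2 (volume.restrict Ω)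

/-- The Hilbert space `L²(Ω) × L²(Ω; ℝ^d)`, in which the pair `(u, ∇u)` has the `H¹`-norm of `u`. -/
abbrev L2Pair {d : ℕ} (Ω : Set (Euc d)) : Type :=
  WithLp 2 (L2 Ω × Lp (Euc d) 2 (volume.restrict Ω))

/-- The pairs `(φ, ∇φ)` for test functions `φ`. -/
def testPairs {d : ℕ} (Ω : Set (Euc d)) : Submodule ℝ (L2Pair Ω) where
  carrier := {z | ∃ φ : Euc d → ℝ, IsTestFunction Ω φ ∧
    z.fst =ᵐ[volume.restrict Ω] φ ∧ z.snd =ᵐ[volume.restrict Ω] gradient φ}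
  zero_mem' := by
    refine ⟨fun _ => 0, ⟨contDiff_const, HasCompactSupport.zero, ?_⟩, ?_, ?_⟩
    · have h : tsupport (fun _ : Euc d => (0 : ℝ)) = ∅ := by
        simp [tsupport, Function.support]
      rw [h]
      exact empty_subset _
    · exact Lp.coeFn_zero ℝ 2 (volume.restrict Ω)
    · filter_upwards [Lp.coeFn_zero (Euc d) 2 (volume.restrict Ω)] with x hx
      rw [gradient_fun_const]
      exact hx
  add_mem' := by
    rintro z z' ⟨φ, ⟨h1, h2, h3⟩, h4, h5⟩ ⟨ψ, ⟨k1, k2, k3⟩, k4, k5⟩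
    refine ⟨φ + ψ, ⟨h1.add k1, h2.add k2,
      (tsupport_add φ ψ).trans (union_subset h3 k3)⟩, ?_, ?_⟩
    · filter_upwards [Lp.coeFn_add z.fst z'.fst, h4, k4] with x hx a b
      rw [WithLp.add_fst, hx, Pi.add_apply, Pi.add_apply, a, b]
    · filter_upwards [Lp.coeFn_add z.snd z'.snd, h5, k5] with x hx a b
      rw [WithLp.add_snd, hx, Pi.add_apply, a, b, gradient, gradient, gradient,
        fderiv_add (h1.differentiable (by simp) x) (k1.differentiable (by simp) x), map_add]
  smul_mem' := by
    rintro c z ⟨φ, ⟨h1, h2, h3⟩, h4, h5⟩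
    refine ⟨c • φ, ⟨contDiff_const.smul h1, h2.smul_left,
      (closure_mono (Function.support_const_smul_subset c φ)).trans h3⟩, ?_, ?_⟩
    · filter_upwards [Lp.coeFn_smul c z.fst, h4] with x hx a
      rw [WithLp.smul_fst, hx, Pi.smul_apply, Pi.smul_apply, a]
    · filter_upwards [Lp.coeFn_smul c z.snd, h5] with x hx a
      rw [WithLp.smul_snd, hx, Pi.smul_apply, a, gradient, gradient,
        fderiv_const_smul (h1.differentiable (by simp) x), map_smul]

/-- `H¹₀(Ω)`: the closure of the test functions in the `H¹`-norm. An element `u` is stored as the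
pair of the function `fnOf u` and its weak gradient `gradOf u`. -/
def H10 {d : ℕ} (Ω : Set (Euc d)) : Submodule ℝ (L2Pair Ω) := (testPairs Ω).topologicalClosure

/-- The underlying `L²`-function of `u ∈ H¹₀(Ω)`. -/
def fnOf {d : ℕ} {Ω : Set (Euc d)} (u : H10 Ω) : L2 Ω := (u : L2Pair Ω).fst

/-- The weak gradient of `u ∈ H¹₀(Ω)`. -/
def gradOf {d : ℕ} {Ω : Set (Euc d)} (u : H10 Ω) : Lp (Euc d) 2 (volume.restrict Ω) :=
  (u : L2Pair Ω).snd

/-- `‖∇u‖_{L²(S)}` (only the part of `S` inside `Ω` counts). -/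
def gradNorm {d : ℕ} {Ω : Set (Euc d)} (S : Set (Euc d)) (u : H10 Ω) : ℝ :=
  Real.sqrt (∫ x in Ω ∩ S, ‖gradOf u x‖ ^ 2)

/-! ### Rectangular meshes, patches, piecewise polynomials -/

/-- The closed `d`-rectangle `∏ᵢ [aᵢ, bᵢ]`, `aᵢ < bᵢ`. -/
def cell {d : ℕ} (K : BoxIntegral.Box (Fin d)) : Set (Euc d) :=
  {x | ∀ i, x i ∈ Icc (K.lower i) (K.upper i)}

/-- `F` is a (closed, nonempty) face of `K`, of any dimension `0, …, d`. -/
def IsFace {d : ℕ} (K : BoxIntegral.Box (Fin d)) (F : Set (Euc d)) : Prop :=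
  ∃ s : Fin d → Set ℝ,
    (∀ i, s i = {K.lower i} ∨ s i = {K.upper i} ∨ s i = Icc (K.lower i) (K.upper i)) ∧
    F = {x | ∀ i, x i ∈ s i}

/-- `T` is a regular (face-to-face) decomposition of `Ω` into `d`-rectangles, all of whose side
lengths agree with the mesh size `H` up to the factor `κ` (shape regularity and
quasi-uniformity with the mesh constant `κ`). -/
structure IsRectMesh {d : ℕ} (Ω : Set (Euc d)) (H κ : ℝ)
    (T : Finset (BoxIntegral.Box (Fin d))) : Prop where
  covers : ⋃ K ∈ T, cell K = closure Ω
  interior_subset : ∀ K ∈ T, interior (cell K) ⊆ Ω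
  disjoint : ∀ K ∈ T, ∀ L ∈ T, K ≠ L → Disjoint (interior (cell K)) (interior (cell L))
  conforming : ∀ K ∈ T, ∀ L ∈ T, (cell K ∩ cell L).Nonempty →
    IsFace K (cell K ∩ cell L) ∧ IsFace L (cell K ∩ cell L)
  side_le : ∀ K ∈ T, ∀ i, K.upper i - K.lower i ≤ κ * H
  le_side : ∀ K ∈ T, ∀ i, H ≤ κ * (K.upper i - K.lower i)

/-- The one-layer patch `N(S)`: the union of all elements that touch `S`. -/
def patchOne {d : ℕ} (T : Finset (BoxIntegral.Box (Fin d))) (S : Set (Euc d)) : Set (Euc d) :=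
  ⋃ K ∈ T, ⋃ _ : (closure S ∩ cell K).Nonempty, cell K

/-- The patch `N^l(S)` of order `l`. -/
def patch {d : ℕ} (T : Finset (BoxIntegral.Box (Fin d))) (l : ℕ) (S : Set (Euc d)) :
    Set (Euc d) :=
  (patchOne T)^[l] S

/-- The space `V_H` of functions in `L²(Ω)` that coincide on every element with a polynomial of
degree at most `p` in each variable. -/
def polySpace {d : ℕ} (Ω : Set (Euc d)) (T : Finset (BoxIntegral.Box (Fin d))) (p : ℕ) :
    Submodule ℝ (L2 Ω) where
  carrier := {v | ∀ K ∈ T, ∃ q ∈ MvPolynomial.restrictDegree (Fin d) ℝ p,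
    ∀ᵐ x ∂(volume.restrict Ω), x ∈ cell K → v x = MvPolynomial.eval (fun i => x i) q}
  zero_mem' := by
    intro K _
    refine ⟨0, Submodule.zero_mem _, ?_⟩
    filter_upwards [Lp.coeFn_zero ℝ 2 (volume.restrict Ω)] with x hx _
    simpa using hx
  add_mem' := by
    intro v w hv hw K hK
    obtain ⟨q, hq, h1⟩ := hv K hK
    obtain ⟨r, hr, h2⟩ := hw K hK
    refine ⟨q + r, Submodule.add_mem _ hq hr, ?_⟩
    filter_upwards [Lp.coeFn_add v w, h1, h2] with x hx a b hxK
    rw [hx, Pi.add_apply, a hxK, b hxK, map_add]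
  smul_mem' := by
    intro c v hv K hK
    obtain ⟨q, hq, h1⟩ := hv K hK
    refine ⟨c • q, Submodule.smul_mem _ c hq, ?_⟩
    filter_upwards [Lp.coeFn_smul c v, h1] with x hx a hxK
    rw [hx, Pi.smul_apply, a hxK, MvPolynomial.smul_eval, smul_eq_mul]

/-- The fine-scale space `W`: the functions in `H¹₀(Ω)` whose `L²`-orthogonal projection onto `V_H`
vanishes, that is, which lie in the `L²`-orthogonal complement of `V_H`. -/
def fineSpace {d : ℕ} (Ω : Set (Euc d)) (T : Finset (BoxIntegral.Box (Fin d))) (p : ℕ) :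
    Set (H10 Ω) :=
  {w | fnOf w ∈ (polySpace Ω T p)ᗮ}

/-- `W(S)`: the functions in `W` with support in `S`. -/
def fineSpaceOn {d : ℕ} (Ω : Set (Euc d)) (T : Finset (BoxIntegral.Box (Fin d))) (p : ℕ)
    (S : Set (Euc d)) : Set (H10 Ω) :=
  {w | w ∈ fineSpace Ω T p ∧ ∀ᵐ x ∂(volume.restrict Ω), x ∉ S → fnOf w x = 0}

/-! ### The bilinear form and the element-wise enriched corrections -/

/-- `A ∈ L^∞(Ω)` is a scalar coefficient with `α ≤ A ≤ β` almost everywhere. -/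
def IsCoefficient {d : ℕ} (Ω : Set (Euc d)) (α β : ℝ) (A : Euc d → ℝ) : Prop :=
  AEStronglyMeasurable A (volume.restrict Ω) ∧ ∀ᵐ x ∂(volume.restrict Ω), α ≤ A x ∧ A x ≤ β

/-- `a_S(u, w) = (A ∇u, ∇w)_{L²(S)}`; the full form `a` is `energyOn A Ω`. -/
def energyOn {d : ℕ} {Ω : Set (Euc d)} (A : Euc d → ℝ) (S : Set (Euc d)) (u w : H10 Ω) : ℝ :=
  ∫ x in Ω ∩ S, A x * inner ℝ (gradOf u x) (gradOf w x)

/-- `u` solves the element-wise enriched correction problem on the patch `S` for the element `G`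
and the datum `v ∈ L²(Ω)`: `u ∈ W(S)` and `a_S(u, w) = -(v, w)_{L²(G)}` for all `w ∈ W(S)`. -/
def IsEnrichedCorrection {d : ℕ} {Ω : Set (Euc d)} (T : Finset (BoxIntegral.Box (Fin d))) (p : ℕ)
    (A : Euc d → ℝ) (S : Set (Euc d)) (G : BoxIntegral.Box (Fin d)) (v : L2 Ω) (u : H10 Ω) :
    Prop :=
  u ∈ fineSpaceOn Ω T p S ∧
    ∀ w ∈ fineSpaceOn Ω T p S, energyOn A S u w = -∫ x in Ω ∩ cell G, v x * fnOf w x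

/-- The solution of the element-wise enriched correction problem on `S`. -/
def enrichedCorrectionOn {d : ℕ} {Ω : Set (Euc d)} (T : Finset (BoxIntegral.Box (Fin d))) (p : ℕ)
    (A : Euc d → ℝ) (S : Set (Euc d)) (G : BoxIntegral.Box (Fin d)) (v : L2 Ω) : H10 Ω :=
  Classical.epsilon (IsEnrichedCorrection T p A S G v)

/-- The localized element-wise enriched correction operator `D_G^{[l]}`. -/
def locCorrection {d : ℕ} {Ω : Set (Euc d)} (T : Finset (BoxIntegral.Box (Fin d))) (p : ℕ)
    (A : Euc d → ℝ) (l : ℕ) (G : BoxIntegral.Box (Fin d)) (v : L2 Ω) : H10 Ω :=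
  enrichedCorrectionOn T p A (patch T l (cell G)) G v

/-- The global element-wise enriched correction operator `D_G = D_G^{[∞]}`. -/
def globCorrection {d : ℕ} {Ω : Set (Euc d)} (T : Finset (BoxIntegral.Box (Fin d))) (p : ℕ)
    (A : Euc d → ℝ) (G : BoxIntegral.Box (Fin d)) (v : L2 Ω) : H10 Ω :=
  enrichedCorrectionOn T p A Ω G v

end

/-!
A function in the fine-scale space has mean zero on every cell, so by Poincaré's inequality its
`L²`-norm on a cell is `O(H)` times its energy there. The fine-scale space is not stable under
multiplication by a cutoff function, but it becomes so after a correction: on every cell one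
subtracts a combination of bubbles with the same moments against polynomials of degree `≤ p` as the
truncated function. This *fine cutoff* costs only a constant factor in energy, cell by cell.

Testing the localized problem with the fine cutoff of its solution shows that the energy outside
`k + 1` layers is at most a fixed multiple of the energy in the `k + 1`-st layer, so the energy
outside `k` layers decays geometrically in `k` (hole filling). Subtracting from an arbitrary
fine-scale test function its fine cutoff gives an admissible test function for the localized
problem; hence the defect of the localized correction in the global problem only involves the
outermost layer, where the correction is exponentially small.
-/

noncomputable section

open BoxIntegral (Box)
open scoped ENNReal

section SquareIntegrable

variable {X : Type*} [MeasurableSpace X] {ν : Measure X}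

section InnerProductSpace

variable {E : Type*} [NormedAddCommGroup E] [InnerProductSpace ℝ E]

theorem norm_sq_eq_integral_norm_sq (f : Lp E 2 ν) : ‖f‖ ^ 2 = ∫ x, ‖f x‖ ^ 2 ∂ν := by
  rw [← real_inner_self_eq_norm_sq, L2.inner_def]
  simp_rw [real_inner_self_eq_norm_sq]

theorem norm_LpToLpRestrictCLM_sq (s : Set X) (f : Lp E 2 ν) :
    ‖LpToLpRestrictCLM X E ℝ ν 2 s f‖ ^ 2 = ∫ x in s, ‖f x‖ ^ 2 ∂ν := by
  rw [norm_sq_eq_integral_norm_sq]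
  exact integral_congr_ae
    ((LpToLpRestrictCLM_coeFn ℝ s f).mono fun _ hx => congrArg (‖·‖ ^ 2) hx)

theorem norm_toLp_eq_sqrt_integral {f : X → E} (hf : MemLp f 2 ν) :
    ‖hf.toLp f‖ = √(∫ x, ‖f x‖ ^ 2 ∂ν) := by
  rw [← Real.sqrt_sq (norm_nonneg _), norm_sq_eq_integral_norm_sq,
    integral_congr_ae (hf.coeFn_toLp.mono fun _ hx => congrArg (‖·‖ ^ 2) hx)]

theorem integral_norm_sq_eq_toReal_lintegral {F : Type*} [NormedAddCommGroup F] {f : X → F}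
    (hf : AEStronglyMeasurable f ν) :
    ∫ x, ‖f x‖ ^ 2 ∂ν = (∫⁻ x, ‖f x‖ₑ ^ 2 ∂ν).toReal := by
  simpa [enorm_pow] using integral_norm_eq_lintegral_enorm (hf.norm.pow 2)

theorem abs_integral_mul_le {f g : X → ℝ} (hf : MemLp f 2 ν) (hg : MemLp g 2 ν) :
    |∫ x, f x * g x ∂ν| ≤ √(∫ x, f x ^ 2 ∂ν) * √(∫ x, g x ^ 2 ∂ν) := by
  have h := abs_real_inner_le_norm (hg.toLp g) (hf.toLp f)
  rw [L2.inner_def, norm_toLp_eq_sqrt_integral, norm_toLp_eq_sqrt_integral, mul_comm] at h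
  simp only [Real.norm_eq_abs, sq_abs] at h
  refine (congrArg abs (integral_congr_ae ?_)).trans_le h
  filter_upwards [hf.coeFn_toLp, hg.coeFn_toLp] with x hfx hgx
  simp [hfx, hgx]

theorem abs_integral_mul_inner_le {A : X → ℝ} {β : ℝ} {f g : X → E} (hA : ∀ᵐ x ∂ν, |A x| ≤ β)
    (hβ : 0 ≤ β) (hf : MemLp f 2 ν) (hg : MemLp g 2 ν) :
    |∫ x, A x * inner ℝ (f x) (g x) ∂ν| ≤
      β * (√(∫ x, ‖f x‖ ^ 2 ∂ν) * √(∫ x, ‖g x‖ ^ 2 ∂ν)) :=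
  calc |∫ x, A x * inner ℝ (f x) (g x) ∂ν| ≤ ∫ x, |A x * inner ℝ (f x) (g x)| ∂ν :=
        abs_integral_le_integral_abs
    _ ≤ ∫ x, β * (‖f x‖ * ‖g x‖) ∂ν := by
        refine integral_mono_of_nonneg (ae_of_all _ fun _ => abs_nonneg _)
          ((hf.norm.integrable_mul hg.norm).const_mul β) (hA.mono fun x hx => ?_)
        simp only [abs_mul]
        exact mul_le_mul hx (abs_real_inner_le_norm _ _) (abs_nonneg _) hβ
    _ = β * ∫ x, ‖f x‖ * ‖g x‖ ∂ν := integral_const_mul _ _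
    _ ≤ _ := by gcongr; exact (le_abs_self _).trans (abs_integral_mul_le hf.norm hg.norm)

end InnerProductSpace

theorem sq_lintegral_le {f : X → ℝ≥0∞} (hf : AEMeasurable f ν) :
    (∫⁻ x, f x ∂ν) ^ 2 ≤ ν univ * ∫⁻ x, f x ^ 2 ∂ν := by
  have h := ENNReal.lintegral_mul_le_Lp_mul_Lq ν Real.HolderConjugate.two_two
    (aemeasurable_const (b := (1 : ℝ≥0∞))) hf
  simp only [Pi.mul_apply, one_mul, one_pow, lintegral_const, ENNReal.rpow_ofNat] at h
  calc (∫⁻ x, f x ∂ν) ^ 2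
      ≤ (ν univ ^ (1 / 2 : ℝ) * (∫⁻ x, f x ^ 2 ∂ν) ^ (1 / 2 : ℝ)) ^ 2 := by gcongr
    _ = ν univ * ∫⁻ x, f x ^ 2 ∂ν := by
        simp only [mul_pow, ← ENNReal.rpow_mul_natCast]; norm_num

section FiniteMeasure

variable [IsFiniteMeasure ν] {f g : X → ℝ}

theorem integral_sub_average_sq (hf : MemLp f 2 ν) :
    ∫ x, (f x - ⨍ y, f y ∂ν) ^ 2 ∂ν = (∫ x, f x ^ 2 ∂ν) - (ν.real univ)⁻¹ * (∫ x, f x ∂ν) ^ 2 := by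
  have hf₁ : Integrable f ν := hf.integrable one_le_two
  have hlin : Integrable (fun x => 2 * (f x * ⨍ y, f y ∂ν)) ν := (hf₁.mul_const _).const_mul 2
  have hquad : Integrable (fun x => f x ^ 2 + (⨍ y, f y ∂ν) ^ 2) ν :=
    hf.integrable_sq.add (integrable_const _)
  simp_rw [sub_sq', mul_assoc]
  rw [integral_sub hquad hlin, integral_add hf.integrable_sq (integrable_const _),
    integral_const_mul, integral_mul_const, integral_const, average_eq, smul_eq_mul, smul_eq_mul]
  rcases eq_or_ne (ν.real univ) 0 with h | h
  · simp [h]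
  · field_simp; ring

theorem integral_prod_sub_sq (hf : MemLp f 2 ν) :
    ∫ z, (f z.1 - f z.2) ^ 2 ∂ν.prod ν =
      2 * ν.real univ * ∫ x, (f x - ⨍ y, f y ∂ν) ^ 2 ∂ν := by
  have hf₁ : Integrable f ν := hf.integrable one_le_two
  have fst_sq : Integrable (fun z : X × X => f z.1 ^ 2) (ν.prod ν) := hf.integrable_sq.comp_fst ν
  have snd_sq : Integrable (fun z : X × X => f z.2 ^ 2) (ν.prod ν) := hf.integrable_sq.comp_snd ν
  have sum_sq : Integrable (fun z : X × X => f z.1 ^ 2 + f z.2 ^ 2) (ν.prod ν) :=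
    fst_sq.add snd_sq
  rw [integral_sub_average_sq hf]
  simp_rw [sub_sq', mul_assoc]
  rw [integral_sub sum_sq ((hf₁.mul_prod hf₁).const_mul 2), integral_add fst_sq snd_sq,
    integral_fun_fst (f := fun x => f x ^ 2), integral_fun_snd (f := fun x => f x ^ 2),
    integral_const_mul, integral_prod_mul, smul_eq_mul]
  rcases eq_or_ne (ν.real univ) 0 with h | h
  · have : ν = 0 := by simpa [measureReal_eq_zero_iff] using h
    simp [this]
  · field_simp; ring

theorem abs_integral_mul_le_of_integral_eq_zero (hf : MemLp f 2 ν) (hg : MemLp g 2 ν)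
    (h0 : ∫ x, g x ∂ν = 0) :
    |∫ x, f x * g x ∂ν| ≤ √(∫ x, (f x - ⨍ y, f y ∂ν) ^ 2 ∂ν) * √(∫ x, g x ^ 2 ∂ν) := by
  have hsub : ∫ x, f x * g x ∂ν = ∫ x, (f x - ⨍ y, f y ∂ν) * g x ∂ν := by
    simp_rw [sub_mul]
    rw [integral_sub (f := fun x => f x * g x) (hf.integrable_mul hg)
      ((hg.integrable one_le_two).const_mul _), integral_const_mul, h0, mul_zero, sub_zero]
  rw [hsub]
  exact abs_integral_mul_le (hf.sub (memLp_const _)) hg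

end FiniteMeasure

section Multiplier

variable {E F G : Type*} [NormedAddCommGroup E] [NormedSpace ℝ E] [NormedAddCommGroup F]
  [NormedSpace ℝ F] [NormedAddCommGroup G] [NormedSpace ℝ G]

theorem exists_clm_ae_eq_apply (B : E →L[ℝ] F →L[ℝ] G) {g : X → E} (hg : MemLp g ∞ ν) :
    ∃ m : Lp F 2 ν →L[ℝ] Lp G 2 ν, ∀ f, ∀ᵐ x ∂ν, m f x = B (g x) (f x) := by
  refine ⟨B.holderL ν ∞ 2 2 (hg.toLp g), fun f => ?_⟩
  filter_upwards [B.coeFn_holder (r := 2) (hg.toLp g) f, hg.coeFn_toLp] with x hx hgx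
  rw [ContinuousLinearMap.holderL_apply_apply, hx, hgx]

end Multiplier

end SquareIntegrable

/-! ### Poincaré inequality on convex sets -/

section Poincare

theorem enorm_sub_sq_le_lintegral_fderiv {E F : Type*} [NormedAddCommGroup E] [NormedSpace ℝ E]
    [NormedAddCommGroup F] [NormedSpace ℝ F] {φ : E → F} (hφ : ContDiff ℝ 1 φ) (x y : E) :
    ‖φ y - φ x‖ₑ ^ 2 ≤
      ‖y - x‖ₑ ^ 2 * ∫⁻ t in Icc (0 : ℝ) 1, ‖fderiv ℝ φ (AffineMap.lineMap x y t)‖ₑ ^ 2 := by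
  have hline : ContDiff ℝ 1 (AffineMap.lineMap x y : ℝ → E) := AffineMap.contDiff_lineMap x y
  have hderiv (t : ℝ) (ht : t ∈ Icc (0 : ℝ) 1) :
      ‖derivWithin (φ ∘ AffineMap.lineMap x y) (Icc 0 1) t‖ₑ ≤
        ‖y - x‖ₑ * ‖fderiv ℝ φ (AffineMap.lineMap x y t)‖ₑ := by
    have h : HasDerivAt (φ ∘ AffineMap.lineMap x y)
        (fderiv ℝ φ (AffineMap.lineMap x y t) (y - x)) t :=
      (hφ.differentiable one_ne_zero _).hasFDerivAt.comp_hasDerivAt t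
        AffineMap.hasDerivAt_lineMap
    rw [h.hasDerivWithinAt.derivWithin (uniqueDiffOn_Icc_zero_one t ht), mul_comm]
    exact ContinuousLinearMap.le_opENorm _ _
  have hmeas : Measurable fun t : ℝ => ‖fderiv ℝ φ (AffineMap.lineMap x y t)‖ₑ :=
    ((hφ.continuous_fderiv one_ne_zero).comp hline.continuous).enorm.measurable
  calc ‖φ y - φ x‖ₑ ^ 2
      ≤ (‖y - x‖ₑ * ∫⁻ t in Icc (0 : ℝ) 1, ‖fderiv ℝ φ (AffineMap.lineMap x y t)‖ₑ) ^ 2 := by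
        have h := enorm_sub_le_lintegral_derivWithin_Icc_of_contDiffOn_Icc
          (hφ.comp hline).contDiffOn zero_le_one
        rw [Function.comp_apply, Function.comp_apply, AffineMap.lineMap_apply_one,
          AffineMap.lineMap_apply_zero] at h
        rw [← lintegral_const_mul _ hmeas]
        gcongr
        exact h.trans (setLIntegral_mono' measurableSet_Icc hderiv)
    _ ≤ _ := by
        rw [mul_pow]
        gcongr
        simpa using sq_lintegral_le (ν := volume.restrict (Icc (0 : ℝ) 1)) hmeas.aemeasurable

variable {E : Type*} [NormedAddCommGroup E] [NormedSpace ℝ E] [FiniteDimensional ℝ E]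
  [MeasurableSpace E] [BorelSpace E] {μ : Measure E} [μ.IsAddHaarMeasure] {S : Set E}

theorem setLIntegral_lineMap_le (hS : MeasurableSet S) (hc : Convex ℝ S) {g : E → ℝ≥0∞}
    (hg : Measurable g) {t : ℝ} (ht : 1 / 2 ≤ t) (ht1 : t ≤ 1) {x : E} (hx : x ∈ S) :
    ∫⁻ y in S, g (AffineMap.lineMap x y t) ∂μ ≤
      2 ^ Module.finrank ℝ E * ∫⁻ y in S, g y ∂μ := by
  have ht0 : 0 < t := by linarith
  calc ∫⁻ y in S, g (AffineMap.lineMap x y t) ∂μ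
      = ∫⁻ y, S.indicator (fun y => g (AffineMap.lineMap x y t)) y ∂μ :=
        (lintegral_indicator hS _).symm
    _ ≤ ∫⁻ y, S.indicator g ((1 - t) • x + t • y) ∂μ := by
        refine lintegral_mono <| indicator_le fun y hy => ?_
        rw [← AffineMap.lineMap_apply_module,
          indicator_of_mem (hc.lineMap_mem hx hy ⟨ht0.le, ht1⟩)]
    _ = ∫⁻ z, S.indicator g ((1 - t) • x + z) ∂(μ.map (t • ·)) := by
        rw [lintegral_map (by fun_prop) (by fun_prop)]
    _ = ENNReal.ofReal |(t ^ Module.finrank ℝ E)⁻¹| * ∫⁻ y in S, g y ∂μ := by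
        rw [Measure.map_addHaar_smul _ ht0.ne', lintegral_smul_measure,
          lintegral_add_left_eq_self (S.indicator g), lintegral_indicator hS, smul_eq_mul]
    _ ≤ 2 ^ Module.finrank ℝ E * ∫⁻ y in S, g y ∂μ := by
        gcongr
        rw [abs_of_nonneg (by positivity), ← inv_pow, ENNReal.ofReal_pow (by positivity),
          ← ENNReal.ofReal_ofNat]
        gcongr
        exact (inv_le_comm₀ ht0 two_pos).2 (by linarith)

/-- Whichever endpoint has weight at least `1 / 2` is the one to integrate over first: the change of
variables then costs a factor of at most `2 ^ dim E`. -/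
theorem setLIntegral_prod_lineMap_le (hS : MeasurableSet S) (hc : Convex ℝ S) {g : E → ℝ≥0∞}
    (hg : Measurable g) {t : ℝ} (ht : t ∈ Icc (0 : ℝ) 1) :
    ∫⁻ z, g (AffineMap.lineMap z.1 z.2 t) ∂(μ.restrict S).prod (μ.restrict S) ≤
      2 ^ Module.finrank ℝ E * (∫⁻ y in S, g y ∂μ) * μ S := by
  have := FiniteDimensional.proper_real E
  have hgm : Measurable fun z : E × E => g (AffineMap.lineMap z.1 z.2 t) := by
    simp only [AffineMap.lineMap_apply_module]; fun_prop
  rw [← setLIntegral_const]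
  rcases le_total t (1 / 2) with h | h
  · rw [lintegral_prod_symm' _ hgm]
    refine setLIntegral_mono measurable_const fun y hy => ?_
    simp_rw [← AffineMap.lineMap_apply_one_sub y]
    exact setLIntegral_lineMap_le hS hc hg (by linarith) (by linarith [ht.1]) hy
  · rw [lintegral_prod _ hgm.aemeasurable]
    exact setLIntegral_mono measurable_const fun x hx =>
      setLIntegral_lineMap_le hS hc hg h ht.2 hx

theorem lintegral_prod_enorm_sub_sq_le {F : Type*} [NormedAddCommGroup F] [NormedSpace ℝ F]
    (hS : MeasurableSet S) (hc : Convex ℝ S) {φ : E → F} (hφ : ContDiff ℝ 1 φ) :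
    ∫⁻ z, ‖φ z.1 - φ z.2‖ₑ ^ 2 ∂(μ.restrict S).prod (μ.restrict S) ≤
      Metric.ediam S ^ 2 *
        (2 ^ Module.finrank ℝ E * (∫⁻ x in S, ‖fderiv ℝ φ x‖ₑ ^ 2 ∂μ) * μ S) := by
  have := FiniteDimensional.proper_real E
  have hφ' : Continuous fun x => ‖fderiv ℝ φ x‖ₑ ^ 2 :=
    (ENNReal.continuous_pow 2).comp (hφ.continuous_fderiv one_ne_zero).enorm
  have hmeas : Measurable fun q : (E × E) × ℝ =>
      ‖fderiv ℝ φ (AffineMap.lineMap q.1.1 q.1.2 q.2)‖ₑ ^ 2 := by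
    simp only [AffineMap.lineMap_apply_module]
    exact (hφ'.comp (by fun_prop : Continuous fun q : (E × E) × ℝ =>
      (1 - q.2) • q.1.1 + q.2 • q.1.2)).measurable
  calc ∫⁻ z, ‖φ z.1 - φ z.2‖ₑ ^ 2 ∂(μ.restrict S).prod (μ.restrict S)
      ≤ ∫⁻ z, Metric.ediam S ^ 2 *
          (∫⁻ t in Icc (0 : ℝ) 1, ‖fderiv ℝ φ (AffineMap.lineMap z.1 z.2 t)‖ₑ ^ 2)
            ∂(μ.restrict S).prod (μ.restrict S) := by
        refine lintegral_mono_ae ?_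
        rw [Measure.prod_restrict]
        filter_upwards [ae_restrict_mem (hS.prod hS)] with z hz
        rw [← edist_eq_enorm_sub, edist_comm, edist_eq_enorm_sub]
        refine (enorm_sub_sq_le_lintegral_fderiv hφ z.1 z.2).trans ?_
        gcongr
        rw [← edist_eq_enorm_sub]
        exact Metric.edist_le_ediam_of_mem hz.2 hz.1
    _ = Metric.ediam S ^ 2 * ∫⁻ t in Icc (0 : ℝ) 1,
          ∫⁻ z, ‖fderiv ℝ φ (AffineMap.lineMap z.1 z.2 t)‖ₑ ^ 2
            ∂(μ.restrict S).prod (μ.restrict S) := by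
        rw [lintegral_const_mul _ hmeas.lintegral_prod_right',
          lintegral_lintegral_swap hmeas.aemeasurable]
    _ ≤ Metric.ediam S ^ 2 * ∫⁻ _ in Icc (0 : ℝ) 1,
          2 ^ Module.finrank ℝ E * (∫⁻ x in S, ‖fderiv ℝ φ x‖ₑ ^ 2 ∂μ) * μ S := by
        gcongr Metric.ediam S ^ 2 * ?_
        exact setLIntegral_mono' measurableSet_Icc fun t ht =>
          setLIntegral_prod_lineMap_le hS hc hφ'.measurable ht
    _ = _ := by simp

theorem integral_sub_average_sq_le_integral_norm_fderiv_sq (hS : MeasurableSet S)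
    (hc : Convex ℝ S) (hb : Bornology.IsBounded S) {φ : E → ℝ} (hφ : ContDiff ℝ 1 φ) :
    ∫ x in S, (φ x - ⨍ y in S, φ y ∂μ) ^ 2 ∂μ ≤
      Metric.diam S ^ 2 * 2 ^ Module.finrank ℝ E * ∫ x in S, ‖fderiv ℝ φ x‖ ^ 2 ∂μ := by
  have := FiniteDimensional.proper_real E
  have : IsFiniteMeasure (μ.restrict S) := isFiniteMeasure_restrict.2 hb.measure_lt_top.ne
  have integrable {g : E → ℝ} (hg : Continuous g) : IntegrableOn g S μ :=
    (hg.locallyIntegrable.integrableOn_isCompact hb.isCompact_closure).mono_set subset_closure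
  have hφL2 : MemLp φ 2 (μ.restrict S) :=
    (memLp_two_iff_integrable_sq hφ.continuous.aestronglyMeasurable).2
      (integrable (hφ.continuous.pow 2))
  have hgrad : ∫⁻ x in S, ‖fderiv ℝ φ x‖ₑ ^ 2 ∂μ ≠ ∞ := by
    have h := (integrable ((hφ.continuous_fderiv one_ne_zero).norm.pow 2)).hasFiniteIntegral.ne
    simpa only [Pi.pow_apply, enorm_pow, enorm_norm] using h
  have hdiff : MemLp (fun z : E × E => φ z.1 - φ z.2) 2 ((μ.restrict S).prod (μ.restrict S)) :=
    (hφL2.comp_fst _).sub (hφL2.comp_snd _)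
  have key := ENNReal.toReal_mono
    (ENNReal.mul_ne_top (by simp [hb.ediam_ne_top])
      (ENNReal.mul_ne_top (ENNReal.mul_ne_top (by simp) hgrad) hb.measure_lt_top.ne))
    (lintegral_prod_enorm_sub_sq_le hS hc hφ)
  rw [← integral_norm_sq_eq_toReal_lintegral hdiff.aestronglyMeasurable] at key
  simp only [ENNReal.toReal_mul, ENNReal.toReal_pow, ENNReal.toReal_ofNat, Real.norm_eq_abs,
    sq_abs, integral_prod_sub_sq hφL2, ← integral_norm_sq_eq_toReal_lintegral
      (hφ.continuous_fderiv one_ne_zero).aestronglyMeasurable] at key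
  rw [measureReal_restrict_apply_univ] at key
  change _ ≤ Metric.diam S ^ 2 * (_ * μ.real S) at key
  rcases (measureReal_nonneg : 0 ≤ μ.real S).eq_or_lt with h0 | hpos
  · have : μ.restrict S = 0 := by
      rw [Measure.restrict_eq_zero, ← measureReal_eq_zero_iff hb.measure_lt_top.ne, h0]
    simp [this]
  · have h0 : 0 ≤ ∫ x in S, (φ x - ⨍ y in S, φ y ∂μ) ^ 2 ∂μ := integral_nonneg fun _ => sq_nonneg _
    refine le_of_mul_le_mul_left ?_ hpos
    nlinarith

end Poincare

variable {d : ℕ} {Ω : Set (Euc d)} {H κ : ℝ} {T S : Finset (Box (Fin d))} {K L : Box (Fin d)}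

/-! ### Geometry of rectangular meshes -/

/-- The interior `∏ᵢ (aᵢ, bᵢ)` of the cell `∏ᵢ [aᵢ, bᵢ]`. Elementwise integrals are taken over open
cells, which are pairwise disjoint and contained in `Ω`. -/
def openCell (K : Box (Fin d)) : Set (Euc d) :=
  {x | ∀ i, x i ∈ Ioo (K.lower i) (K.upper i)}

theorem cell_eq_preimage (K : Box (Fin d)) :
    cell K = EuclideanSpace.equiv (Fin d) ℝ ⁻¹' Box.Icc K := by
  rw [Box.Icc_eq_pi]
  exact Set.ext fun _ => mem_univ_pi.symm

theorem openCell_eq_preimage (K : Box (Fin d)) :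
    openCell K = EuclideanSpace.equiv (Fin d) ℝ ⁻¹' Box.Ioo K :=
  Set.ext fun _ => mem_univ_pi.symm

theorem isClosed_cell (K : Box (Fin d)) : IsClosed (cell K) := by
  rw [cell_eq_preimage]
  exact K.isCompact_Icc.isClosed.preimage (EuclideanSpace.equiv (Fin d) ℝ).continuous

theorem isOpen_openCell (K : Box (Fin d)) : IsOpen (openCell K) := by
  rw [openCell_eq_preimage]
  exact (isOpen_set_pi finite_univ fun _ _ => isOpen_Ioo).preimage
    (EuclideanSpace.equiv (Fin d) ℝ).continuous

theorem measurableSet_openCell (K : Box (Fin d)) : MeasurableSet (openCell K) :=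
  (isOpen_openCell K).measurableSet

theorem openCell_subset_cell (K : Box (Fin d)) : openCell K ⊆ cell K :=
  fun _ hx i => Ioo_subset_Icc_self (hx i)

theorem cell_nonempty (K : Box (Fin d)) : (cell K).Nonempty :=
  ⟨WithLp.toLp 2 K.lower, fun i => ⟨le_rfl, (K.lower_lt_upper i).le⟩⟩

theorem interior_cell (K : Box (Fin d)) : interior (cell K) = openCell K := by
  have h := (EuclideanSpace.equiv (Fin d) ℝ).toHomeomorph.preimage_interior (Box.Icc K)
  rw [Box.Icc_eq_pi, interior_pi_set finite_univ, ← Box.Icc_eq_pi] at h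
  simp only [interior_Icc] at h
  rw [cell_eq_preimage, openCell_eq_preimage]
  exact h.symm

theorem convex_openCell (K : Box (Fin d)) : Convex ℝ (openCell K) := by
  rw [openCell_eq_preimage]
  exact (convex_pi fun _ _ => convex_Ioo _ _).linear_preimage
    (EuclideanSpace.equiv (Fin d) ℝ).toLinearMap

theorem isBounded_openCell (K : Box (Fin d)) : Bornology.IsBounded (openCell K) := by
  refine Bornology.IsBounded.subset ?_ (openCell_subset_cell K)
  rw [cell_eq_preimage]
  exact ((EuclideanSpace.equiv (Fin d) ℝ).toHomeomorph.isCompact_preimage.2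
    K.isCompact_Icc).isBounded

theorem openCell_ae_eq_cell (K : Box (Fin d)) : openCell K =ᵐ[volume] cell K := by
  rw [openCell_eq_preimage, cell_eq_preimage]
  exact (PiLp.volume_preserving_ofLp (Fin d)).quasiMeasurePreserving.preimage_ae_eq K.Ioo_ae_eq_Icc

theorem volume_openCell (K : Box (Fin d)) :
    volume (openCell K) = ENNReal.ofReal (∏ i, (K.upper i - K.lower i)) := by
  rw [openCell_eq_preimage, ENNReal.ofReal_prod_of_nonneg
    fun i _ => sub_nonneg.2 (K.lower_le_upper i), ← Real.volume_pi_Ioo]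
  exact (PiLp.volume_preserving_ofLp (Fin d)).measure_preimage
    (MeasurableSet.univ_pi fun _ => measurableSet_Ioo).nullMeasurableSet

theorem ae_mem_openCell_of_mem_cell (K : Box (Fin d)) :
    ∀ᵐ x ∂volume.restrict Ω, x ∈ cell K → x ∈ openCell K :=
  ae_restrict_of_ae (openCell_ae_eq_cell K).symm.le

namespace IsRectMesh

theorem openCell_subset (hT : IsRectMesh Ω H κ T) (hK : K ∈ T) : openCell K ⊆ Ω := by
  rw [← interior_cell]
  exact hT.interior_subset K hK

theorem pairwiseDisjoint_openCell (hT : IsRectMesh Ω H κ T) :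
    (T : Set (Box (Fin d))).PairwiseDisjoint openCell := fun K hK L hL h => by
  simpa only [interior_cell] using hT.disjoint K hK L hL h

theorem eq_of_mem_openCell (hT : IsRectMesh Ω H κ T) (hK : K ∈ T) (hL : L ∈ T) {x : Euc d}
    (hxK : x ∈ openCell K) (hxL : x ∈ openCell L) : K = L :=
  hT.pairwiseDisjoint_openCell.elim hK hL (not_disjoint_iff.2 ⟨x, hxK, hxL⟩)

theorem exists_mem_cell (hT : IsRectMesh Ω H κ T) {x : Euc d} (hx : x ∈ Ω) :
    ∃ K ∈ T, x ∈ cell K := by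
  have h := subset_closure hx
  rw [← hT.covers] at h
  simpa using h

theorem inter_biUnion_ae_eq (hT : IsRectMesh Ω H κ T) (hS : S ⊆ T) :
    (Ω ∩ ⋃ K ∈ S, cell K : Set (Euc d)) =ᵐ[volume] ⋃ K ∈ S, openCell K := by
  have h : (⋃ K ∈ S, openCell K : Set (Euc d)) =ᵐ[volume] ⋃ K ∈ S, cell K :=
    .countable_bUnion S.countable_toSet fun K _ => openCell_ae_eq_cell K
  have hΩ : (⋃ K ∈ S, openCell K) ⊆ Ω := iUnion₂_subset fun K hK => hT.openCell_subset (hS hK)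
  rw [← inter_eq_right.2 hΩ]
  exact (ae_eq_refl _).inter h.symm

theorem ae_eq_biUnion (hT : IsRectMesh Ω H κ T) : Ω =ᵐ[volume] ⋃ K ∈ T, openCell K := by
  have h := hT.inter_biUnion_ae_eq Finset.Subset.rfl
  rwa [hT.covers, inter_eq_left.2 subset_closure] at h

theorem ae_openCell (hT : IsRectMesh Ω H κ T) (hK : K ∈ T) {q : Euc d → Prop}
    (h : ∀ᵐ x ∂volume.restrict Ω, q x) : ∀ᵐ x ∂volume.restrict (openCell K), q x :=
  ae_restrict_of_ae_restrict_of_subset (hT.openCell_subset hK) h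

theorem ae_of_forall_openCell (hT : IsRectMesh Ω H κ T) {q : Euc d → Prop}
    (h : ∀ K ∈ T, ∀ᵐ x ∂volume.restrict (openCell K), q x) : ∀ᵐ x ∂volume.restrict Ω, q x := by
  rwa [Measure.restrict_congr_set hT.ae_eq_biUnion, ae_restrict_biUnion_finset_iff]

theorem setIntegral_biUnion (hT : IsRectMesh Ω H κ T) (hS : S ⊆ T) {g : Euc d → ℝ}
    (hg : IntegrableOn g Ω) :
    ∫ x in Ω ∩ ⋃ K ∈ S, cell K, g x = ∑ K ∈ S, ∫ x in openCell K, g x := by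
  rw [setIntegral_congr_set (hT.inter_biUnion_ae_eq hS)]
  exact integral_biUnion_finset S (fun K _ => measurableSet_openCell K)
    (hT.pairwiseDisjoint_openCell.subset (by exact_mod_cast hS))
    fun K hK => hg.mono_set (hT.openCell_subset (hS hK))

theorem setIntegral_eq_sum (hT : IsRectMesh Ω H κ T) {g : Euc d → ℝ} (hg : IntegrableOn g Ω) :
    ∫ x in Ω, g x = ∑ K ∈ T, ∫ x in openCell K, g x := by
  rw [← hT.setIntegral_biUnion Finset.Subset.rfl hg, hT.covers, inter_eq_left.2 subset_closure]

theorem diam_openCell_sq_le (hT : IsRectMesh Ω H κ T) (hK : K ∈ T) :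
    Metric.diam (openCell K) ^ 2 ≤ d * (κ * H) ^ 2 := by
  rw [← Real.le_sqrt Metric.diam_nonneg (by positivity)]
  refine Metric.diam_le_of_forall_dist_le (Real.sqrt_nonneg _) fun x hx y hy => ?_
  rw [EuclideanSpace.dist_eq]
  refine Real.sqrt_le_sqrt ?_
  calc ∑ i, dist (x i) (y i) ^ 2 ≤ ∑ _i : Fin d, (κ * H) ^ 2 := by
        gcongr with i
        exact (Real.dist_le_of_mem_Icc (Ioo_subset_Icc_self (hx i))
          (Ioo_subset_Icc_self (hy i))).trans (hT.side_le K hK i)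
    _ = d * (κ * H) ^ 2 := by simp

theorem le_volume_openCell (hT : IsRectMesh Ω H κ T) (hH : 0 < H) (hκ : 0 < κ) (hK : K ∈ T) :
    ENNReal.ofReal ((H / κ) ^ d) ≤ volume (openCell K) := by
  rw [volume_openCell]
  refine ENNReal.ofReal_le_ofReal ?_
  calc (H / κ) ^ d = ∏ _i : Fin d, H / κ := by rw [Finset.prod_const, Finset.card_fin]
    _ ≤ ∏ i, (K.upper i - K.lower i) := Finset.prod_le_prod (fun i _ => by positivity)
        fun i _ => (div_le_iff₀' hκ).2 (hT.le_side K hK i)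

theorem card_mul_le (hT : IsRectMesh Ω H κ T) (hH : 0 < H) (hκ : 0 < κ) (hS : S ⊆ T) (x : Euc d)
    {R : ℝ} (hR : ∀ K ∈ S, ∀ y ∈ openCell K, ∀ i, |y i - x i| ≤ R) (hR0 : 0 ≤ R) :
    S.card * (H / κ) ^ d ≤ (2 * R) ^ d := by
  have hcube : (⋃ K ∈ S, openCell K) ⊆ EuclideanSpace.equiv (Fin d) ℝ ⁻¹'
      Icc (fun i => x i - R) (fun i => x i + R) := iUnion₂_subset fun K hK y hy =>
    ⟨fun i => sub_le_of_abs_sub_le_left (hR K hK y hy i),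
      fun i => sub_le_iff_le_add'.1 (abs_sub_le_iff.1 (hR K hK y hy i)).1⟩
  have hvol : volume (EuclideanSpace.equiv (Fin d) ℝ ⁻¹'
      Icc (fun i => x i - R) (fun i => x i + R)) = ENNReal.ofReal ((2 * R) ^ d) := by
    rw [ENNReal.ofReal_pow (by positivity)]
    refine ((PiLp.volume_preserving_ofLp (Fin d)).measure_preimage
      measurableSet_Icc.nullMeasurableSet).trans ?_
    simp [Real.volume_Icc_pi, two_mul]
  have h := calc S.card • ENNReal.ofReal ((H / κ) ^ d)
      ≤ ∑ K ∈ S, volume (openCell K) :=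
        Finset.card_nsmul_le_sum S _ _ fun K hK => hT.le_volume_openCell hH hκ (hS hK)
    _ = volume (⋃ K ∈ S, openCell K) :=
        (measure_biUnion_finset (hT.pairwiseDisjoint_openCell.subset (by exact_mod_cast hS))
          fun K _ => measurableSet_openCell K).symm
    _ ≤ ENNReal.ofReal ((2 * R) ^ d) := hvol ▸ measure_mono hcube
  rw [nsmul_eq_mul, ← ENNReal.ofReal_natCast, ← ENNReal.ofReal_mul (by positivity)] at h
  exact (ENNReal.ofReal_le_ofReal_iff (by positivity)).1 h

end IsRectMesh

/-! ### Mesh-adapted cutoff functions -/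

/-- The largest slope of `Real.smoothTransition`; it enters all gradient bounds for cutoffs. -/
def smoothTransitionSlope : ℝ := ⨆ t, |deriv Real.smoothTransition t|

theorem differentiable_smoothTransition : Differentiable ℝ Real.smoothTransition :=
  (Real.smoothTransition.contDiff (n := 1)).differentiable one_ne_zero

theorem hasCompactSupport_deriv_smoothTransition :
    HasCompactSupport (deriv Real.smoothTransition) := by
  refine HasCompactSupport.intro (isCompact_Icc (a := (0 : ℝ)) (b := 1)) fun t ht => ?_
  rcases lt_or_ge t 0 with h | h
  · have : Real.smoothTransition =ᶠ[nhds t] fun _ => 0 := by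
      filter_upwards [Iio_mem_nhds h] with s hs
      exact Real.smoothTransition.zero_of_nonpos (le_of_lt hs)
    rw [this.deriv_eq, deriv_const]
  · have : Real.smoothTransition =ᶠ[nhds t] fun _ => 1 := by
      filter_upwards [Ioi_mem_nhds (not_le.1 fun h' => ht ⟨h, h'⟩)] with s hs
      exact Real.smoothTransition.one_of_one_le (le_of_lt hs)
    rw [this.deriv_eq, deriv_const]

theorem abs_deriv_smoothTransition_le (t : ℝ) :
    |deriv Real.smoothTransition t| ≤ smoothTransitionSlope := by
  refine le_ciSup (f := fun t => |deriv Real.smoothTransition t|) ?_ t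
  obtain ⟨M, hM⟩ := hasCompactSupport_deriv_smoothTransition.exists_bound_of_continuous
    ((Real.smoothTransition.contDiff (n := 1)).continuous_deriv le_rfl)
  exact ⟨M, forall_mem_range.2 hM⟩

theorem smoothTransitionSlope_nonneg : 0 ≤ smoothTransitionSlope :=
  (abs_nonneg _).trans (abs_deriv_smoothTransition_le 0)

theorem norm_fderiv_prod_le {E ι : Type*} [NormedAddCommGroup E] [NormedSpace ℝ E] {s : Finset ι}
    {f : ι → E → ℝ} {C : ι → ℝ} {x : E} (hd : ∀ i ∈ s, DifferentiableAt ℝ (f i) x)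
    (h1 : ∀ i ∈ s, |f i x| ≤ 1) (hC : ∀ i ∈ s, ‖fderiv ℝ (f i) x‖ ≤ C i) :
    ‖fderiv ℝ (fun y => ∏ i ∈ s, f i y) x‖ ≤ ∑ i ∈ s, C i := by
  classical
  rw [(HasFDerivAt.finsetProd fun i hi => (hd i hi).hasFDerivAt).fderiv]
  refine norm_sum_le_of_le _ fun i hi => ?_
  rw [norm_smul, Real.norm_eq_abs, Finset.abs_prod]
  refine (mul_le_of_le_one_left (norm_nonneg _) ?_).trans (hC i hi)
  exact Finset.prod_le_one (fun _ _ => abs_nonneg _) fun j hj => h1 j (Finset.mem_of_mem_erase hj)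

/-- A smooth function of one variable that is `1` on `[a, b]` and `0` at distance `≥ 1 / c`. -/
def plateau (c a b t : ℝ) : ℝ :=
  Real.smoothTransition (1 + c * (t - a)) * Real.smoothTransition (1 + c * (b - t))

section Plateau

variable {c a b t : ℝ}

theorem plateau_nonneg : 0 ≤ plateau c a b t :=
  mul_nonneg (Real.smoothTransition.nonneg _) (Real.smoothTransition.nonneg _)

theorem plateau_le_one : plateau c a b t ≤ 1 :=
  mul_le_one₀ (Real.smoothTransition.le_one _) (Real.smoothTransition.nonneg _)
    (Real.smoothTransition.le_one _)

theorem plateau_eq_one (hc : 0 ≤ c) (h : t ∈ Icc a b) : plateau c a b t = 1 := by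
  rw [plateau, Real.smoothTransition.one_of_one_le, Real.smoothTransition.one_of_one_le, mul_one]
  exacts [le_add_of_nonneg_right (mul_nonneg hc (sub_nonneg.2 h.2)),
    le_add_of_nonneg_right (mul_nonneg hc (sub_nonneg.2 h.1))]

theorem plateau_eq_zero (h : 1 ≤ c * (a - t) ∨ 1 ≤ c * (t - b)) : plateau c a b t = 0 := by
  rcases h with h | h
  · rw [plateau, Real.smoothTransition.zero_of_nonpos (by linarith), zero_mul]
  · rw [plateau, mul_comm, Real.smoothTransition.zero_of_nonpos (by linarith), zero_mul]

theorem contDiff_plateau {n : ℕ∞} : ContDiff ℝ n (plateau c a b) :=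
  (Real.smoothTransition.contDiff.comp (by fun_prop)).mul
    (Real.smoothTransition.contDiff.comp (by fun_prop))

theorem abs_deriv_plateau_le (hc : 0 ≤ c) :
    |deriv (plateau c a b) t| ≤ 2 * smoothTransitionSlope * c := by
  have hd (s : ℝ) := (differentiable_smoothTransition s).hasDerivAt
  have hleft : HasDerivAt (fun t => Real.smoothTransition (1 + c * (t - a)))
      (deriv Real.smoothTransition (1 + c * (t - a)) * c) t :=
    (hd _).comp t (by simpa using (((hasDerivAt_id t).sub_const a).const_mul c).const_add 1)
  have hright : HasDerivAt (fun t => Real.smoothTransition (1 + c * (b - t)))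
      (deriv Real.smoothTransition (1 + c * (b - t)) * -c) t :=
    (hd _).comp t (by simpa using (((hasDerivAt_id t).const_sub b).const_mul c).const_add 1)
  have habs (s : ℝ) : |Real.smoothTransition s| ≤ 1 := by
    rw [abs_of_nonneg (Real.smoothTransition.nonneg s)]
    exact Real.smoothTransition.le_one s
  rw [show deriv (plateau c a b) t = _ from (hleft.mul hright).deriv]
  refine (abs_add_le _ _).trans ?_
  simp only [abs_mul, abs_neg, abs_of_nonneg hc]
  calc _ ≤ smoothTransitionSlope * c * 1 + 1 * (smoothTransitionSlope * c) := by
        have := smoothTransitionSlope_nonneg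
        gcongr <;> first | exact abs_deriv_smoothTransition_le _ | exact habs _
    _ = 2 * smoothTransitionSlope * c := by ring

end Plateau

/-- A smooth function on `ℝ^d` that is `1` on `K` and `0` at distance `≥ 1 / c` in the sup-norm. -/
def boxPlateau (c : ℝ) (K : Box (Fin d)) (x : Euc d) : ℝ :=
  ∏ i, plateau c (K.lower i) (K.upper i) (x i)

section BoxPlateau

variable {c : ℝ} {x : Euc d}

theorem boxPlateau_nonneg : 0 ≤ boxPlateau c K x :=
  Finset.prod_nonneg fun _ _ => plateau_nonneg

theorem boxPlateau_le_one : boxPlateau c K x ≤ 1 :=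
  Finset.prod_le_one (fun _ _ => plateau_nonneg) fun _ _ => plateau_le_one

theorem boxPlateau_eq_one (hc : 0 ≤ c) (hx : x ∈ cell K) : boxPlateau c K x = 1 :=
  Finset.prod_eq_one fun i _ => plateau_eq_one hc (hx i)

theorem boxPlateau_eq_zero {i : Fin d}
    (h : 1 ≤ c * (K.lower i - x i) ∨ 1 ≤ c * (x i - K.upper i)) : boxPlateau c K x = 0 :=
  Finset.prod_eq_zero (Finset.mem_univ i) (plateau_eq_zero h)

theorem contDiff_boxPlateau {n : ℕ∞} : ContDiff ℝ n (boxPlateau c K) :=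
  contDiff_prod fun _ _ => contDiff_plateau.comp (by fun_prop)

theorem norm_fderiv_comp_coord_le {f : ℝ → ℝ} {i : Fin d} (hf : DifferentiableAt ℝ f (x i)) :
    ‖fderiv ℝ (fun y : Euc d => f (y i)) x‖ ≤ |deriv f (x i)| := by
  have h : HasFDerivAt (fun y : Euc d => f (y i))
      (deriv f (x i) • (EuclideanSpace.proj i : Euc d →L[ℝ] ℝ)) x :=
    hf.hasDerivAt.comp_hasFDerivAt x (EuclideanSpace.proj i : Euc d →L[ℝ] ℝ).hasFDerivAt
  rw [h.fderiv, norm_smul]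
  refine mul_le_of_le_one_right (norm_nonneg _) ?_
  exact ContinuousLinearMap.opNorm_le_bound _ zero_le_one fun y => by
    simpa using PiLp.norm_apply_le y i

theorem norm_fderiv_boxPlateau_le (hc : 0 ≤ c) :
    ‖fderiv ℝ (boxPlateau c K) x‖ ≤ d * (2 * smoothTransitionSlope * c) := by
  have hdiff (a b : ℝ) : Differentiable ℝ (plateau c a b) :=
    (contDiff_plateau (n := 1)).differentiable one_ne_zero
  refine (norm_fderiv_prod_le (C := fun _ => 2 * smoothTransitionSlope * c) (fun i _ => ?_)
    (fun i _ => ?_) fun i _ => ?_).trans_eq (by simp)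
  · exact (hdiff _ _ (x i)).comp x (EuclideanSpace.proj i : Euc d →L[ℝ] ℝ).differentiableAt
  · exact (abs_of_nonneg plateau_nonneg).trans_le plateau_le_one
  · exact (norm_fderiv_comp_coord_le (hdiff _ _ _)).trans (abs_deriv_plateau_le hc)

end BoxPlateau

theorem mem_patchOne_cell {x : Euc d} :
    x ∈ patchOne T (cell K) ↔ ∃ M ∈ T, (cell K ∩ cell M).Nonempty ∧ x ∈ cell M := by
  simp [patchOne, (isClosed_cell K).closure_eq, and_left_comm]

theorem isClosed_patchOne (T : Finset (Box (Fin d))) (S : Set (Euc d)) :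
    IsClosed (patchOne T S) :=
  T.finite_toSet.isClosed_biUnion fun _ _ => isClosed_iUnion_of_finite fun _ => isClosed_cell _

theorem exists_separating_coord (h : Disjoint (cell K) (cell L)) :
    ∃ i, L.upper i < K.lower i ∨ K.upper i < L.lower i := by
  by_contra! hle
  refine h.notMem_of_mem_left (a := WithLp.toLp 2 (K.lower ⊔ L.lower))
    (fun i => ⟨le_max_left _ _, ?_⟩) fun i => ⟨le_max_right _ _, ?_⟩
  · exact max_le (K.lower_le_upper i) (hle i).2
  · exact max_le (hle i).1 (L.lower_le_upper i)

theorem IsFace.coord_trichotomy (hface : IsFace L (cell K ∩ cell L))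
    (hKL : (cell K ∩ cell L).Nonempty) (i : Fin d) :
    K.upper i ≤ L.lower i ∨ L.upper i ≤ K.lower i ∨
      Icc (L.lower i) (L.upper i) ⊆ Icc (K.lower i) (K.upper i) := by
  obtain ⟨s, hs, hF⟩ := hface
  obtain ⟨y, hy⟩ := hKL
  have update_mem {t : Fin d → Set ℝ} (hyt : ∀ j, y j ∈ t j) (r : ℝ) :
      (∀ j, Function.update (y : Fin d → ℝ) i r j ∈ t j) ↔ r ∈ t i := by
    simpa using update_mem_pi_iff_of_mem (i := i) (b := r) (mem_univ_pi.2 hyt)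
  have mem_s (r : ℝ) : r ∈ s i ↔
      r ∈ Icc (K.lower i) (K.upper i) ∧ r ∈ Icc (L.lower i) (L.upper i) := by
    rw [← update_mem hy.1, ← update_mem hy.2, ← update_mem (hF ▸ hy : y ∈ {x | ∀ i, x i ∈ s i})]
    exact (Set.ext_iff.1 hF (WithLp.toLp 2 (Function.update y i r))).symm
  have hK := hy.1 i
  have hL := hy.2 i
  have hKi := K.lower_lt_upper i
  have hLi := L.lower_lt_upper i
  rcases hs i with h | h | h <;> rw [h] at mem_s
  · have hmin := (mem_s (min (K.upper i) (L.upper i))).2 (by grind)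
    grind
  · have hmax := (mem_s (max (K.lower i) (L.lower i))).2 (by grind)
    grind
  · exact Or.inr (Or.inr fun r hr => ((mem_s r).1 hr).1)

namespace IsRectMesh

theorem le_dist_coord_of_disjoint (hT : IsRectMesh Ω H κ T) (hκ : 0 < κ) {M : Box (Fin d)}
    (hK : K ∈ T) (hL : L ∈ T) (hM : M ∈ T) {x : Euc d} (hxM : x ∈ cell M) (hxL : x ∈ cell L)
    (hKM : (cell K ∩ cell M).Nonempty) (hKL : Disjoint (cell K) (cell L)) :
    ∃ i, H / κ ≤ K.lower i - x i ∨ H / κ ≤ x i - K.upper i := by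
  obtain ⟨i, hi⟩ := exists_separating_coord hKL
  have hLM : (cell L ∩ cell M).Nonempty := ⟨x, hxL, hxM⟩
  have side := (div_le_iff₀' hκ).2 (hT.le_side M hM i)
  have KM_coord := (hT.conforming K hK M hM hKM).2.coord_trichotomy hKM i
  have LM_coord := (hT.conforming L hL M hM hLM).2.coord_trichotomy hLM i
  rw [Icc_subset_Icc_iff (M.lower_le_upper i)] at KM_coord LM_coord
  obtain ⟨y, hyK, hyM⟩ := hKM
  have hyKi := hyK i
  have hyMi := hyM i
  have hxMi := hxM i
  have hxLi := hxL i
  refine ⟨i, ?_⟩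
  grind

end IsRectMesh

open Classical in
/-- The plateau function of the cell `K`, cut off outside the patch of `K`. On a face-to-face mesh
with parameters `H`, `κ` this does not destroy its smoothness in `Ω`. -/
def hat (H κ : ℝ) (T : Finset (Box (Fin d))) (K : Box (Fin d)) (x : Euc d) : ℝ :=
  if x ∈ patchOne T (cell K) then boxPlateau (2 * κ / H) K x else 0

theorem hat_nonneg {x : Euc d} : 0 ≤ hat H κ T K x := by
  unfold hat; split_ifs
  exacts [boxPlateau_nonneg, le_rfl]

theorem hat_le_one {x : Euc d} : hat H κ T K x ≤ 1 := by
  unfold hat; split_ifs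
  exacts [boxPlateau_le_one, zero_le_one]

theorem hat_eq_one (hH : 0 < H) (hκ : 0 < κ) (hK : K ∈ T) {x : Euc d} (hx : x ∈ cell K) :
    hat H κ T K x = 1 := by
  rw [hat, if_pos (mem_patchOne_cell.2 ⟨K, hK, ⟨x, hx, hx⟩, hx⟩),
    boxPlateau_eq_one (by positivity) hx]

/-- The smooth function that vanishes on the cells in `S` and is `1` on the cells away from them. -/
def cutoff (H κ : ℝ) (T S : Finset (Box (Fin d))) (x : Euc d) : ℝ :=
  ∏ K ∈ S, (1 - hat H κ T K x)

/-- The constant in the gradient bound for cutoffs: `(4 κ²) ^ d` bounds the number of hat functions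
that do not vanish at a point, the other factor the gradient of a single one. -/
def cutoffSlope (d : ℕ) (κ : ℝ) : ℝ :=
  (4 * κ ^ 2) ^ d * (d * (2 * smoothTransitionSlope * (2 * κ)))

theorem cutoff_nonneg {x : Euc d} : 0 ≤ cutoff H κ T S x :=
  Finset.prod_nonneg fun _ _ => sub_nonneg.2 hat_le_one

theorem cutoff_le_one {x : Euc d} : cutoff H κ T S x ≤ 1 :=
  Finset.prod_le_one (fun _ _ => sub_nonneg.2 hat_le_one) fun _ _ => sub_le_self _ hat_nonneg

theorem cutoff_eq_zero (hH : 0 < H) (hκ : 0 < κ) (hS : S ⊆ T) (hK : K ∈ S) {x : Euc d}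
    (hx : x ∈ cell K) : cutoff H κ T S x = 0 :=
  Finset.prod_eq_zero hK (by rw [hat_eq_one hH hκ (hS hK) hx, sub_self])

namespace IsRectMesh

theorem boxPlateau_eventually_zero (hT : IsRectMesh Ω H κ T) (hH : 0 < H) (hκ : 0 < κ)
    {x : Euc d} (hK : K ∈ T) (hL : L ∈ T) (hxK : x ∈ patchOne T (cell K)) (hxL : x ∈ cell L)
    (hKL : Disjoint (cell K) (cell L)) : ∀ᶠ y in nhds x, boxPlateau (2 * κ / H) K y = 0 := by
  obtain ⟨M, hM, hKM, hxM⟩ := mem_patchOne_cell.1 hxK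
  obtain ⟨i, hi⟩ := hT.le_dist_coord_of_disjoint hκ hK hL hM hxM hxL hKM hKL
  have hpos : 0 < H / κ := by positivity
  have hcont : ContinuousAt (fun y : Euc d => y i) x := by fun_prop
  have one_le {r : ℝ} (hr : H / κ / 2 < r) : 1 ≤ 2 * κ / H * r :=
    calc (1 : ℝ) = 2 * κ / H * (H / κ / 2) := by field_simp
      _ ≤ 2 * κ / H * r := by gcongr
  rcases hi with hi | hi
  · have h : ∀ᶠ y in nhds x, y i < K.lower i - H / κ / 2 :=
      hcont.eventually_lt_const (by linarith)
    filter_upwards [h] with y hy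
    exact boxPlateau_eq_zero (i := i) (Or.inl (one_le (by linarith)))
  · have h : ∀ᶠ y in nhds x, K.upper i + H / κ / 2 < y i :=
      hcont.eventually_const_lt (by linarith)
    filter_upwards [h] with y hy
    exact boxPlateau_eq_zero (i := i) (Or.inr (one_le (by linarith)))

theorem hat_eq_zero (hT : IsRectMesh Ω H κ T) (hH : 0 < H) (hκ : 0 < κ) (hK : K ∈ T) (hL : L ∈ T)
    {x : Euc d} (hxL : x ∈ cell L) (hKL : Disjoint (cell K) (cell L)) : hat H κ T K x = 0 := by
  unfold hat
  split_ifs with h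
  · exact (hT.boxPlateau_eventually_zero hH hκ hK hL h hxL hKL).self_of_nhds
  · rfl

theorem eventually_mem_patchOne (hT : IsRectMesh Ω H κ T) (hΩ : IsOpen Ω) {x : Euc d} (hx : x ∈ Ω)
    (hxK : ∀ L ∈ T, x ∈ cell L → (cell K ∩ cell L).Nonempty) :
    ∀ᶠ y in nhds x, y ∈ patchOne T (cell K) := by
  have hcell : ∀ᶠ y in nhds x, ∀ L ∈ T, y ∈ cell L → x ∈ cell L := by
    refine (Filter.eventually_all_finset T).2 fun L _ => ?_
    by_cases hxL : x ∈ cell L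
    · exact Filter.Eventually.of_forall fun _ _ => hxL
    · filter_upwards [(isClosed_cell L).isOpen_compl.mem_nhds hxL] with y hy hy'
      exact absurd hy' hy
  filter_upwards [hcell, hΩ.mem_nhds hx] with y hy hyΩ
  obtain ⟨L, hL, hyL⟩ := hT.exists_mem_cell hyΩ
  exact mem_patchOne_cell.2 ⟨L, hL, hxK L hL (hy L hL hyL), hyL⟩

theorem hat_eventuallyEq (hT : IsRectMesh Ω H κ T) (hΩ : IsOpen Ω) (hH : 0 < H) (hκ : 0 < κ)
    (hK : K ∈ T) {x : Euc d} (hx : x ∈ Ω) :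
    (hat H κ T K =ᶠ[nhds x] fun _ => 0) ∨
      (hat H κ T K =ᶠ[nhds x] boxPlateau (2 * κ / H) K ∧ x ∈ patchOne T (cell K)) := by
  by_cases hxK : x ∈ patchOne T (cell K)
  · by_cases hfar : ∃ L ∈ T, x ∈ cell L ∧ Disjoint (cell K) (cell L)
    · obtain ⟨L, hL, hxL, hKL⟩ := hfar
      left
      filter_upwards [hT.boxPlateau_eventually_zero hH hκ hK hL hxK hxL hKL] with y hy
      unfold hat; split_ifs
      exacts [hy, rfl]
    · simp only [not_exists, not_and, not_disjoint_iff_nonempty_inter] at hfar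
      refine Or.inr ⟨?_, hxK⟩
      filter_upwards [hT.eventually_mem_patchOne hΩ hx hfar] with y hy
      exact if_pos hy
  · left
    filter_upwards [(isClosed_patchOne T (cell K)).isOpen_compl.mem_nhds hxK] with y hy
    exact if_neg hy

theorem contDiffAt_hat (hT : IsRectMesh Ω H κ T) (hΩ : IsOpen Ω) (hH : 0 < H) (hκ : 0 < κ)
    (hK : K ∈ T) {x : Euc d} (hx : x ∈ Ω) {n : ℕ∞} : ContDiffAt ℝ n (hat H κ T K) x := by
  rcases hT.hat_eventuallyEq hΩ hH hκ hK hx with h | ⟨h, -⟩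
  · exact contDiffAt_const.congr_of_eventuallyEq h
  · exact contDiff_boxPlateau.contDiffAt.congr_of_eventuallyEq h

theorem fderiv_hat_eq_zero (hT : IsRectMesh Ω H κ T) (hΩ : IsOpen Ω) (hH : 0 < H) (hκ : 0 < κ)
    (hK : K ∈ T) {x : Euc d} (hx : x ∈ Ω) (hxK : x ∉ patchOne T (cell K)) :
    fderiv ℝ (hat H κ T K) x = 0 := by
  rcases hT.hat_eventuallyEq hΩ hH hκ hK hx with h | ⟨-, h⟩
  · rw [h.fderiv_eq, fderiv_fun_const, Pi.zero_apply]
  · exact absurd h hxK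

theorem norm_fderiv_hat_le (hT : IsRectMesh Ω H κ T) (hΩ : IsOpen Ω) (hH : 0 < H) (hκ : 0 < κ)
    (hK : K ∈ T) {x : Euc d} (hx : x ∈ Ω) :
    ‖fderiv ℝ (hat H κ T K) x‖ ≤ d * (2 * smoothTransitionSlope * (2 * κ / H)) := by
  have := smoothTransitionSlope_nonneg
  rcases hT.hat_eventuallyEq hΩ hH hκ hK hx with h | ⟨h, -⟩
  · rw [h.fderiv_eq, fderiv_fun_const, Pi.zero_apply, norm_zero]
    positivity
  · rw [h.fderiv_eq]
    exact norm_fderiv_boxPlateau_le (by positivity)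

theorem abs_sub_coord_le_of_mem_patchOne (hT : IsRectMesh Ω H κ T) (hK : K ∈ T) {x y : Euc d}
    (hx : x ∈ patchOne T (cell K)) (hy : y ∈ cell K) (i : Fin d) : |y i - x i| ≤ 2 * κ * H := by
  obtain ⟨M, hM, ⟨z, hzK, hzM⟩, hxM⟩ := mem_patchOne_cell.1 hx
  have hyz := Real.dist_le_of_mem_Icc (hy i) (hzK i)
  have hzx := Real.dist_le_of_mem_Icc (hzM i) (hxM i)
  rw [← Real.dist_eq]
  linarith [dist_triangle (y i) (z i) (x i), hT.side_le K hK i, hT.side_le M hM i]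

theorem card_patchOne_le (hT : IsRectMesh Ω H κ T) (hH : 0 < H) (hκ : 0 < κ) (hS : S ⊆ T)
    {x : Euc d} (hx : ∀ K ∈ S, x ∈ patchOne T (cell K)) : (S.card : ℝ) ≤ (4 * κ ^ 2) ^ d := by
  have h := hT.card_mul_le hH hκ hS x (R := 2 * κ * H) (fun K hK y hy i =>
    hT.abs_sub_coord_le_of_mem_patchOne (hS hK) (hx K hK) (openCell_subset_cell K hy) i)
    (by positivity)
  have hscale : 2 * (2 * κ * H) = 4 * κ ^ 2 * (H / κ) := by field_simp; ring
  rw [hscale, mul_pow] at h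
  exact le_of_mul_le_mul_right h (by positivity)

theorem contDiffAt_cutoff (hT : IsRectMesh Ω H κ T) (hΩ : IsOpen Ω) (hH : 0 < H) (hκ : 0 < κ)
    (hS : S ⊆ T) {x : Euc d} (hx : x ∈ Ω) {n : ℕ∞} : ContDiffAt ℝ n (cutoff H κ T S) x :=
  contDiffAt_prod fun _ hK => contDiffAt_const.sub (hT.contDiffAt_hat hΩ hH hκ (hS hK) hx)

theorem norm_fderiv_cutoff_le (hT : IsRectMesh Ω H κ T) (hΩ : IsOpen Ω) (hH : 0 < H) (hκ : 0 < κ)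
    (hS : S ⊆ T) {x : Euc d} (hx : x ∈ Ω) :
    ‖fderiv ℝ (cutoff H κ T S) x‖ ≤ cutoffSlope d κ / H := by
  classical
  have := smoothTransitionSlope_nonneg
  set M := d * (2 * smoothTransitionSlope * (2 * κ / H)) with hM
  calc ‖fderiv ℝ (cutoff H κ T S) x‖
      ≤ ∑ K ∈ S, if x ∈ patchOne T (cell K) then M else 0 := by
        refine norm_fderiv_prod_le (fun K hK => ?_) (fun K _ => ?_) fun K hK => ?_
        · exact (contDiffAt_const.sub (hT.contDiffAt_hat (n := 1) hΩ hH hκ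
            (hS hK) hx)).differentiableAt (by simp)
        · rw [abs_of_nonneg (sub_nonneg.2 hat_le_one)]
          exact sub_le_self _ hat_nonneg
        · rw [fderiv_const_sub, norm_neg]
          split_ifs with h
          · exact hT.norm_fderiv_hat_le hΩ hH hκ (hS hK) hx
          · rw [hT.fderiv_hat_eq_zero hΩ hH hκ (hS hK) hx h, norm_zero]
    _ = (S.filter fun K => x ∈ patchOne T (cell K)).card * M := by
        rw [← Finset.sum_filter, Finset.sum_const, nsmul_eq_mul]
    _ ≤ (4 * κ ^ 2) ^ d * M := by
        gcongr
        exact hT.card_patchOne_le hH hκ ((Finset.filter_subset _ _).trans hS)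
          fun K hK => (Finset.mem_filter.1 hK).2
    _ = cutoffSlope d κ / H := by rw [hM, cutoffSlope]; ring

theorem cutoff_eq_one (hT : IsRectMesh Ω H κ T) (hH : 0 < H) (hκ : 0 < κ) (hS : S ⊆ T)
    (hK : K ∈ T) (hKS : ∀ L ∈ S, Disjoint (cell L) (cell K)) {x : Euc d} (hx : x ∈ cell K) :
    cutoff H κ T S x = 1 :=
  Finset.prod_eq_one fun L hL => by
    rw [hT.hat_eq_zero hH hκ (hS hL) hK hx (hKS L hL), sub_zero]

end IsRectMesh

/-! ### Calculus in `H¹₀(Ω)` -/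

section Gradient

variable {φ : Euc d → ℝ}

theorem inner_gradient (φ : Euc d → ℝ) (x v : Euc d) :
    inner ℝ (gradient φ x) v = fderiv ℝ φ x v := by
  rw [gradient, InnerProductSpace.toDual_symm_apply]

theorem norm_gradient (φ : Euc d → ℝ) (x : Euc d) : ‖gradient φ x‖ = ‖fderiv ℝ φ x‖ := by
  rw [gradient, LinearIsometryEquiv.norm_map]

theorem continuous_gradient (hφ : ContDiff ℝ 1 φ) : Continuous (gradient φ) :=
  (InnerProductSpace.toDual ℝ (Euc d)).symm.continuous.comp (hφ.continuous_fderiv one_ne_zero)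

theorem hasCompactSupport_gradient (hφ : HasCompactSupport φ) : HasCompactSupport (gradient φ) :=
  (hφ.fderiv ℝ).comp_left (map_zero (InnerProductSpace.toDual ℝ (Euc d)).symm)

end Gradient

namespace IsTestFunction

variable {φ ψ : Euc d → ℝ}

theorem contDiff_one (hφ : IsTestFunction Ω φ) : ContDiff ℝ 1 φ :=
  hφ.1.of_le (by exact_mod_cast le_top)

theorem differentiable (hφ : IsTestFunction Ω φ) : Differentiable ℝ φ :=
  hφ.contDiff_one.differentiable one_ne_zero

theorem eq_zero_of_notMem (hφ : IsTestFunction Ω φ) {x : Euc d} (hx : x ∉ Ω) : φ x = 0 :=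
  image_eq_zero_of_notMem_tsupport fun h => hx (hφ.2.2 h)

theorem fderiv_eq_zero_of_notMem (hφ : IsTestFunction Ω φ) {x : Euc d} (hx : x ∉ Ω) :
    fderiv ℝ φ x = 0 :=
  fderiv_of_notMem_tsupport (𝕜 := ℝ) fun h => hx (hφ.2.2 h)

theorem mono (hφ : IsTestFunction Ω φ) {Ω' : Set (Euc d)} (h : Ω ⊆ Ω') : IsTestFunction Ω' φ :=
  ⟨hφ.1, hφ.2.1, hφ.2.2.trans h⟩

theorem memLp (hφ : IsTestFunction Ω φ) : MemLp φ 2 :=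
  hφ.1.continuous.memLp_of_hasCompactSupport hφ.2.1

theorem memLp_gradient (hφ : IsTestFunction Ω φ) : MemLp (gradient φ) 2 :=
  (continuous_gradient hφ.contDiff_one).memLp_of_hasCompactSupport
    (hasCompactSupport_gradient hφ.2.1)

theorem continuous_fderiv_apply (hφ : IsTestFunction Ω φ) (e : Euc d) :
    Continuous fun x => fderiv ℝ φ x e :=
  (hφ.contDiff_one.continuous_fderiv one_ne_zero).clm_apply continuous_const

/-- A test function as an element of `H¹₀(Ω)`. -/
def toH10 (hφ : IsTestFunction Ω φ) : H10 Ω :=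
  ⟨WithLp.toLp 2 ((hφ.memLp.restrict Ω).toLp φ, (hφ.memLp_gradient.restrict Ω).toLp (gradient φ)),
    subset_closure
      ⟨φ, hφ, (hφ.memLp.restrict Ω).coeFn_toLp, (hφ.memLp_gradient.restrict Ω).coeFn_toLp⟩⟩

theorem fnOf_toH10 (hφ : IsTestFunction Ω φ) : fnOf hφ.toH10 =ᵐ[volume.restrict Ω] φ :=
  (hφ.memLp.restrict Ω).coeFn_toLp

theorem gradOf_toH10 (hφ : IsTestFunction Ω φ) :
    gradOf hφ.toH10 =ᵐ[volume.restrict Ω] gradient φ :=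
  (hφ.memLp_gradient.restrict Ω).coeFn_toLp

theorem mul_of_contDiffAt {θ : Euc d → ℝ} (hθ : ∀ x ∈ Ω, ContDiffAt ℝ (⊤ : ℕ∞) θ x)
    (hφ : IsTestFunction Ω φ) : IsTestFunction Ω (fun x => θ x * φ x) := by
  refine ⟨contDiff_iff_contDiffAt.2 fun x => ?_, hφ.2.1.mul_left,
    tsupport_mul_subset_right.trans hφ.2.2⟩
  by_cases hx : x ∈ tsupport φ
  · exact (hθ x (hφ.2.2 hx)).mul hφ.1.contDiffAt
  · have hzero : (fun y => θ y * φ y) =ᶠ[nhds x] fun _ => 0 := by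
      filter_upwards [notMem_tsupport_iff_eventuallyEq.1 hx] with y hy
      simp only [hy, Pi.zero_apply, mul_zero]
    exact contDiffAt_const.congr_of_eventuallyEq hzero

theorem const_mul (hφ : IsTestFunction Ω φ) (c : ℝ) : IsTestFunction Ω (fun x => c * φ x) :=
  hφ.mul_of_contDiffAt fun _ _ => contDiffAt_const

theorem add (hφ : IsTestFunction Ω φ) (hψ : IsTestFunction Ω ψ) : IsTestFunction Ω (φ + ψ) :=
  ⟨hφ.1.add hψ.1, hφ.2.1.add hψ.2.1, (tsupport_add _ _).trans (union_subset hφ.2.2 hψ.2.2)⟩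

theorem sum {ι : Type*} {s : Finset ι} {φ : ι → Euc d → ℝ} (h : ∀ i ∈ s, IsTestFunction Ω (φ i)) :
    IsTestFunction Ω (fun x => ∑ i ∈ s, φ i x) := by
  have hzero : IsTestFunction Ω (0 : Euc d → ℝ) :=
    ⟨contDiff_zero_fun, HasCompactSupport.zero, by simp [tsupport, Function.support]⟩
  simpa only [Finset.sum_fn] using
    Finset.sum_induction φ (IsTestFunction Ω) (fun _ _ => add) hzero h

theorem integral_fderiv_mul_add_integral_mul_fderiv (hφ : IsTestFunction Ω φ)
    (hψ : IsTestFunction Ω ψ) (e : Euc d) :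
    (∫ x, fderiv ℝ ψ x e * φ x) + ∫ x, ψ x * fderiv ℝ φ x e = 0 := by
  have hφ' := hφ.continuous_fderiv_apply e
  have hψ' := hψ.continuous_fderiv_apply e
  rw [integral_mul_fderiv_eq_neg_fderiv_mul_of_integrable, add_neg_cancel]
  · exact (hψ'.mul hφ.1.continuous).integrable_of_hasCompactSupport hφ.2.1.mul_left
  · exact (hψ.1.continuous.mul hφ').integrable_of_hasCompactSupport hψ.2.1.mul_right
  · exact (hψ.1.continuous.mul hφ.1.continuous).integrable_of_hasCompactSupport hψ.2.1.mul_right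
  · exact fun x _ => hψ.differentiable x
  · exact fun x _ => hφ.differentiable x

end IsTestFunction

theorem fnOf_sub (u v : H10 Ω) : fnOf (u - v) = fnOf u - fnOf v := rfl

theorem gradOf_sub (u v : H10 Ω) : gradOf (u - v) = gradOf u - gradOf v := rfl

namespace H10

theorem mem_of_isClosed (u : H10 Ω) {P : Set (L2Pair Ω)} (hP : IsClosed P)
    (h : ∀ z ∈ testPairs Ω, z ∈ P) : (u : L2Pair Ω) ∈ P :=
  closure_minimal (s := (testPairs Ω : Set (L2Pair Ω))) h hP u.2

theorem exists_mul (hΩ : IsOpen Ω) {θ : Euc d → ℝ} {B L : ℝ}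
    (hθ : ∀ x ∈ Ω, ContDiffAt ℝ (⊤ : ℕ∞) θ x) (hB : ∀ x ∈ Ω, |θ x| ≤ B)
    (hL : ∀ x ∈ Ω, ‖fderiv ℝ θ x‖ ≤ L) (u : H10 Ω) :
    ∃ u' : H10 Ω, (∀ᵐ x ∂volume.restrict Ω, fnOf u' x = θ x * fnOf u x) ∧
      ∀ᵐ x ∂volume.restrict Ω, gradOf u' x = θ x • gradOf u x + fnOf u x • gradient θ x := by
  have hsmooth : ContDiffOn ℝ (⊤ : ℕ∞) θ Ω := fun x hx => (hθ x hx).contDiffWithinAt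
  have hθ_top : MemLp θ ∞ (volume.restrict Ω) :=
    memLp_top_of_bound (hsmooth.continuousOn.aestronglyMeasurable hΩ.measurableSet) B
      ((ae_restrict_mem hΩ.measurableSet).mono hB)
  have hgrad : ContinuousOn (gradient θ) Ω :=
    (InnerProductSpace.toDual ℝ (Euc d)).symm.continuous.comp_continuousOn
      (hsmooth.continuousOn_fderiv_of_isOpen hΩ (by simp))
  have hgrad_top : MemLp (gradient θ) ∞ (volume.restrict Ω) :=
    memLp_top_of_bound (hgrad.aestronglyMeasurable hΩ.measurableSet) L <|
      (ae_restrict_mem hΩ.measurableSet).mono fun x hx => (norm_gradient θ x).trans_le (hL x hx)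
  obtain ⟨m₁, hm₁⟩ := exists_clm_ae_eq_apply (.lsmul ℝ ℝ : ℝ →L[ℝ] ℝ →L[ℝ] ℝ) hθ_top
  obtain ⟨m₂, hm₂⟩ := exists_clm_ae_eq_apply (.lsmul ℝ ℝ : ℝ →L[ℝ] Euc d →L[ℝ] Euc d) hθ_top
  obtain ⟨m₃, hm₃⟩ :=
    exists_clm_ae_eq_apply (.lsmul ℝ ℝ : ℝ →L[ℝ] Euc d →L[ℝ] Euc d).flip hgrad_top
  have hm₂₃ (z : L2Pair Ω) : ∀ᵐ x ∂volume.restrict Ω, (m₂ z.snd + m₃ z.fst : Lp _ _ _) x =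
      θ x • z.snd x + z.fst x • gradient θ x := by
    filter_upwards [hm₂ z.snd, hm₃ z.fst, Lp.coeFn_add (m₂ z.snd) (m₃ z.fst)] with x h₂ h₃ hadd
    rw [hadd, Pi.add_apply, h₂, h₃]; rfl
  let m : L2Pair Ω → L2Pair Ω := fun z => WithLp.toLp 2 (m₁ z.fst, m₂ z.snd + m₃ z.fst)
  have hm : Continuous m := (WithLp.prod_continuous_toLp 2 _ _).comp (by fun_prop)
  refine ⟨⟨m u, map_mem_closure (s := (testPairs Ω : Set (L2Pair Ω))) hm u.2 ?_⟩,
    hm₁ _, hm₂₃ u⟩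
  rintro z ⟨φ, hφ, hz₁, hz₂⟩
  refine ⟨fun x => θ x * φ x, hφ.mul_of_contDiffAt hθ, ?_, ?_⟩
  · filter_upwards [hm₁ z.fst, hz₁] with x hx hφx
    exact hx.trans (congrArg (θ x * ·) hφx)
  · filter_upwards [hm₂₃ z, hz₁, hz₂, ae_restrict_mem hΩ.measurableSet] with x hx hφx hgx hxΩ
    refine hx.trans ?_
    rw [hφx, hgx, gradient, gradient, gradient, fderiv_fun_mul
      ((hθ x hxΩ).differentiableAt (by simp)) (hφ.differentiable x), map_add, map_smul, map_smul]

theorem integral_fderiv_mul_add_integral_mul_inner (u : H10 Ω) {ψ : Euc d → ℝ}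
    (hψ : IsTestFunction Ω ψ) (e : Euc d) :
    (∫ x in Ω, fderiv ℝ ψ x e * fnOf u x) + ∫ x in Ω, ψ x * inner ℝ e (gradOf u x) = 0 := by
  have hψ₁ : MemLp (fun x => fderiv ℝ ψ x e) 2 (volume.restrict Ω) :=
    ((hψ.continuous_fderiv_apply e).memLp_of_hasCompactSupport
      (hψ.2.1.fderiv_apply ℝ e)).restrict Ω
  have hψ₂ : MemLp (fun x => ψ x • e) 2 (volume.restrict Ω) :=
    ((hψ.1.continuous.smul continuous_const).memLp_of_hasCompactSupport hψ.2.1.smul_right).restrict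
      Ω
  have inner₁ (f : L2 Ω) : inner ℝ (hψ₁.toLp _) f = ∫ x in Ω, fderiv ℝ ψ x e * f x := by
    rw [L2.inner_def]
    refine integral_congr_ae (hψ₁.coeFn_toLp.mono fun x hx => ?_)
    simp only [hx, RCLike.inner_apply', conj_trivial]
  have inner₂ (f : Lp (Euc d) 2 (volume.restrict Ω)) :
      inner ℝ (hψ₂.toLp _) f = ∫ x in Ω, ψ x * inner ℝ e (f x) := by
    rw [L2.inner_def]
    refine integral_congr_ae (hψ₂.coeFn_toLp.mono fun x hx => ?_)
    simp only [hx, real_inner_smul_left]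
  rw [← inner₁, ← inner₂]
  refine H10.mem_of_isClosed u
    (P := {z | inner ℝ (hψ₁.toLp _) z.fst + inner ℝ (hψ₂.toLp _) z.snd = 0})
    (isClosed_eq (by fun_prop) continuous_const) ?_
  rintro z ⟨φ, hφ, hz₁, hz₂⟩
  have hfst : ∫ x in Ω, fderiv ℝ ψ x e * z.fst x = ∫ x, fderiv ℝ ψ x e * φ x :=
    (integral_congr_ae (hz₁.mono fun x hx => congrArg (fderiv ℝ ψ x e * ·) hx)).trans <|
      setIntegral_eq_integral_of_forall_compl_eq_zero fun x hx => by
        simp only [hφ.eq_zero_of_notMem hx, mul_zero]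
  have hsnd : ∫ x in Ω, ψ x * inner ℝ e (z.snd x) = ∫ x, ψ x * fderiv ℝ φ x e := by
    rw [← setIntegral_eq_integral_of_forall_compl_eq_zero (s := Ω)
      (f := fun x => ψ x * fderiv ℝ φ x e) fun x hx => by rw [hψ.eq_zero_of_notMem hx, zero_mul]]
    refine integral_congr_ae (hz₂.mono fun x hx => ?_)
    simp only [hx, real_inner_comm (gradient φ x) e, inner_gradient]
  rw [mem_ofPred_eq, inner₁, inner₂, hfst, hsnd,
    hφ.integral_fderiv_mul_add_integral_mul_fderiv hψ e]

theorem gradOf_ae_eq_zero (u : H10 Ω) {O : Set (Euc d)} (hO : IsOpen O) (hOΩ : O ⊆ Ω)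
    (h : ∀ᵐ x ∂volume.restrict O, fnOf u x = 0) : ∀ᵐ x ∂volume.restrict O, gradOf u x = 0 := by
  have hmem : MemLp (gradOf u) 2 (volume.restrict O) :=
    (Lp.memLp (gradOf u)).mono_measure (Measure.restrict_mono_set volume hOΩ)
  have hint : LocallyIntegrableOn (gradOf u) O :=
    locallyIntegrableOn_of_locallyIntegrable_restrict (hmem.locallyIntegrable one_le_two)
  rw [ae_restrict_iff' hO.measurableSet]
  refine hO.ae_eq_zero_of_integral_contDiff_smul_eq_zero hint fun g hg hg_supp hgO => ?_
  have hgtO : IsTestFunction O g := ⟨hg, hg_supp, hgO⟩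
  have hgt : IsTestFunction Ω g := hgtO.mono hOΩ
  rw [← setIntegral_eq_integral_of_forall_compl_eq_zero fun x hx => by
    rw [hgt.eq_zero_of_notMem hx, zero_smul]]
  have hi : IntegrableOn (fun x => g x • gradOf u x) Ω :=
    memLp_one_iff_integrable.1 ((Lp.memLp (gradOf u)).smul (q := 2) (hgt.memLp.restrict Ω))
  refine ext_inner_left ℝ fun e => ?_
  have hzero : ∫ x in Ω, fderiv ℝ g x e * fnOf u x = 0 := by
    refine integral_eq_zero_of_ae (ae_restrict_of_ae ?_)
    filter_upwards [(ae_restrict_iff' hO.measurableSet).1 h] with x hx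
    by_cases hxO : x ∈ O
    · simp only [hx hxO, mul_zero, Pi.zero_apply]
    · simp only [hgtO.fderiv_eq_zero_of_notMem hxO, zero_apply, zero_mul, Pi.zero_apply]
  rw [← integral_inner hi, inner_zero_right]
  simpa only [hzero, zero_add, real_inner_smul_right] using
    integral_fderiv_mul_add_integral_mul_inner u hgt e

theorem gradOf_ae_eq {u v : H10 Ω} {O : Set (Euc d)} (hO : IsOpen O) (hOΩ : O ⊆ Ω)
    (h : ∀ᵐ x ∂volume.restrict O, fnOf u x = fnOf v x) :
    ∀ᵐ x ∂volume.restrict O, gradOf u x = gradOf v x := by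
  have hle := ae_mono (Measure.restrict_mono_set volume hOΩ)
  have hsub : ∀ᵐ x ∂volume.restrict O, gradOf (u - v) x = 0 := by
    refine gradOf_ae_eq_zero _ hO hOΩ ?_
    filter_upwards [h, hle (Lp.coeFn_sub (fnOf u) (fnOf v))] with x hx hxs
    rw [fnOf_sub, hxs, Pi.sub_apply, hx, sub_self]
  filter_upwards [hsub, hle (Lp.coeFn_sub (gradOf u) (gradOf v))] with x hx hxs
  rwa [gradOf_sub, hxs, Pi.sub_apply, sub_eq_zero] at hx

theorem integral_sub_average_sq_le (u : H10 Ω) {S : Set (Euc d)} (hS : MeasurableSet S)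
    (hSΩ : S ⊆ Ω) (hc : Convex ℝ S) (hb : Bornology.IsBounded S) :
    ∫ x in S, (fnOf u x - ⨍ y in S, fnOf u y) ^ 2 ≤
      Metric.diam S ^ 2 * 2 ^ d * ∫ x in S, ‖gradOf u x‖ ^ 2 := by
  have hfin : volume S ≠ ∞ := hb.measure_lt_top.ne
  have : IsFiniteMeasure (volume.restrict S) := isFiniteMeasure_restrict.2 hfin
  have hrestrict : (volume.restrict Ω).restrict S = volume.restrict S :=
    Measure.restrict_restrict_of_subset hSΩ
  have hfinΩ : volume.restrict Ω S ≠ ∞ := ((Measure.restrict_apply_le _ _).trans_lt hfin.lt_top).ne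
  let R₁ := LpToLpRestrictCLM (Euc d) ℝ ℝ (volume.restrict Ω) 2 S
  let R₂ := LpToLpRestrictCLM (Euc d) (Euc d) ℝ (volume.restrict Ω) 2 S
  let ι : L2 Ω := indicatorConstLp 2 hS hfinΩ 1
  have hR₁ (f : L2 Ω) : ∫ x in S, (f x - ⨍ y in S, f y) ^ 2 =
      ‖R₁ f‖ ^ 2 - (volume.real S)⁻¹ * inner ℝ ι f ^ 2 := by
    rw [integral_sub_average_sq ((Lp.memLp f).mono_measure (Measure.restrict_mono_set _ hSΩ)),
      measureReal_restrict_apply_univ, norm_LpToLpRestrictCLM_sq, L2.inner_indicatorConstLp_one,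
      hrestrict]
    simp only [Real.norm_eq_abs, sq_abs]
  have hR₂ (f : Lp (Euc d) 2 (volume.restrict Ω)) : ∫ x in S, ‖f x‖ ^ 2 = ‖R₂ f‖ ^ 2 := by
    rw [norm_LpToLpRestrictCLM_sq, hrestrict]
  rw [hR₁, hR₂]
  refine H10.mem_of_isClosed u
    (P := {z | ‖R₁ z.fst‖ ^ 2 - (volume.real S)⁻¹ * inner ℝ ι z.fst ^ 2 ≤
      Metric.diam S ^ 2 * 2 ^ d * ‖R₂ z.snd‖ ^ 2}) (isClosed_le (by fun_prop) (by fun_prop)) ?_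
  rintro z ⟨φ, hφ, hz₁, hz₂⟩
  replace hz₁ := ae_restrict_of_ae_restrict_of_subset hSΩ hz₁
  replace hz₂ := ae_restrict_of_ae_restrict_of_subset hSΩ hz₂
  have hφS := integral_sub_average_sq_le_integral_norm_fderiv_sq (μ := volume) hS hc hb
    hφ.contDiff_one
  rw [finrank_euclideanSpace_fin] at hφS
  rw [mem_ofPred_eq, ← hR₁, ← hR₂, average_congr hz₁,
    integral_congr_ae (hz₁.mono fun x hx => congrArg (fun t => (t - _) ^ 2) hx),
    integral_congr_ae (hz₂.mono fun x hx => congrArg (‖·‖ ^ 2) hx)]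
  simpa only [norm_gradient] using hφS

end H10

/-! ### Moments and bubbles -/

/-- The value of a polynomial in `d` variables at a point of `ℝ^d`. -/
abbrev polyEval (q : MvPolynomial (Fin d) ℝ) (x : Euc d) : ℝ := MvPolynomial.eval (fun i => x i) q

/-- The space `Q_p` of polynomials in `d` variables of degree at most `p` in each variable. -/
abbrev tensorPoly (d p : ℕ) : Submodule ℝ (MvPolynomial (Fin d) ℝ) :=
  MvPolynomial.restrictDegree (Fin d) ℝ p

variable {p : ℕ} {φ : Euc d → ℝ} {q : MvPolynomial (Fin d) ℝ}

theorem contDiff_polyEval (q : MvPolynomial (Fin d) ℝ) {n : ℕ∞} : ContDiff ℝ n (polyEval q) := by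
  unfold polyEval
  simp_rw [MvPolynomial.eval_eq']
  exact ContDiff.sum fun s _ => contDiff_const.mul
    (contDiff_prod fun i _ => ContDiff.pow (by fun_prop) _)

theorem continuous_polyEval (q : MvPolynomial (Fin d) ℝ) : Continuous (polyEval q) :=
  (contDiff_polyEval q (n := 0)).continuous

theorem memLp_polyEval (q : MvPolynomial (Fin d) ℝ) (K : Box (Fin d)) :
    MemLp (polyEval q) 2 (volume.restrict (openCell K)) := by
  have : IsFiniteMeasure (volume.restrict (openCell K)) :=
    isFiniteMeasure_restrict.2 (isBounded_openCell K).measure_lt_top.ne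
  obtain ⟨B, hB⟩ := (isBounded_openCell K).isCompact_closure.exists_bound_of_continuousOn
    (continuous_polyEval q).continuousOn
  refine MemLp.of_bound (continuous_polyEval q).aestronglyMeasurable B ?_
  filter_upwards [ae_restrict_mem (measurableSet_openCell K)] with x hx
  exact hB x (subset_closure hx)

theorem bind₁_mem_restrictDegree {σ R : Type*} [Finite σ] [DecidableEq σ] [CommSemiring R]
    {g : σ → MvPolynomial σ R} (hg : ∀ i j, (g i).degreeOf j ≤ if i = j then 1 else 0)
    {f : MvPolynomial σ R} (hf : f ∈ MvPolynomial.restrictDegree σ R p) :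
    MvPolynomial.bind₁ g f ∈ MvPolynomial.restrictDegree σ R p := by
  have := Fintype.ofFinite σ
  rw [MvPolynomial.bind₁, MvPolynomial.aeval_def, MvPolynomial.eval₂_eq']
  refine Submodule.sum_mem _ fun s hs => (MvPolynomial.mem_restrictDegree _ _ _).2 fun t ht j => ?_
  refine (MvPolynomial.degreeOf_le_iff.1 ?_ t ht).trans
    ((MvPolynomial.mem_restrictDegree _ _ _).1 hf s hs j)
  calc _ ≤ ∑ i, (g i ^ s i).degreeOf j :=
        (MvPolynomial.degreeOf_C_mul_le _ _ _).trans (MvPolynomial.degreeOf_prod_le _ _ _)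
    _ ≤ ∑ i, s i * if i = j then 1 else 0 := Finset.sum_le_sum fun i _ =>
        (MvPolynomial.degreeOf_pow_le _ _ _).trans (Nat.mul_le_mul_left _ (hg i j))
    _ = s j := by simp

theorem exists_comp_affine_mem_tensorPoly (hq : q ∈ tensorPoly d p) (a c : Fin d → ℝ) :
    ∃ q' ∈ tensorPoly d p, ∀ x : Euc d,
      polyEval q' x = polyEval q (WithLp.toLp 2 fun i => a i + c i * x i) := by
  let g (i : Fin d) : MvPolynomial (Fin d) ℝ :=
    MvPolynomial.C (a i) + MvPolynomial.C (c i) * MvPolynomial.X i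
  have hg (i j : Fin d) : (g i).degreeOf j ≤ if i = j then 1 else 0 := by
    refine (MvPolynomial.degreeOf_add_le _ _ _).trans (max_le (by simp) ?_)
    refine (MvPolynomial.degreeOf_C_mul_le _ _ _).trans ?_
    simp [MvPolynomial.degreeOf_X, eq_comm]
  refine ⟨MvPolynomial.bind₁ g q, bind₁_mem_restrictDegree hg hq, fun x => ?_⟩
  rw [polyEval, ← MvPolynomial.aeval_eq_eval, MvPolynomial.aeval_bind₁]
  simp [polyEval, g, MvPolynomial.aeval_eq_eval]

theorem IsTestFunction.mul_polyEval (hφ : IsTestFunction Ω φ) (q : MvPolynomial (Fin d) ℝ) :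
    IsTestFunction Ω (fun x => φ x * polyEval q x) :=
  ⟨hφ.1.mul (contDiff_polyEval q), hφ.2.1.mul_right, tsupport_mul_subset_left.trans hφ.2.2⟩

theorem IsTestFunction.integrable (hφ : IsTestFunction Ω φ) : Integrable φ :=
  hφ.1.continuous.integrable_of_hasCompactSupport hφ.2.1

/-- The unit cube `[0, 1]^d`, the reference cell. -/
def unitBox (d : ℕ) : Box (Fin d) := ⟨0, 1, fun _ => zero_lt_one⟩

/-- The cube `[1/3, 2/3]^d`, on which the weight of the moments equals one. -/
def middleBox (d : ℕ) : Box (Fin d) := ⟨fun _ => 1 / 3, fun _ => 2 / 3, fun _ => by norm_num⟩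

/-- The weight of the moments: a smooth function with compact support in the unit cube that equals
one on its middle third. -/
def momentWeight (d : ℕ) : Euc d → ℝ := boxPlateau 6 (middleBox d)

theorem isTestFunction_momentWeight : IsTestFunction (openCell (unitBox d)) (momentWeight d) := by
  let B : Box (Fin d) := ⟨fun _ => 1 / 6, fun _ => 5 / 6, fun _ => by norm_num⟩
  have hB : cell B ⊆ openCell (unitBox d) := fun x hx i => by
    have := hx i
    simp only [B, unitBox, mem_Icc, mem_Ioo, Pi.zero_apply, Pi.one_apply] at this ⊢
    constructor <;> linarith
  have h0 (x) (hx : x ∉ cell B) : momentWeight d x = 0 := by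
    simp only [cell, mem_ofPred_eq, not_forall, mem_Icc, not_and_or, not_le, B] at hx
    obtain ⟨i, hi⟩ := hx
    refine boxPlateau_eq_zero (i := i) ?_
    simp only [middleBox]
    exact hi.imp (fun _ => by linarith) (fun _ => by linarith)
  have hsupp : tsupport (momentWeight d) ⊆ cell B :=
    closure_minimal (fun x hx => by_contra fun h => hx (h0 x h)) (isClosed_cell B)
  exact ⟨contDiff_boxPlateau, .intro' ((Metric.isCompact_of_isClosed_isBounded
    (isClosed_cell B) ((isBounded_openCell (unitBox d)).subset hB))) (isClosed_cell B)
    fun {x} => h0 x, hsupp.trans hB⟩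

theorem integrable_momentWeight_mul (r q : MvPolynomial (Fin d) ℝ) :
    Integrable fun x : Euc d => momentWeight d x * polyEval r x * polyEval q x :=
  ((isTestFunction_momentWeight.mul_polyEval r).mul_polyEval q).integrable

/-- The weighted `L²` inner product on `Q_p`, as a map from `Q_p` to its dual. -/
def momentForm (d p : ℕ) : tensorPoly d p →ₗ[ℝ] Module.Dual ℝ (tensorPoly d p) :=
  LinearMap.mk₂ ℝ (fun r q => ∫ x, momentWeight d x * polyEval r.1 x * polyEval q.1 x)
    (fun r r' q => by
      rw [← integral_add (integrable_momentWeight_mul _ _) (integrable_momentWeight_mul _ _)]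
      simp [polyEval, mul_add, add_mul])
    (fun c r q => by
      rw [smul_eq_mul, ← integral_const_mul]
      simp [polyEval, MvPolynomial.smul_eval, mul_assoc, mul_left_comm])
    (fun r q q' => by
      rw [← integral_add (integrable_momentWeight_mul _ _) (integrable_momentWeight_mul _ _)]
      simp [polyEval, mul_add])
    (fun c r q => by
      rw [smul_eq_mul, ← integral_const_mul]
      simp [polyEval, MvPolynomial.smul_eval, mul_left_comm])

theorem eq_zero_of_integral_momentWeight_mul_self
    (h : ∫ x, momentWeight d x * polyEval q x * polyEval q x = 0) : q = 0 := by
  rw [integral_eq_zero_iff_of_nonneg (fun x => by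
    rw [mul_assoc]
    exact mul_nonneg boxPlateau_nonneg (mul_self_nonneg (polyEval q x)))
    (integrable_momentWeight_mul q q)] at h
  have hzero := (Continuous.ae_eq_iff_eq volume ((isTestFunction_momentWeight.mul_polyEval
    q).mul_polyEval q).1.continuous continuous_zero).1 h
  refine MvPolynomial.funext_set (fun _ => Icc (1 / 3 : ℝ) (2 / 3))
    (fun _ => Icc_infinite (by norm_num)) fun y hy => ?_
  have hy' : (WithLp.toLp 2 y : Euc d) ∈ cell (middleBox d) := fun i => hy i (mem_univ i)
  have hy0 := congrFun hzero (WithLp.toLp 2 y)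
  rw [momentWeight, boxPlateau_eq_one (by norm_num) hy'] at hy0
  simpa using hy0

theorem momentForm_surjective (d p : ℕ) : Function.Surjective (momentForm d p) :=
  (LinearMap.injective_iff_surjective_of_finrank_eq_finrank Subspace.dual_finrank_eq.symm).1
    ((injective_iff_map_eq_zero _).2 fun r hr => Subtype.ext
      (eq_zero_of_integral_momentWeight_mul_self (LinearMap.congr_fun hr r)))

/-- The index set of a basis of `Q_p`. -/
abbrev PolyIndex (d p : ℕ) : Type := Fin (Module.finrank ℝ (tensorPoly d p))

/-- A basis of `Q_p`. -/
def polyBasis (d p : ℕ) : Module.Basis (PolyIndex d p) ℝ (tensorPoly d p) :=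
  Module.finBasis ℝ (tensorPoly d p)

/-- Smooth functions with compact support in the unit cube that are `L²`-dual to `polyBasis`. -/
def dualBubble (d p : ℕ) (j : PolyIndex d p) (x : Euc d) : ℝ :=
  momentWeight d x * polyEval (momentForm_surjective d p ((polyBasis d p).coord j)).choose.1 x

theorem isTestFunction_dualBubble (j : PolyIndex d p) :
    IsTestFunction (openCell (unitBox d)) (dualBubble d p j) :=
  isTestFunction_momentWeight.mul_polyEval _

theorem sum_integral_dualBubble_mul (hq : q ∈ tensorPoly d p) (x : Euc d) :
    ∑ j, (∫ y, dualBubble d p j y * polyEval q y) * polyEval (polyBasis d p j).1 x =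
      polyEval q x := by
  have hcoord (j) : ∫ y, dualBubble d p j y * polyEval q y = (polyBasis d p).repr ⟨q, hq⟩ j :=
    LinearMap.congr_fun (momentForm_surjective d p ((polyBasis d p).coord j)).choose_spec ⟨q, hq⟩
  have hrepr : ∑ j, (polyBasis d p).repr ⟨q, hq⟩ j • (polyBasis d p j).1 = q :=
    (Submodule.coe_sum _ _ _).symm.trans (congrArg Subtype.val ((polyBasis d p).sum_repr ⟨q, hq⟩))
  conv_rhs => rw [← hrepr]
  simp only [hcoord, polyEval, map_sum, MvPolynomial.smul_eval]

/-- The linear part of the affine bijection from `K` onto the unit cube. -/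
def boxScale (K : Box (Fin d)) : Euc d →L[ℝ] Euc d :=
  (EuclideanSpace.equiv (Fin d) ℝ).symm.toContinuousLinearMap.comp
    (ContinuousLinearMap.pi fun i => (K.upper i - K.lower i)⁻¹ • EuclideanSpace.proj i)

/-- The affine bijection from `K` onto the unit cube. -/
def toUnit (K : Box (Fin d)) (x : Euc d) : Euc d := boxScale K (x - WithLp.toLp 2 K.lower)

/-- The inverse of `toUnit K`. -/
def fromUnit (K : Box (Fin d)) (y : Euc d) : Euc d :=
  WithLp.toLp 2 fun i => K.lower i + (K.upper i - K.lower i) * y i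

theorem boxScale_apply (K : Box (Fin d)) (x : Euc d) (i : Fin d) :
    boxScale K x i = (K.upper i - K.lower i)⁻¹ * x i := by
  simp [boxScale]

theorem toUnit_apply (K : Box (Fin d)) (x : Euc d) (i : Fin d) :
    toUnit K x i = (K.upper i - K.lower i)⁻¹ * (x i - K.lower i) := by
  rw [toUnit, boxScale_apply, PiLp.sub_apply]

theorem toUnit_fromUnit (K : Box (Fin d)) (y : Euc d) : toUnit K (fromUnit K y) = y := by
  ext i
  have := (sub_pos.2 (K.lower_lt_upper i)).ne'
  simp only [toUnit_apply, fromUnit]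
  field_simp
  ring

theorem fromUnit_toUnit (K : Box (Fin d)) (x : Euc d) : fromUnit K (toUnit K x) = x := by
  ext i
  have := (sub_pos.2 (K.lower_lt_upper i)).ne'
  simp only [toUnit_apply, fromUnit]
  field_simp
  ring

theorem bijective_toUnit (K : Box (Fin d)) : Function.Bijective (toUnit K) :=
  Function.bijective_iff_has_inverse.2 ⟨fromUnit K, fromUnit_toUnit K, toUnit_fromUnit K⟩

theorem contDiff_toUnit (K : Box (Fin d)) {n : ℕ∞} : ContDiff ℝ n (toUnit K) := by
  unfold toUnit
  fun_prop

theorem hasFDerivAt_toUnit (K : Box (Fin d)) (x : Euc d) :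
    HasFDerivAt (toUnit K) (boxScale K) x :=
  (boxScale K).hasFDerivAt.comp x ((hasFDerivAt_id x).sub_const (WithLp.toLp 2 K.lower))

theorem norm_boxScale_le {c : ℝ} (hc : 0 ≤ c) (h : ∀ i, (K.upper i - K.lower i)⁻¹ ≤ c) :
    ‖boxScale K‖ ≤ c := by
  refine ContinuousLinearMap.opNorm_le_bound _ hc fun x => ?_
  refine le_of_sq_le_sq ?_ (by positivity)
  rw [mul_pow, EuclideanSpace.norm_sq_eq, EuclideanSpace.norm_sq_eq, Finset.mul_sum]
  refine Finset.sum_le_sum fun i _ => ?_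
  have := inv_nonneg.2 (sub_pos.2 (K.lower_lt_upper i)).le
  rw [boxScale_apply, norm_mul, mul_pow, Real.norm_of_nonneg this]
  gcongr
  exact h i

theorem toUnit_mem_openCell {x : Euc d} : toUnit K x ∈ openCell (unitBox d) ↔ x ∈ openCell K := by
  refine forall_congr' fun i => ?_
  have hi := sub_pos.2 (K.lower_lt_upper i)
  simp only [toUnit_apply, unitBox, mem_Ioo, Pi.zero_apply, Pi.one_apply]
  rw [inv_mul_lt_iff₀ hi, mul_pos_iff_of_pos_left (inv_pos.2 hi)]
  constructor <;> rintro ⟨h1, h2⟩ <;> constructor <;> linarith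

theorem volume_real_openCell_pos (K : Box (Fin d)) : 0 < volume.real (openCell K) := by
  have hpos : 0 < ∏ i, (K.upper i - K.lower i) :=
    Finset.prod_pos fun i _ => sub_pos.2 (K.lower_lt_upper i)
  rwa [Measure.real, volume_openCell, ENNReal.toReal_ofReal hpos.le]

theorem integral_eq_abs_det_mul_integral_comp_toUnit (K : Box (Fin d)) (g : Euc d → ℝ) :
    ∫ y, g y = |(boxScale K).det| * ∫ x, g (toUnit K x) := by
  have h := integral_image_eq_integral_abs_det_fderiv_smul volume MeasurableSet.univ
    (fun x _ => (hasFDerivAt_toUnit K x).hasFDerivWithinAt) (bijective_toUnit K).1.injOn g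
  simpa [image_univ, (bijective_toUnit K).2.range_eq, integral_const_mul] using h

theorem abs_det_boxScale_mul_volume (K : Box (Fin d)) :
    |(boxScale K).det| * volume.real (openCell K) = 1 := by
  have h := integral_eq_abs_det_mul_integral_comp_toUnit K
    ((openCell (unitBox d)).indicator fun _ => 1)
  have hcomp : (fun x => (openCell (unitBox d)).indicator (fun _ => (1 : ℝ)) (toUnit K x)) =
      (openCell K).indicator fun _ => 1 := by
    ext x
    classical exact if_congr toUnit_mem_openCell rfl rfl
  rw [hcomp, integral_indicator (measurableSet_openCell _),
    integral_indicator (measurableSet_openCell _), setIntegral_const, setIntegral_const,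
    smul_eq_mul, smul_eq_mul, mul_one, mul_one, Measure.real, volume_openCell] at h
  simpa [unitBox] using h.symm

theorem integral_comp_toUnit (K : Box (Fin d)) (g : Euc d → ℝ) :
    ∫ x, g (toUnit K x) = volume.real (openCell K) * ∫ y, g y := by
  rw [integral_eq_abs_det_mul_integral_comp_toUnit K g, ← mul_assoc, mul_comm (volume.real _),
    abs_det_boxScale_mul_volume, one_mul]

theorem IsTestFunction.comp_toUnit (hφ : IsTestFunction (openCell (unitBox d)) φ)
    (K : Box (Fin d)) : IsTestFunction (openCell K) (fun x => φ (toUnit K x)) := by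
  have hsub : tsupport (fun x => φ (toUnit K x)) ⊆ toUnit K ⁻¹' tsupport φ :=
    closure_minimal (fun x hx => subset_tsupport φ hx)
      ((isClosed_tsupport φ).preimage (contDiff_toUnit K (n := 0)).continuous)
  have hsub' : tsupport (fun x => φ (toUnit K x)) ⊆ openCell K :=
    fun x hx => toUnit_mem_openCell.1 (hφ.2.2 (hsub hx))
  exact ⟨hφ.1.comp (contDiff_toUnit K), Metric.isCompact_of_isClosed_isBounded
    (isClosed_tsupport _) ((isBounded_openCell K).subset hsub'), hsub'⟩

theorem exists_comp_toUnit (hq : q ∈ tensorPoly d p) (K : Box (Fin d)) :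
    ∃ q' ∈ tensorPoly d p, ∀ x, polyEval q' x = polyEval q (toUnit K x) := by
  obtain ⟨q', hq', h⟩ := exists_comp_affine_mem_tensorPoly hq
    (fun i => -((K.upper i - K.lower i)⁻¹ * K.lower i)) (fun i => (K.upper i - K.lower i)⁻¹)
  refine ⟨q', hq', fun x => (h x).trans (congrArg _ ?_)⟩
  ext i
  rw [toUnit_apply]
  ring

theorem exists_comp_fromUnit (hq : q ∈ tensorPoly d p) (K : Box (Fin d)) :
    ∃ q' ∈ tensorPoly d p, ∀ x, polyEval q' (toUnit K x) = polyEval q x := by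
  obtain ⟨q', hq', h⟩ := exists_comp_affine_mem_tensorPoly hq K.lower
    (fun i => K.upper i - K.lower i)
  exact ⟨q', hq', fun x => (h _).trans (congrArg _ (fromUnit_toUnit K x))⟩

/-- The moment of `f` on `K` against the `j`-th basis polynomial, averaged over `K`. -/
def cellMoment (p : ℕ) (K : Box (Fin d)) (f : Euc d → ℝ)
    (j : PolyIndex d p) : ℝ :=
  (volume.real (openCell K))⁻¹ * ∫ x in openCell K, f x * polyEval (polyBasis d p j).1 (toUnit K x)

/-- The smooth function with compact support in the open cell `K` that has the same moments as `f`
against polynomials of degree at most `p` in each variable. -/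
def bubble (p : ℕ) (K : Box (Fin d)) (f : Euc d → ℝ) (x : Euc d) : ℝ :=
  ∑ j, cellMoment p K f j * dualBubble d p j (toUnit K x)

section Bubble

variable {f : Euc d → ℝ}

theorem isTestFunction_bubble : IsTestFunction (openCell K) (bubble p K f) :=
  IsTestFunction.sum fun j _ => ((isTestFunction_dualBubble j).comp_toUnit K).const_mul _

theorem bubble_eq_zero (h : ∀ q ∈ tensorPoly d p, ∫ x in openCell K, f x * polyEval q x = 0) :
    bubble p K f = 0 := by
  ext x
  refine Finset.sum_eq_zero fun j _ => ?_
  obtain ⟨q, hq, hqj⟩ := exists_comp_toUnit (polyBasis d p j).2 K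
  simp only [cellMoment, ← hqj, h q hq, mul_zero, zero_mul]

theorem memLp_polyEval_comp_toUnit (hq : q ∈ tensorPoly d p) (K : Box (Fin d)) :
    MemLp (fun x => polyEval q (toUnit K x)) 2 (volume.restrict (openCell K)) := by
  obtain ⟨q', -, h⟩ := exists_comp_toUnit hq K
  simpa only [← h] using memLp_polyEval q' K

theorem setIntegral_bubble_mul_polyEval (hf : MemLp f 2 (volume.restrict (openCell K)))
    (hq : q ∈ tensorPoly d p) :
    ∫ x in openCell K, bubble p K f x * polyEval q x = ∫ x in openCell K, f x * polyEval q x := by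
  obtain ⟨q', hq', hqq'⟩ := exists_comp_fromUnit hq K
  let m (j : PolyIndex d p) : ℝ := ∫ y, dualBubble d p j y * polyEval q' y
  have hbubble (j : PolyIndex d p) :
      ∫ x, dualBubble d p j (toUnit K x) * polyEval q x = volume.real (openCell K) * m j := by
    rw [← integral_comp_toUnit K fun y => dualBubble d p j y * polyEval q' y]
    simp_rw [hqq']
  have hexpand (x : Euc d) : f x * polyEval q x =
      ∑ j, m j * (f x * polyEval (polyBasis d p j).1 (toUnit K x)) := by
    rw [← hqq', ← sum_integral_dualBubble_mul hq', Finset.mul_sum]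
    exact Finset.sum_congr rfl fun j _ => mul_left_comm _ _ _
  have hint (j : PolyIndex d p) : Integrable (fun x =>
      f x * polyEval (polyBasis d p j).1 (toUnit K x)) (volume.restrict (openCell K)) :=
    hf.integrable_mul (memLp_polyEval_comp_toUnit (polyBasis d p j).2 K)
  rw [setIntegral_eq_integral_of_forall_compl_eq_zero fun x hx => by
    rw [isTestFunction_bubble.eq_zero_of_notMem hx, zero_mul]]
  simp_rw [hexpand, bubble, Finset.sum_mul, mul_assoc]
  rw [integral_finsetSum _ fun j _ => (((isTestFunction_dualBubble j).comp_toUnit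
      K).mul_polyEval q).integrable.const_mul _,
    integral_finsetSum _ fun j _ => (hint j).const_mul _]
  refine Finset.sum_congr rfl fun j _ => ?_
  have := (volume_real_openCell_pos K).ne'
  rw [integral_const_mul, integral_const_mul, hbubble, cellMoment]
  field_simp

/-- The supremum of the modulus of the `j`-th basis polynomial on the unit cube. -/
def polyBasisSup (d p : ℕ) (j : PolyIndex d p) : ℝ :=
  sSup ((fun y => |polyEval (polyBasis d p j).1 y|) '' openCell (unitBox d))

/-- The Lipschitz constant of the `j`-th dual bubble. -/
def dualBubbleSlope (d p : ℕ) (j : PolyIndex d p) : ℝ :=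
  ⨆ y, ‖fderiv ℝ (dualBubble d p j) y‖

/-- The constant in the gradient estimate for bubbles. -/
def bubbleConst (d p : ℕ) (κ : ℝ) : ℝ := (∑ j, polyBasisSup d p j * dualBubbleSlope d p j * κ) ^ 2

theorem polyBasisSup_nonneg (j : PolyIndex d p) :
    0 ≤ polyBasisSup d p j :=
  Real.sSup_nonneg (forall_mem_image.2 fun _ _ => abs_nonneg _)

theorem abs_polyEval_polyBasis_le (j : PolyIndex d p) {y : Euc d}
    (hy : y ∈ openCell (unitBox d)) : |polyEval (polyBasis d p j).1 y| ≤ polyBasisSup d p j :=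
  le_csSup (((isBounded_openCell (unitBox d)).isCompact_closure.bddAbove_image
    (continuous_polyEval _).abs.continuousOn).mono (image_mono subset_closure))
    (mem_image_of_mem _ hy)

theorem norm_fderiv_dualBubble_le (j : PolyIndex d p) (y : Euc d) :
    ‖fderiv ℝ (dualBubble d p j) y‖ ≤ dualBubbleSlope d p j := by
  have hj := isTestFunction_dualBubble (d := d) (p := p) j
  obtain ⟨M, hM⟩ := (hj.2.1.fderiv ℝ).exists_bound_of_continuous
    (hj.1.continuous_fderiv (by simp))
  exact le_ciSup (f := fun y => ‖fderiv ℝ (dualBubble d p j) y‖) ⟨M, forall_mem_range.2 hM⟩ y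

theorem abs_cellMoment_le (hf : MemLp f 2 (volume.restrict (openCell K)))
    (j : PolyIndex d p) :
    |cellMoment p K f j| ≤
      polyBasisSup d p j * √((volume.real (openCell K))⁻¹ * ∫ x in openCell K, f x ^ 2) := by
  have : IsFiniteMeasure (volume.restrict (openCell K)) :=
    isFiniteMeasure_restrict.2 (isBounded_openCell K).measure_lt_top.ne
  have hV := volume_real_openCell_pos K
  have hb := memLp_polyEval_comp_toUnit (polyBasis d p j).2 K
  have hsq : ∫ x in openCell K, polyEval (polyBasis d p j).1 (toUnit K x) ^ 2 ≤
      volume.real (openCell K) * polyBasisSup d p j ^ 2 := by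
    rw [← smul_eq_mul, ← setIntegral_const]
    refine setIntegral_mono_on hb.integrable_sq (integrable_const _) (measurableSet_openCell K)
      fun x hx => ?_
    rw [← sq_abs]
    gcongr
    exact abs_polyEval_polyBasis_le j (toUnit_mem_openCell.2 hx)
  rw [cellMoment, abs_mul, abs_of_pos (inv_pos.2 hV)]
  calc _ ≤ (volume.real (openCell K))⁻¹ * (√(∫ x in openCell K, f x ^ 2) *
          √(volume.real (openCell K) * polyBasisSup d p j ^ 2)) := by
        gcongr
        exact (abs_integral_mul_le hf hb).trans (by gcongr)
    _ = _ := by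
        rw [Real.sqrt_mul hV.le, Real.sqrt_mul (inv_nonneg.2 hV.le), Real.sqrt_inv,
          Real.sqrt_sq (polyBasisSup_nonneg j)]
        nth_rw 1 [← Real.mul_self_sqrt hV.le]
        field_simp

theorem norm_fderiv_bubble_le (hH : 0 < H) (hκ : 0 < κ)
    (hK : ∀ i, H ≤ κ * (K.upper i - K.lower i)) (hf : MemLp f 2 (volume.restrict (openCell K)))
    (x : Euc d) :
    ‖fderiv ℝ (bubble p K f) x‖ ≤ (∑ j, polyBasisSup d p j * dualBubbleSlope d p j * κ) / H *
      √((volume.real (openCell K))⁻¹ * ∫ x in openCell K, f x ^ 2) := by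
  have hscale : ‖boxScale K‖ ≤ κ / H := norm_boxScale_le (by positivity) fun i => by
    rw [inv_le_comm₀ (sub_pos.2 (K.lower_lt_upper i)) (by positivity), inv_div, div_le_iff₀' hκ]
    exact hK i
  have hderiv (j : PolyIndex d p) :
      HasFDerivAt (fun x => cellMoment p K f j * dualBubble d p j (toUnit K x))
        (cellMoment p K f j • (fderiv ℝ (dualBubble d p j) (toUnit K x)).comp (boxScale K)) x :=
    (((isTestFunction_dualBubble j).differentiable _).hasFDerivAt.comp x
      (hasFDerivAt_toUnit K x)).const_mul _
  rw [show fderiv ℝ (bubble p K f) x = _ from (HasFDerivAt.fun_sum fun j _ => hderiv j).fderiv,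
    Finset.sum_div, Finset.sum_mul]
  refine norm_sum_le_of_le _ fun j _ => ?_
  have hslope := (norm_nonneg _).trans (norm_fderiv_dualBubble_le (d := d) (p := p) j 0)
  have := polyBasisSup_nonneg (d := d) (p := p) j
  rw [norm_smul]
  calc _ ≤ polyBasisSup d p j * √((volume.real (openCell K))⁻¹ * ∫ x in openCell K, f x ^ 2) *
        (dualBubbleSlope d p j * (κ / H)) := by
        gcongr
        · exact abs_cellMoment_le hf j
        · exact (ContinuousLinearMap.opNorm_comp_le _ _).trans (by
            gcongr
            exact norm_fderiv_dualBubble_le j _)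
    _ = _ := by ring

theorem setIntegral_norm_gradient_bubble_sq_le (hH : 0 < H) (hκ : 0 < κ)
    (hK : ∀ i, H ≤ κ * (K.upper i - K.lower i)) (hf : MemLp f 2 (volume.restrict (openCell K))) :
    ∫ x in openCell K, ‖gradient (bubble p K f) x‖ ^ 2 ≤
      bubbleConst d p κ / H ^ 2 * ∫ x in openCell K, f x ^ 2 := by
  have : IsFiniteMeasure (volume.restrict (openCell K)) :=
    isFiniteMeasure_restrict.2 (isBounded_openCell K).measure_lt_top.ne
  have hV := volume_real_openCell_pos K
  have hF : 0 ≤ ∫ x in openCell K, f x ^ 2 := integral_nonneg fun _ => sq_nonneg _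
  have hpoint (x : Euc d) : ‖gradient (bubble p K f) x‖ ^ 2 ≤ bubbleConst d p κ / H ^ 2 *
      ((volume.real (openCell K))⁻¹ * ∫ x in openCell K, f x ^ 2) := by
    rw [norm_gradient, bubbleConst, ← div_pow, ← Real.sq_sqrt
      (mul_nonneg (inv_nonneg.2 hV.le) hF), ← mul_pow]
    exact pow_le_pow_left₀ (norm_nonneg _) (norm_fderiv_bubble_le hH hκ hK hf x) 2
  calc _ ≤ ∫ _ in openCell K, bubbleConst d p κ / H ^ 2 *
        ((volume.real (openCell K))⁻¹ * ∫ x in openCell K, f x ^ 2) :=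
        integral_mono (isTestFunction_bubble.memLp_gradient.restrict _).norm.integrable_sq
          (integrable_const _) hpoint
    _ = _ := by
        rw [setIntegral_const, smul_eq_mul]
        field_simp

end Bubble

/-- The squared `L²`-norm of the gradient of `u` on the cell `K`. -/
def cellEnergy (K : Box (Fin d)) (u : H10 Ω) : ℝ := ∫ x in openCell K, ‖gradOf u x‖ ^ 2

theorem cellEnergy_nonneg (u : H10 Ω) : 0 ≤ cellEnergy K u :=
  integral_nonneg fun _ => sq_nonneg _

/-- The Poincaré constant of a cell, relative to `H²`. -/
def poincareConst (d : ℕ) (κ : ℝ) : ℝ := d * κ ^ 2 * 2 ^ d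

theorem poincareConst_nonneg : 0 ≤ poincareConst d κ := by
  unfold poincareConst
  positivity

namespace IsRectMesh

theorem memLp_openCell {E : Type*} [NormedAddCommGroup E] (hT : IsRectMesh Ω H κ T) (hK : K ∈ T)
    (f : Lp E 2 (volume.restrict Ω)) : MemLp f 2 (volume.restrict (openCell K)) :=
  (Lp.memLp f).mono_measure (Measure.restrict_mono_set _ (hT.openCell_subset hK))

theorem integral_sub_average_sq_le_cellEnergy (hT : IsRectMesh Ω H κ T) (hK : K ∈ T) (u : H10 Ω) :
    ∫ x in openCell K, (fnOf u x - ⨍ y in openCell K, fnOf u y) ^ 2 ≤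
      poincareConst d κ * H ^ 2 * cellEnergy K u := by
  refine (H10.integral_sub_average_sq_le u (measurableSet_openCell K) (hT.openCell_subset hK)
    (convex_openCell K) (isBounded_openCell K)).trans ?_
  refine mul_le_mul_of_nonneg_right ?_ (cellEnergy_nonneg u)
  calc _ ≤ d * (κ * H) ^ 2 * 2 ^ d := by
        gcongr
        exact hT.diam_openCell_sq_le hK
    _ = _ := by
        rw [poincareConst]
        ring

theorem integral_sq_le_cellEnergy (hT : IsRectMesh Ω H κ T) (hK : K ∈ T) {w : H10 Ω}
    (hw : ∫ x in openCell K, fnOf w x = 0) :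
    ∫ x in openCell K, fnOf w x ^ 2 ≤ poincareConst d κ * H ^ 2 * cellEnergy K w := by
  refine le_of_eq_of_le ?_ (hT.integral_sub_average_sq_le_cellEnergy hK w)
  simp [setAverage_eq, hw]

theorem abs_integral_mul_le_cellEnergy (hT : IsRectMesh Ω H κ T) (hK : K ∈ T) (v : H10 Ω)
    {w : H10 Ω} (hw : ∫ x in openCell K, fnOf w x = 0) :
    |∫ x in openCell K, fnOf v x * fnOf w x| ≤
      poincareConst d κ * H ^ 2 * (√(cellEnergy K v) * √(cellEnergy K w)) := by
  have : IsFiniteMeasure (volume.restrict (openCell K)) :=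
    isFiniteMeasure_restrict.2 (isBounded_openCell K).measure_lt_top.ne
  have hP : 0 ≤ poincareConst d κ * H ^ 2 := mul_nonneg poincareConst_nonneg (sq_nonneg H)
  calc _ ≤ √(poincareConst d κ * H ^ 2 * cellEnergy K v) *
          √(poincareConst d κ * H ^ 2 * cellEnergy K w) := by
        refine (abs_integral_mul_le_of_integral_eq_zero (hT.memLp_openCell hK _)
          (hT.memLp_openCell hK _) hw).trans ?_
        gcongr
        · exact hT.integral_sub_average_sq_le_cellEnergy hK v
        · exact hT.integral_sq_le_cellEnergy hK hw
    _ = _ := by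
        rw [Real.sqrt_mul hP, Real.sqrt_mul hP, mul_mul_mul_comm, Real.mul_self_sqrt hP]

theorem memLp_indicator_polyEval (hT : IsRectMesh Ω H κ T) (hK : K ∈ T)
    (q : MvPolynomial (Fin d) ℝ) :
    MemLp ((openCell K).indicator (polyEval q)) 2 (volume.restrict Ω) := by
  rw [memLp_indicator_iff_restrict (measurableSet_openCell K),
    Measure.restrict_restrict_of_subset (hT.openCell_subset hK)]
  exact memLp_polyEval q K

theorem toLp_indicator_polyEval_mem (hT : IsRectMesh Ω H κ T) (hK : K ∈ T)
    (hq : q ∈ tensorPoly d p) :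
    (hT.memLp_indicator_polyEval hK q).toLp _ ∈ polySpace Ω T p := by
  classical
  refine fun L hL => ⟨if L = K then q else 0, ?_, ?_⟩
  · split_ifs
    exacts [hq, Submodule.zero_mem _]
  · filter_upwards [(hT.memLp_indicator_polyEval hK q).coeFn_toLp, ae_mem_openCell_of_mem_cell L]
      with x hx hxL hxcell
    rw [hx]
    split_ifs with hLK
    · exact indicator_of_mem (hLK ▸ hxL hxcell) _
    · rw [indicator_of_notMem fun hxK => hLK (hT.eq_of_mem_openCell hL hK (hxL hxcell) hxK),
        map_zero]

theorem inner_toLp_indicator_polyEval (hT : IsRectMesh Ω H κ T) (hK : K ∈ T)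
    (q : MvPolynomial (Fin d) ℝ) (f : L2 Ω) :
    inner ℝ ((hT.memLp_indicator_polyEval hK q).toLp _) f =
      ∫ x in openCell K, f x * polyEval q x := by
  rw [L2.inner_def, ← Measure.restrict_restrict_of_subset (hT.openCell_subset hK),
    ← integral_indicator (measurableSet_openCell K)]
  refine integral_congr_ae ?_
  filter_upwards [(hT.memLp_indicator_polyEval hK q).coeFn_toLp] with x hx
  rw [hx]
  by_cases hxK : x ∈ openCell K
  · rw [indicator_of_mem hxK, indicator_of_mem hxK]
    rfl
  · rw [indicator_of_notMem hxK, indicator_of_notMem hxK, inner_zero_left]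

theorem mem_polySpace_orthogonal (hT : IsRectMesh Ω H κ T) {f : L2 Ω} :
    f ∈ (polySpace Ω T p)ᗮ ↔
      ∀ K ∈ T, ∀ q ∈ tensorPoly d p, ∫ x in openCell K, f x * polyEval q x = 0 := by
  rw [Submodule.mem_orthogonal]
  refine ⟨fun h K hK q hq => ?_, fun h r hr => ?_⟩
  · rw [← hT.inner_toLp_indicator_polyEval hK q f]
    exact h _ (hT.toLp_indicator_polyEval_mem hK hq)
  · rw [L2.inner_def, hT.setIntegral_eq_sum (L2.integrable_inner r f)]
    refine Finset.sum_eq_zero fun K hK => ?_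
    obtain ⟨q, hq, hrq⟩ := hr K hK
    rw [← h K hK q hq]
    refine integral_congr_ae ?_
    filter_upwards [hT.ae_openCell hK hrq, ae_restrict_mem (measurableSet_openCell K)]
      with x hx hxK
    rw [hx (openCell_subset_cell K hxK)]
    rfl

theorem integral_eq_zero_of_mem_fineSpace (hT : IsRectMesh Ω H κ T) (hK : K ∈ T) {w : H10 Ω}
    (hw : w ∈ fineSpace Ω T p) : ∫ x in openCell K, fnOf w x = 0 := by
  simpa [polyEval] using hT.mem_polySpace_orthogonal.1 hw K hK 1
    ((MvPolynomial.mem_restrictDegree _ _ _).2 fun s hs i => by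
      rw [MvPolynomial.support_one, Finset.mem_singleton] at hs
      simp [hs])

theorem isTestFunction_sum_bubble (hT : IsRectMesh Ω H κ T) (p : ℕ) (f : L2 Ω) :
    IsTestFunction Ω (fun x => ∑ K ∈ T, bubble p K f x) :=
  .sum fun _ hK => isTestFunction_bubble.mono (hT.openCell_subset hK)

/-- The sum of the bubbles of `f` on all cells: a local `H¹₀`-function that has the same
`L²`-projection onto the piecewise polynomials as `f`. -/
def bubbleSum (hT : IsRectMesh Ω H κ T) (p : ℕ) (f : L2 Ω) : H10 Ω :=
  (hT.isTestFunction_sum_bubble p f).toH10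

theorem sum_bubble_eventuallyEq (hT : IsRectMesh Ω H κ T) (hK : K ∈ T) (f : L2 Ω) {x : Euc d}
    (hx : x ∈ openCell K) : (fun y => ∑ L ∈ T, bubble p L f y) =ᶠ[nhds x] bubble p K f := by
  filter_upwards [(isOpen_openCell K).mem_nhds hx] with y hy
  refine Finset.sum_eq_single K (fun L hL hLK => ?_) fun h => absurd hK h
  exact isTestFunction_bubble.eq_zero_of_notMem
    fun hyL => hLK (hT.eq_of_mem_openCell hL hK hyL hy)

theorem fnOf_bubbleSum (hT : IsRectMesh Ω H κ T) (hK : K ∈ T) (f : L2 Ω) :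
    fnOf (hT.bubbleSum p f) =ᵐ[volume.restrict (openCell K)] bubble p K f := by
  filter_upwards [hT.ae_openCell hK (hT.isTestFunction_sum_bubble p f).fnOf_toH10,
    ae_restrict_mem (measurableSet_openCell K)] with x hx hxK
  exact hx.trans (hT.sum_bubble_eventuallyEq hK f hxK).self_of_nhds

theorem gradOf_bubbleSum (hT : IsRectMesh Ω H κ T) (hK : K ∈ T) (f : L2 Ω) :
    gradOf (hT.bubbleSum p f) =ᵐ[volume.restrict (openCell K)] gradient (bubble p K f) := by
  filter_upwards [hT.ae_openCell hK (hT.isTestFunction_sum_bubble p f).gradOf_toH10,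
    ae_restrict_mem (measurableSet_openCell K)] with x hx hxK
  rw [bubbleSum, hx, gradient, gradient, (hT.sum_bubble_eventuallyEq hK f hxK).fderiv_eq]

theorem sub_fnOf_bubbleSum_mem (hT : IsRectMesh Ω H κ T) (f : L2 Ω) :
    f - fnOf (hT.bubbleSum p f) ∈ (polySpace Ω T p)ᗮ := by
  refine hT.mem_polySpace_orthogonal.2 fun K hK q hq => ?_
  have hf : Integrable (fun x => f x * polyEval q x) (volume.restrict (openCell K)) :=
    (hT.memLp_openCell hK f).integrable_mul (memLp_polyEval q K)
  have hb : Integrable (fun x => bubble p K f x * polyEval q x) (volume.restrict (openCell K)) :=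
    (isTestFunction_bubble.mul_polyEval q).integrable.integrableOn
  calc _ = ∫ x in openCell K, (f x * polyEval q x - bubble p K f x * polyEval q x) := by
        refine integral_congr_ae ?_
        filter_upwards [hT.fnOf_bubbleSum hK f, hT.ae_openCell hK (Lp.coeFn_sub f _)] with x hb hsub
        rw [hsub, Pi.sub_apply, hb, sub_mul]
    _ = 0 := by
        rw [integral_sub hf hb, setIntegral_bubble_mul_polyEval (hT.memLp_openCell hK f) hq,
          sub_self]

theorem fnOf_bubbleSum_eq_zero (hT : IsRectMesh Ω H κ T) (hK : K ∈ T) {f : L2 Ω}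
    (h : ∀ q ∈ tensorPoly d p, ∫ x in openCell K, f x * polyEval q x = 0) :
    fnOf (hT.bubbleSum p f) =ᵐ[volume.restrict (openCell K)] 0 := by
  rw [← bubble_eq_zero h]
  exact hT.fnOf_bubbleSum hK f

theorem cellEnergy_bubbleSum_le (hT : IsRectMesh Ω H κ T) (hH : 0 < H) (hκ : 0 < κ) (hK : K ∈ T)
    (f : L2 Ω) : cellEnergy K (hT.bubbleSum p f) ≤
      bubbleConst d p κ / H ^ 2 * ∫ x in openCell K, f x ^ 2 := by
  rw [cellEnergy, integral_congr_ae
    ((hT.gradOf_bubbleSum hK f).mono fun x hx => congrArg (‖·‖ ^ 2) hx)]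
  exact setIntegral_norm_gradient_bubble_sq_le hH hκ (hT.le_side K hK) (hT.memLp_openCell hK f)

theorem cellEnergy_sub_le (hT : IsRectMesh Ω H κ T) (hK : K ∈ T) (u v : H10 Ω) :
    cellEnergy K (u - v) ≤ 2 * cellEnergy K u + 2 * cellEnergy K v := by
  have hu := (hT.memLp_openCell hK (gradOf u)).norm.integrable_sq.const_mul 2
  have hv := (hT.memLp_openCell hK (gradOf v)).norm.integrable_sq.const_mul 2
  unfold cellEnergy
  rw [← integral_const_mul, ← integral_const_mul, ← integral_add hu hv]
  refine integral_mono_ae (hT.memLp_openCell hK _).norm.integrable_sq (hu.add hv) ?_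
  filter_upwards [hT.ae_openCell hK (Lp.coeFn_sub (gradOf u) (gradOf v))] with x hx
  rw [gradOf_sub, hx, Pi.sub_apply, ← mul_add]
  exact (pow_le_pow_left₀ (norm_nonneg _) (norm_sub_le _ _) 2).trans add_sq_le

theorem cellEnergy_le_of_gradOf_eq_mul (hT : IsRectMesh Ω H κ T) (hK : K ∈ T) {u u' : H10 Ω}
    {θ : Euc d → ℝ} {L : ℝ} (hθ : ∀ x ∈ Ω, |θ x| ≤ 1) (hL : ∀ x ∈ Ω, ‖fderiv ℝ θ x‖ ≤ L)
    (h : ∀ᵐ x ∂volume.restrict Ω, gradOf u' x = θ x • gradOf u x + fnOf u x • gradient θ x) :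
    cellEnergy K u' ≤ 2 * cellEnergy K u + 2 * L ^ 2 * ∫ x in openCell K, fnOf u x ^ 2 := by
  have hg := (hT.memLp_openCell hK (gradOf u)).norm.integrable_sq.const_mul 2
  have hu := (hT.memLp_openCell hK (fnOf u)).integrable_sq.const_mul (2 * L ^ 2)
  unfold cellEnergy
  rw [← integral_const_mul, ← integral_const_mul, ← integral_add hg hu]
  refine integral_mono_ae (hT.memLp_openCell hK _).norm.integrable_sq (hg.add hu) ?_
  filter_upwards [hT.ae_openCell hK h, ae_restrict_mem (measurableSet_openCell K)] with x hx hxK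
  have hxΩ := hT.openCell_subset hK hxK
  have hnorm : ‖gradOf u' x‖ ≤ ‖gradOf u x‖ + |fnOf u x| * L := by
    rw [hx]
    refine (norm_add_le _ _).trans ?_
    rw [norm_smul, norm_smul, norm_gradient]
    exact add_le_add (mul_le_of_le_one_left (norm_nonneg _) (hθ x hxΩ))
      (mul_le_mul_of_nonneg_left (hL x hxΩ) (norm_nonneg _))
  refine ((pow_le_pow_left₀ (norm_nonneg _) hnorm 2).trans add_sq_le).trans_eq ?_
  rw [mul_pow, sq_abs]
  ring

/-- The fine-scale part of `u`: subtracting the bubbles removes the projection onto the piecewise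
polynomials and, unlike the `L²`-projection itself, stays in `H¹₀`. -/
def finePart (hT : IsRectMesh Ω H κ T) (p : ℕ) (u : H10 Ω) : H10 Ω :=
  u - hT.bubbleSum p (fnOf u)

theorem finePart_mem (hT : IsRectMesh Ω H κ T) (u : H10 Ω) :
    hT.finePart p u ∈ fineSpace Ω T p :=
  hT.sub_fnOf_bubbleSum_mem (fnOf u)

theorem fnOf_finePart (hT : IsRectMesh Ω H κ T) (hK : K ∈ T) {u : H10 Ω} {f : Euc d → ℝ}
    (hu : ∀ᵐ x ∂volume.restrict (openCell K), fnOf u x = f x)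
    (hf : ∀ q ∈ tensorPoly d p, ∫ x in openCell K, f x * polyEval q x = 0) :
    ∀ᵐ x ∂volume.restrict (openCell K), fnOf (hT.finePart p u) x = f x := by
  have hmoment (q) (hq : q ∈ tensorPoly d p) :
      ∫ x in openCell K, fnOf u x * polyEval q x = 0 := by
    rw [← hf q hq]
    exact integral_congr_ae (hu.mono fun x hx => congrArg (· * polyEval q x) hx)
  filter_upwards [hu, hT.fnOf_bubbleSum_eq_zero hK hmoment,
    hT.ae_openCell hK (Lp.coeFn_sub (fnOf u) (fnOf (hT.bubbleSum p (fnOf u))))] with x hx hb hsub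
  rw [finePart, fnOf_sub, hsub, Pi.sub_apply, hx, hb, Pi.zero_apply, sub_zero]

theorem fnOf_finePart_eq_zero (hT : IsRectMesh Ω H κ T) (hK : K ∈ T) {u : H10 Ω}
    (hu : ∀ᵐ x ∂volume.restrict (openCell K), fnOf u x = 0) :
    ∀ᵐ x ∂volume.restrict (openCell K), fnOf (hT.finePart p u) x = 0 :=
  hT.fnOf_finePart hK hu (by simp)

theorem cellEnergy_finePart_le (hT : IsRectMesh Ω H κ T) (hH : 0 < H) (hκ : 0 < κ) (hK : K ∈ T)
    (u : H10 Ω) : cellEnergy K (hT.finePart p u) ≤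
      2 * cellEnergy K u + 2 * (bubbleConst d p κ / H ^ 2 * ∫ x in openCell K, fnOf u x ^ 2) := by
  have hb := hT.cellEnergy_bubbleSum_le (p := p) hH hκ hK (fnOf u)
  have hsub := hT.cellEnergy_sub_le hK u (hT.bubbleSum p (fnOf u))
  rw [finePart]
  linarith

end IsRectMesh

/-! ### Cutoffs in the fine-scale space -/

/-- `w'` is a cutoff of `w` inside the fine-scale space: it vanishes on the cells in `S`, agrees
with `w` on the cells of `T` that do not touch `S`, vanishes where `w` does, and has at most `C`
times the energy of `w` on every cell. -/
structure IsFineCutoff (T S : Finset (Box (Fin d))) (p : ℕ) (C : ℝ) (w w' : H10 Ω) : Prop where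
  mem : w' ∈ fineSpace Ω T p
  eq_zero : ∀ K ∈ S, ∀ᵐ x ∂volume.restrict (openCell K), fnOf w' x = 0
  eq_self : ∀ K ∈ T, (∀ L ∈ S, Disjoint (cell L) (cell K)) →
    ∀ᵐ x ∂volume.restrict (openCell K), fnOf w' x = fnOf w x
  eq_zero_of_eq_zero : ∀ K ∈ T, (∀ᵐ x ∂volume.restrict (openCell K), fnOf w x = 0) →
    ∀ᵐ x ∂volume.restrict (openCell K), fnOf w' x = 0
  cellEnergy_le : ∀ K ∈ T, cellEnergy K w' ≤ C * cellEnergy K w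

/-- The stability constant of the fine-scale cutoff. -/
def fineCutoffConst (d p : ℕ) (κ : ℝ) : ℝ :=
  2 * (2 + 2 * cutoffSlope d κ ^ 2 * poincareConst d κ) +
    2 * (bubbleConst d p κ * poincareConst d κ)

theorem fineCutoffConst_pos : 0 < fineCutoffConst d p κ := by
  have := poincareConst_nonneg (d := d) (κ := κ)
  unfold fineCutoffConst bubbleConst
  positivity

namespace IsRectMesh

theorem cellEnergy_finePart_mul_le (hT : IsRectMesh Ω H κ T) (hH : 0 < H) (hκ : 0 < κ)
    {θ : Euc d → ℝ} (hθ : ∀ x ∈ Ω, |θ x| ≤ 1)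
    (hθ' : ∀ x ∈ Ω, ‖fderiv ℝ θ x‖ ≤ cutoffSlope d κ / H) {w w₁ : H10 Ω} (hw : w ∈ fineSpace Ω T p)
    (hw₁ : ∀ᵐ x ∂volume.restrict Ω, fnOf w₁ x = θ x * fnOf w x)
    (hgrad : ∀ᵐ x ∂volume.restrict Ω, gradOf w₁ x = θ x • gradOf w x + fnOf w x • gradient θ x)
    (hK : K ∈ T) :
    cellEnergy K (hT.finePart p w₁) ≤ fineCutoffConst d p κ * cellEnergy K w := by
  have hPoincare := hT.integral_sq_le_cellEnergy hK (hT.integral_eq_zero_of_mem_fineSpace hK hw)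
  have hfn : ∫ x in openCell K, fnOf w₁ x ^ 2 ≤ ∫ x in openCell K, fnOf w x ^ 2 := by
    refine integral_mono_ae (hT.memLp_openCell hK _).integrable_sq
      (hT.memLp_openCell hK _).integrable_sq ?_
    filter_upwards [hT.ae_openCell hK hw₁, ae_restrict_mem (measurableSet_openCell K)] with x hx hxK
    rw [hx, mul_pow]
    exact mul_le_of_le_one_left (sq_nonneg _)
      ((sq_le_one_iff_abs_le_one _).2 (hθ x (hT.openCell_subset hK hxK)))
  have hB : 0 ≤ bubbleConst d p κ := sq_nonneg _
  calc cellEnergy K (hT.finePart p w₁)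
      ≤ 2 * cellEnergy K w₁ + 2 * (bubbleConst d p κ / H ^ 2 * ∫ x in openCell K, fnOf w₁ x ^ 2) :=
        hT.cellEnergy_finePart_le hH hκ hK w₁
    _ ≤ 2 * (2 * cellEnergy K w + 2 * (cutoffSlope d κ / H) ^ 2 *
          (poincareConst d κ * H ^ 2 * cellEnergy K w)) +
          2 * (bubbleConst d p κ / H ^ 2 * (poincareConst d κ * H ^ 2 * cellEnergy K w)) := by
        gcongr
        · refine (hT.cellEnergy_le_of_gradOf_eq_mul hK hθ hθ' hgrad).trans ?_
          gcongr
        · exact hfn.trans hPoincare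
    _ = fineCutoffConst d p κ * cellEnergy K w := by
        rw [fineCutoffConst]
        field_simp

theorem exists_isFineCutoff (hT : IsRectMesh Ω H κ T) (hΩ : IsOpen Ω) (hH : 0 < H) (hκ : 0 < κ)
    (hS : S ⊆ T) {w : H10 Ω} (hw : w ∈ fineSpace Ω T p) :
    ∃ w', IsFineCutoff T S p (fineCutoffConst d p κ) w w' := by
  have hθ (x : Euc d) (_ : x ∈ Ω) : |cutoff H κ T S x| ≤ 1 :=
    abs_le.2 ⟨(neg_one_lt_zero.le).trans cutoff_nonneg, cutoff_le_one⟩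
  have hθ' (x : Euc d) (hx : x ∈ Ω) : ‖fderiv ℝ (cutoff H κ T S) x‖ ≤ cutoffSlope d κ / H :=
    hT.norm_fderiv_cutoff_le hΩ hH hκ hS hx
  obtain ⟨w₁, hw₁, hgrad⟩ :=
    H10.exists_mul hΩ (fun x hx => hT.contDiffAt_cutoff hΩ hH hκ hS hx) hθ hθ' w
  refine ⟨hT.finePart p w₁, hT.finePart_mem w₁, fun K hK => ?_, fun K hK hKS => ?_,
    fun K hK h0 => ?_, fun K hK => hT.cellEnergy_finePart_mul_le hH hκ hθ hθ' hw hw₁ hgrad hK⟩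
  · refine hT.fnOf_finePart_eq_zero (hS hK) ?_
    filter_upwards [hT.ae_openCell (hS hK) hw₁, ae_restrict_mem (measurableSet_openCell K)]
      with x hx hxK
    rw [hx, cutoff_eq_zero hH hκ hS hK (openCell_subset_cell K hxK), zero_mul]
  · refine hT.fnOf_finePart hK ?_ fun q hq => hT.mem_polySpace_orthogonal.1 hw K hK q hq
    filter_upwards [hT.ae_openCell hK hw₁, ae_restrict_mem (measurableSet_openCell K)] with x hx hxK
    rw [hx, hT.cutoff_eq_one hH hκ hS hK hKS (openCell_subset_cell K hxK), one_mul]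
  · refine hT.fnOf_finePart_eq_zero hK ?_
    filter_upwards [hT.ae_openCell hK hw₁, h0] with x hx hx0
    rw [hx, hx0, mul_zero]

end IsRectMesh

variable {G : Box (Fin d)} {α β C : ℝ} {A : Euc d → ℝ} {u w w' : H10 Ω} {v : L2 Ω} {l : ℕ}

open scoped Classical in
/-- The cells that make up the patch of order `l` around `G`. -/
def layer (T : Finset (Box (Fin d))) (G : Box (Fin d)) : ℕ → Finset (Box (Fin d))
  | 0 => {G}
  | l + 1 => {K ∈ T | ∃ L ∈ layer T G l, (cell L ∩ cell K).Nonempty}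

theorem mem_layer_succ :
    K ∈ layer T G (l + 1) ↔ K ∈ T ∧ ∃ L ∈ layer T G l, (cell L ∩ cell K).Nonempty := by
  simp [layer]

theorem layer_subset (hG : G ∈ T) (l : ℕ) : layer T G l ⊆ T := by
  cases l with
  | zero => simpa [layer] using hG
  | succ l => exact fun K hK => (mem_layer_succ.1 hK).1

theorem layer_subset_succ (hG : G ∈ T) (l : ℕ) : layer T G l ⊆ layer T G (l + 1) := fun K hK =>
  mem_layer_succ.2 ⟨layer_subset hG l hK, K, hK, by rw [inter_self]; exact cell_nonempty K⟩

theorem self_mem_layer (hG : G ∈ T) (l : ℕ) : G ∈ layer T G l := by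
  induction l with
  | zero => simp [layer]
  | succ l ih => exact layer_subset_succ hG l ih

theorem disjoint_of_notMem_layer_succ (hK : K ∈ T) (hKl : K ∉ layer T G (l + 1))
    (hL : L ∈ layer T G l) : Disjoint (cell L) (cell K) :=
  not_not.1 fun h =>
    hKl (mem_layer_succ.2 ⟨hK, L, hL, not_disjoint_iff_nonempty_inter.1 h⟩)

theorem patchOne_biUnion_cell (T S : Finset (Box (Fin d))) :
    patchOne T (⋃ L ∈ S, cell L) = ⋃ L ∈ S, patchOne T (cell L) := by
  have hclosed : IsClosed (⋃ L ∈ S, cell L) :=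
    S.finite_toSet.isClosed_biUnion fun _ _ => isClosed_cell _
  ext x
  simp only [mem_iUnion, exists_prop, mem_patchOne_cell]
  simp only [patchOne, hclosed.closure_eq, mem_iUnion, exists_prop, iUnion_inter,
    nonempty_iUnion]
  tauto

theorem patch_eq_biUnion (T : Finset (Box (Fin d))) (G : Box (Fin d)) (l : ℕ) :
    patch T l (cell G) = ⋃ K ∈ layer T G l, cell K := by
  induction l with
  | zero => simp [patch, layer]
  | succ l ih =>
    have hsucc : patch T (l + 1) (cell G) = patchOne T (patch T l (cell G)) :=
      Function.iterate_succ_apply' _ _ _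
    rw [hsucc, ih, patchOne_biUnion_cell]
    ext x
    simp only [mem_iUnion, exists_prop, mem_patchOne_cell, mem_layer_succ]
    tauto

/-! ### The energy form and the corrector problems -/

/-- The part `(A ∇u, ∇w)_{L²(K)}` of the energy form that belongs to the cell `K`. -/
def cellForm (A : Euc d → ℝ) (K : Box (Fin d)) (u w : H10 Ω) : ℝ :=
  ∫ x in openCell K, A x * inner ℝ (gradOf u x) (gradOf w x)

theorem cellForm_comm (A : Euc d → ℝ) (K : Box (Fin d)) (u w : H10 Ω) :
    cellForm A K u w = cellForm A K w u := by
  simp_rw [cellForm, real_inner_comm]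

namespace IsRectMesh

theorem mem_fineSpaceOn (hT : IsRectMesh Ω H κ T) (hS : S ⊆ T) :
    w ∈ fineSpaceOn Ω T p (⋃ K ∈ S, cell K) ↔ w ∈ fineSpace Ω T p ∧
      ∀ K ∈ T, K ∉ S → ∀ᵐ x ∂volume.restrict (openCell K), fnOf w x = 0 := by
  refine and_congr_right fun _ => ⟨fun h K hK hKS => ?_, fun h => ?_⟩
  · have hboundary : ∀ᵐ x ∂volume.restrict Ω, ∀ L ∈ S, x ∈ cell L → x ∈ openCell L :=
      (Filter.eventually_all_finset S).2 fun L _ => ae_mem_openCell_of_mem_cell L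
    filter_upwards [hT.ae_openCell hK h, hT.ae_openCell hK hboundary,
      ae_restrict_mem (measurableSet_openCell K)] with x hx hxboundary hxK
    refine hx fun hxS => ?_
    obtain ⟨L, hL, hxL⟩ := mem_iUnion₂.1 hxS
    exact hKS (hT.eq_of_mem_openCell hK (hS hL) hxK (hxboundary L hL hxL) ▸ hL)
  · refine hT.ae_of_forall_openCell fun K hK => ?_
    by_cases hKS : K ∈ S
    · filter_upwards [ae_restrict_mem (measurableSet_openCell K)] with x hx hxS
      exact absurd (mem_iUnion₂.2 ⟨K, hKS, openCell_subset_cell K hx⟩) hxS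
    · exact (h K hK hKS).mono fun x hx _ => hx

theorem mem_fineSpaceOn_self (hT : IsRectMesh Ω H κ T) :
    w ∈ fineSpaceOn Ω T p (⋃ K ∈ T, cell K) ↔ w ∈ fineSpace Ω T p := by
  rw [hT.mem_fineSpaceOn Finset.Subset.rfl]
  exact and_iff_left fun K hK hKT => absurd hK hKT

theorem cellEnergy_eq_zero (hT : IsRectMesh Ω H κ T) (hK : K ∈ T)
    (h : ∀ᵐ x ∂volume.restrict (openCell K), fnOf u x = 0) : cellEnergy K u = 0 := by
  refine integral_eq_zero_of_ae ?_
  filter_upwards [H10.gradOf_ae_eq_zero u (isOpen_openCell K) (hT.openCell_subset hK) h] with x hx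
  simp [hx]

theorem cellForm_congr_right (hT : IsRectMesh Ω H κ T) (hK : K ∈ T) (A : Euc d → ℝ) (u : H10 Ω)
    (h : ∀ᵐ x ∂volume.restrict (openCell K), fnOf w x = fnOf w' x) :
    cellForm A K u w = cellForm A K u w' :=
  integral_congr_ae <| (H10.gradOf_ae_eq (isOpen_openCell K) (hT.openCell_subset hK) h).mono
    fun x hx => congrArg (fun g => A x * inner ℝ (gradOf u x) g) hx

theorem cellForm_eq_zero_right (hT : IsRectMesh Ω H κ T) (hK : K ∈ T) (A : Euc d → ℝ) (u : H10 Ω)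
    (h : ∀ᵐ x ∂volume.restrict (openCell K), fnOf w x = 0) : cellForm A K u w = 0 := by
  refine integral_eq_zero_of_ae ?_
  filter_upwards [H10.gradOf_ae_eq_zero w (isOpen_openCell K) (hT.openCell_subset hK) h] with x hx
  simp [hx]

theorem cellForm_eq_zero_left (hT : IsRectMesh Ω H κ T) (hK : K ∈ T) (A : Euc d → ℝ) (w : H10 Ω)
    (h : ∀ᵐ x ∂volume.restrict (openCell K), fnOf u x = 0) : cellForm A K u w = 0 := by
  rw [cellForm_comm, hT.cellForm_eq_zero_right hK A w h]

theorem setIntegral_inter_cell (hT : IsRectMesh Ω H κ T) (hG : G ∈ T) (g : Euc d → ℝ) :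
    ∫ x in Ω ∩ cell G, g x = ∫ x in openCell G, g x := by
  refine setIntegral_congr_set ?_
  simpa using hT.inter_biUnion_ae_eq (Finset.singleton_subset_iff.2 hG)

theorem gradNorm_cell (hT : IsRectMesh Ω H κ T) (hG : G ∈ T) (u : H10 Ω) :
    gradNorm (cell G) u = √(cellEnergy G u) := by
  rw [gradNorm, hT.setIntegral_inter_cell hG, cellEnergy]

theorem gradNorm_biUnion (hT : IsRectMesh Ω H κ T) (hS : S ⊆ T) (u : H10 Ω) :
    gradNorm (⋃ K ∈ S, cell K) u = √(∑ K ∈ S, cellEnergy K u) := by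
  rw [gradNorm, hT.setIntegral_biUnion hS (Lp.memLp (gradOf u)).norm.integrable_sq]
  rfl

theorem norm_gradOf_sq (hT : IsRectMesh Ω H κ T) (u : H10 Ω) :
    ‖gradOf u‖ ^ 2 = ∑ K ∈ T, cellEnergy K u := by
  rw [norm_sq_eq_integral_norm_sq, hT.setIntegral_eq_sum (Lp.memLp (gradOf u)).norm.integrable_sq]
  rfl

theorem norm_fnOf_sq_le (hT : IsRectMesh Ω H κ T) (hu : u ∈ fineSpace Ω T p) :
    ‖fnOf u‖ ^ 2 ≤ poincareConst d κ * H ^ 2 * ‖gradOf u‖ ^ 2 := by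
  rw [norm_sq_eq_integral_norm_sq, hT.norm_gradOf_sq, Finset.mul_sum]
  simp only [Real.norm_eq_abs, sq_abs]
  rw [hT.setIntegral_eq_sum (Lp.memLp (fnOf u)).integrable_sq]
  exact Finset.sum_le_sum fun K hK =>
    hT.integral_sq_le_cellEnergy hK (hT.integral_eq_zero_of_mem_fineSpace hK hu)

end IsRectMesh

namespace IsCoefficient

theorem ae_abs_le (hA : IsCoefficient Ω α β A) (hα : 0 < α) :
    ∀ᵐ x ∂volume.restrict Ω, |A x| ≤ β :=
  hA.2.mono fun x hx => by rw [abs_of_pos (hα.trans_le hx.1)]; exact hx.2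

theorem integrableOn (hA : IsCoefficient Ω α β A) (hα : 0 < α) (u w : H10 Ω) :
    IntegrableOn (fun x => A x * inner ℝ (gradOf u x) (gradOf w x)) Ω :=
  (L2.integrable_inner (𝕜 := ℝ) (gradOf u) (gradOf w)).bdd_mul hA.1 (hA.ae_abs_le hα)

theorem energyOn_biUnion (hA : IsCoefficient Ω α β A) (hα : 0 < α) (hT : IsRectMesh Ω H κ T)
    (hS : S ⊆ T) (u w : H10 Ω) :
    energyOn A (⋃ K ∈ S, cell K) u w = ∑ K ∈ S, cellForm A K u w :=
  hT.setIntegral_biUnion hS (hA.integrableOn hα u w)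

theorem energyOn_self (hA : IsCoefficient Ω α β A) (hα : 0 < α) (hT : IsRectMesh Ω H κ T)
    (u w : H10 Ω) : energyOn A Ω u w = ∑ K ∈ T, cellForm A K u w := by
  rw [energyOn, inter_self]
  exact hT.setIntegral_eq_sum (hA.integrableOn hα u w)

theorem cellForm_sub_left (hA : IsCoefficient Ω α β A) (hα : 0 < α) (hT : IsRectMesh Ω H κ T)
    (hK : K ∈ T) (u u' w : H10 Ω) :
    cellForm A K (u - u') w = cellForm A K u w - cellForm A K u' w := by
  unfold cellForm
  rw [← integral_sub ((hA.integrableOn hα u w).mono_set (hT.openCell_subset hK))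
    ((hA.integrableOn hα u' w).mono_set (hT.openCell_subset hK))]
  refine integral_congr_ae ?_
  filter_upwards [hT.ae_openCell hK (Lp.coeFn_sub (gradOf u) (gradOf u'))] with x hx
  rw [gradOf_sub, hx, Pi.sub_apply, inner_sub_left, mul_sub]

theorem cellForm_sub_right (hA : IsCoefficient Ω α β A) (hα : 0 < α) (hT : IsRectMesh Ω H κ T)
    (hK : K ∈ T) (u w w' : H10 Ω) :
    cellForm A K u (w - w') = cellForm A K u w - cellForm A K u w' := by
  rw [cellForm_comm, hA.cellForm_sub_left hα hT hK, cellForm_comm, cellForm_comm A K w']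

theorem abs_cellForm_le (hA : IsCoefficient Ω α β A) (hα : 0 < α) (hαβ : α ≤ β)
    (hT : IsRectMesh Ω H κ T) (hK : K ∈ T) (u w : H10 Ω) :
    |cellForm A K u w| ≤ β * (√(cellEnergy K u) * √(cellEnergy K w)) :=
  abs_integral_mul_inner_le (hT.ae_openCell hK (hA.ae_abs_le hα)) (hα.le.trans hαβ)
    (hT.memLp_openCell hK _) (hT.memLp_openCell hK _)

theorem le_cellForm_self (hA : IsCoefficient Ω α β A) (hα : 0 < α) (hT : IsRectMesh Ω H κ T)
    (hK : K ∈ T) (u : H10 Ω) : α * cellEnergy K u ≤ cellForm A K u u := by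
  unfold cellEnergy cellForm
  rw [← integral_const_mul]
  refine integral_mono_ae ((hT.memLp_openCell hK _).norm.integrable_sq.const_mul α)
    ((hA.integrableOn hα u u).mono_set (hT.openCell_subset hK)) ?_
  filter_upwards [hT.ae_openCell hK hA.2] with x hx
  rw [real_inner_self_eq_norm_sq]
  exact mul_le_mul_of_nonneg_right hx.1 (sq_nonneg _)

end IsCoefficient

section LaxMilgram

variable {E : Type*} [NormedAddCommGroup E] [InnerProductSpace ℝ E] [CompleteSpace E]

theorem existsUnique_forall_eq_of_isCoercive {B : E →L[ℝ] E →L[ℝ] ℝ} (hB : IsCoercive B)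
    (F : E →L[ℝ] ℝ) : ∃! u, ∀ w, B u w = F w := by
  have hiff (u : E) : (∀ w, B u w = F w) ↔
      hB.continuousLinearEquivOfBilin u = (InnerProductSpace.toDual ℝ E).symm F := by
    rw [ext_iff_inner_right ℝ]
    simp [hB.continuousLinearEquivOfBilin_apply]
  simp_rw [hiff]
  exact hB.continuousLinearEquivOfBilin.bijective.existsUnique _

theorem existsUnique_mem_forall_eq_of_coercive {V : Submodule ℝ E} (hV : IsClosed (V : Set E))
    (B : E →L[ℝ] E →L[ℝ] ℝ) (F : E →L[ℝ] ℝ) {c : ℝ} (hc : 0 < c)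
    (h : ∀ u ∈ V, c * ‖u‖ ^ 2 ≤ B u u) : ∃! u, u ∈ V ∧ ∀ w ∈ V, B u w = F w := by
  have : CompleteSpace V := hV.completeSpace_coe
  have hcoercive : IsCoercive (B.bilinearComp V.subtypeL V.subtypeL) :=
    ⟨c, hc, fun u => by rw [mul_assoc, ← sq]; exact h u u.2⟩
  obtain ⟨u, hu, huniq⟩ := existsUnique_forall_eq_of_isCoercive hcoercive (F.comp V.subtypeL)
  refine ⟨u, ⟨u.2, fun w hw => hu ⟨w, hw⟩⟩, fun u' hu' => ?_⟩
  exact congrArg Subtype.val (huniq ⟨u', hu'.1⟩ fun w => hu'.2 w w.2)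

end LaxMilgram

/-- The inclusion of `H¹₀(Ω)` into `L²(Ω)`, as a continuous linear map. -/
def fnOfL (Ω : Set (Euc d)) : H10 Ω →L[ℝ] L2 Ω :=
  (WithLp.fstL 2 ℝ _ _).comp (H10 Ω).subtypeL

/-- The weak gradient on `H¹₀(Ω)`, as a continuous linear map. -/
def gradOfL (Ω : Set (Euc d)) : H10 Ω →L[ℝ] Lp (Euc d) 2 (volume.restrict Ω) :=
  (WithLp.sndL 2 ℝ _ _).comp (H10 Ω).subtypeL

/-- The localized fine-scale space `W(S)` as a subspace of `H¹₀(Ω)`. -/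
def fineSubmodule (Ω : Set (Euc d)) (T : Finset (Box (Fin d))) (p : ℕ) (S : Set (Euc d)) :
    Submodule ℝ (H10 Ω) :=
  ((polySpace Ω T p)ᗮ.comap (fnOfL Ω).toLinearMap) ⊓
    (((LpToLpRestrictCLM (Euc d) ℝ ℝ (volume.restrict Ω) 2 Sᶜ).comp (fnOfL Ω)).toLinearMap).ker

theorem isClosed_fineSubmodule (T : Finset (Box (Fin d))) (p : ℕ) (S : Set (Euc d)) :
    IsClosed (fineSubmodule Ω T p S : Set (H10 Ω)) :=
  ((Submodule.isClosed_orthogonal _).preimage (fnOfL Ω).continuous).inter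
    (ContinuousLinearMap.isClosed_ker _)

theorem mem_fineSubmodule {S : Set (Euc d)} (hS : MeasurableSet S) :
    w ∈ fineSubmodule Ω T p S ↔ w ∈ fineSpaceOn Ω T p S := by
  refine and_congr Iff.rfl ?_
  change LpToLpRestrictCLM (Euc d) ℝ ℝ (volume.restrict Ω) 2 Sᶜ (fnOf w) = 0 ↔
    ∀ᵐ x ∂volume.restrict Ω, x ∈ Sᶜ → fnOf w x = 0
  rw [Lp.eq_zero_iff_ae_eq_zero, ← ae_restrict_iff' hS.compl]
  exact (LpToLpRestrictCLM_coeFn (μ := volume.restrict Ω) (p := 2) ℝ Sᶜ (fnOf w)).congr_left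

theorem IsCoefficient.exists_clm_eq_energyOn (hA : IsCoefficient Ω α β A) (hα : 0 < α)
    {S : Set (Euc d)} (hS : MeasurableSet S) :
    ∃ B : H10 Ω →L[ℝ] H10 Ω →L[ℝ] ℝ, ∀ u w, B u w = energyOn A S u w := by
  have hbdd : MemLp (S.indicator A) ∞ (volume.restrict Ω) :=
    (memLp_top_of_bound hA.1 β (hA.ae_abs_le hα)).indicator hS
  obtain ⟨m, hm⟩ : ∃ m : Lp (Euc d) 2 (volume.restrict Ω) →L[ℝ] Lp (Euc d) 2 (volume.restrict Ω),
      ∀ f, ∀ᵐ x ∂volume.restrict Ω, m f x = S.indicator A x • f x :=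
    exists_clm_ae_eq_apply (ContinuousLinearMap.lsmul ℝ ℝ) hbdd
  refine ⟨(innerSL ℝ).bilinearComp (m.comp (gradOfL Ω)) (gradOfL Ω), fun u w => ?_⟩
  change inner ℝ (m (gradOf u)) (gradOf w) = _
  rw [L2.inner_def, energyOn, inter_comm, ← Measure.restrict_restrict hS, ← integral_indicator hS]
  refine integral_congr_ae ((hm (gradOf u)).mono fun x hx => ?_)
  simp only [hx, real_inner_smul_left]
  by_cases hxS : x ∈ S <;> simp [hxS]

theorem exists_clm_eq_setIntegral_mul (v : L2 Ω) {S : Set (Euc d)} (hS : MeasurableSet S) :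
    ∃ F : H10 Ω →L[ℝ] ℝ, ∀ w, F w = ∫ x in Ω ∩ S, v x * fnOf w x := by
  have hm : MemLp (S.indicator v) 2 (volume.restrict Ω) := (Lp.memLp v).indicator hS
  refine ⟨(innerSL ℝ (hm.toLp _)).comp (fnOfL Ω), fun w => ?_⟩
  change inner ℝ (hm.toLp _) (fnOf w) = _
  rw [L2.inner_def, inter_comm, ← Measure.restrict_restrict hS, ← integral_indicator hS]
  refine integral_congr_ae (hm.coeFn_toLp.mono fun x hx => ?_)
  by_cases hxS : x ∈ S <;> simp [hx, hxS, mul_comm]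

theorem H10.norm_sq (u : H10 Ω) : ‖u‖ ^ 2 = ‖fnOf u‖ ^ 2 + ‖gradOf u‖ ^ 2 :=
  WithLp.prod_norm_sq_eq_of_L2 (u : L2Pair Ω)

theorem IsRectMesh.coercive_energyOn (hT : IsRectMesh Ω H κ T) (hA : IsCoefficient Ω α β A)
    (hα : 0 < α) (hS : S ⊆ T) (hu : u ∈ fineSpaceOn Ω T p (⋃ K ∈ S, cell K)) :
    α / (1 + poincareConst d κ * H ^ 2) * ‖u‖ ^ 2 ≤ energyOn A (⋃ K ∈ S, cell K) u u := by
  have hP : 0 ≤ poincareConst d κ := poincareConst_nonneg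
  have hnorm : ‖u‖ ^ 2 ≤ (1 + poincareConst d κ * H ^ 2) * ‖gradOf u‖ ^ 2 := by
    rw [H10.norm_sq, add_mul, one_mul, add_comm]
    gcongr
    exact hT.norm_fnOf_sq_le hu.1
  have hsupp : ∑ K ∈ T, cellEnergy K u = ∑ K ∈ S, cellEnergy K u :=
    (Finset.sum_subset hS fun K hK hKS =>
      hT.cellEnergy_eq_zero hK (((hT.mem_fineSpaceOn hS).1 hu).2 K hK hKS)).symm
  calc _ ≤ α / (1 + poincareConst d κ * H ^ 2) *
          ((1 + poincareConst d κ * H ^ 2) * ‖gradOf u‖ ^ 2) := by gcongr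
    _ = ∑ K ∈ S, α * cellEnergy K u := by
        rw [← Finset.mul_sum, ← hsupp, ← hT.norm_gradOf_sq]
        field_simp
    _ ≤ _ := by
        rw [hA.energyOn_biUnion hα hT hS]
        exact Finset.sum_le_sum fun K hK => hA.le_cellForm_self hα hT (hS hK) u

theorem IsRectMesh.existsUnique_isEnrichedCorrection (hT : IsRectMesh Ω H κ T)
    (hA : IsCoefficient Ω α β A) (hα : 0 < α) (hS : S ⊆ T) (G : Box (Fin d)) (v : L2 Ω) :
    ∃! u, IsEnrichedCorrection T p A (⋃ K ∈ S, cell K) G v u := by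
  have hSm : MeasurableSet (⋃ K ∈ S, cell K) :=
    S.measurableSet_biUnion fun K _ => (isClosed_cell K).measurableSet
  have hP : 0 ≤ poincareConst d κ := poincareConst_nonneg
  have : CompleteSpace (H10 Ω) :=
    (Submodule.isClosed_topologicalClosure (testPairs Ω)).completeSpace_coe
  obtain ⟨B, hB⟩ := hA.exists_clm_eq_energyOn hα hSm
  obtain ⟨F, hF⟩ := exists_clm_eq_setIntegral_mul v (isClosed_cell G).measurableSet
  have h := existsUnique_mem_forall_eq_of_coercive
    (isClosed_fineSubmodule T p (⋃ K ∈ S, cell K)) B (-F)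
    (c := α / (1 + poincareConst d κ * H ^ 2)) (by positivity) fun u hu => by
      rw [hB]
      exact hT.coercive_energyOn hA hα hS ((mem_fineSubmodule hSm).1 hu)
  simpa only [IsEnrichedCorrection, mem_fineSubmodule hSm, hB, neg_apply, hF] using h

theorem IsRectMesh.isEnrichedCorrection_self_iff (hT : IsRectMesh Ω H κ T) (hΩ : IsOpen Ω)
    (hA : IsCoefficient Ω α β A) (hα : 0 < α) :
    IsEnrichedCorrection T p A Ω G v u ↔
      IsEnrichedCorrection T p A (⋃ K ∈ T, cell K) G v u := by
  have hspace : fineSpaceOn Ω T p Ω = fineSpaceOn Ω T p (⋃ K ∈ T, cell K) := by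
    ext w
    rw [hT.mem_fineSpaceOn_self]
    exact and_iff_left ((ae_restrict_mem hΩ.measurableSet).mono fun x hx hx' => absurd hx hx')
  simp_rw [IsEnrichedCorrection, hspace, hA.energyOn_self hα hT,
    hA.energyOn_biUnion hα hT Finset.Subset.rfl]

theorem IsFineCutoff.abs_cellForm_le (hw' : IsFineCutoff T S p C w w')
    (hA : IsCoefficient Ω α β A) (hα : 0 < α) (hαβ : α ≤ β) (hT : IsRectMesh Ω H κ T)
    (hC : 0 ≤ C) (hK : K ∈ T) (u : H10 Ω) :
    |cellForm A K u w'| ≤ β * √C * (√(cellEnergy K u) * √(cellEnergy K w)) := by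
  have hβ : 0 < β := hα.trans_le hαβ
  calc _ ≤ β * (√(cellEnergy K u) * √(cellEnergy K w')) := hA.abs_cellForm_le hα hαβ hT hK u w'
    _ ≤ β * (√(cellEnergy K u) * √(C * cellEnergy K w)) := by
        gcongr
        exact hw'.cellEnergy_le K hK
    _ = _ := by rw [Real.sqrt_mul hC]; ring

theorem IsFineCutoff.sub_mem_fineSpaceOn (hw' : IsFineCutoff T (layer T G l) p C w w')
    (hT : IsRectMesh Ω H κ T) (hG : G ∈ T) (hw : w ∈ fineSpace Ω T p) :
    w - w' ∈ fineSpaceOn Ω T p (⋃ K ∈ layer T G (l + 1), cell K) := by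
  refine (hT.mem_fineSpaceOn (layer_subset hG (l + 1))).2
    ⟨Submodule.sub_mem (polySpace Ω T p)ᗮ hw hw'.mem, fun K hK hKl => ?_⟩
  filter_upwards [hT.ae_openCell hK (Lp.coeFn_sub (fnOf w) (fnOf w')),
    hw'.eq_self K hK fun L hL => disjoint_of_notMem_layer_succ hK hKl hL] with x hsub hself
  rw [fnOf_sub, hsub, Pi.sub_apply, hself, sub_self]

namespace IsEnrichedCorrection

theorem sum_cellForm (hu : IsEnrichedCorrection T p A (⋃ K ∈ S, cell K) G v u)
    (hT : IsRectMesh Ω H κ T) (hA : IsCoefficient Ω α β A) (hα : 0 < α) (hG : G ∈ T) (hS : S ⊆ T)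
    (hw : w ∈ fineSpaceOn Ω T p (⋃ K ∈ S, cell K)) :
    ∑ K ∈ T, cellForm A K u w = -∫ x in openCell G, v x * fnOf w x := by
  rw [← hT.setIntegral_inter_cell hG, ← hu.2 w hw, hA.energyOn_biUnion hα hT hS]
  exact (Finset.sum_subset hS fun K hK hKS =>
    hT.cellForm_eq_zero_left hK A w (((hT.mem_fineSpaceOn hS).1 hu.1).2 K hK hKS)).symm

theorem sqrt_sum_cellEnergy_le {v : H10 Ω}
    (hu : IsEnrichedCorrection T p A (⋃ K ∈ S, cell K) G (fnOf v) u) (hT : IsRectMesh Ω H κ T)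
    (hA : IsCoefficient Ω α β A) (hα : 0 < α) (hG : G ∈ T) (hS : S ⊆ T) :
    √(∑ K ∈ T, cellEnergy K u) ≤ poincareConst d κ / α * H ^ 2 * √(cellEnergy G v) := by
  have hP : 0 ≤ poincareConst d κ := poincareConst_nonneg
  set E := ∑ K ∈ T, cellEnergy K u with hE
  have hE0 : 0 ≤ E := Finset.sum_nonneg fun _ _ => cellEnergy_nonneg u
  have henergy : α * E ≤ poincareConst d κ * H ^ 2 * (√(cellEnergy G v) * √E) :=
    calc α * E ≤ ∑ K ∈ T, cellForm A K u u := by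
          rw [hE, Finset.mul_sum]
          exact Finset.sum_le_sum fun K hK => hA.le_cellForm_self hα hT hK u
      _ = -∫ x in openCell G, fnOf v x * fnOf u x := hu.sum_cellForm hT hA hα hG hS hu.1
      _ ≤ |∫ x in openCell G, fnOf v x * fnOf u x| := neg_le_abs _
      _ ≤ poincareConst d κ * H ^ 2 * (√(cellEnergy G v) * √(cellEnergy G u)) :=
          hT.abs_integral_mul_le_cellEnergy hG v (hT.integral_eq_zero_of_mem_fineSpace hG hu.1.1)
      _ ≤ _ := by
          gcongr
          exact Finset.single_le_sum (f := fun K => cellEnergy K u)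
            (fun _ _ => cellEnergy_nonneg u) hG
  rcases (Real.sqrt_nonneg E).eq_or_lt with hzero | hpos
  · rw [← hzero]
    positivity
  · refine le_of_mul_le_mul_right ?_ hpos
    rw [Real.mul_self_sqrt hE0, div_mul_eq_mul_div, div_mul_eq_mul_div, div_mul_eq_mul_div,
      le_div_iff₀ hα]
    linarith

end IsEnrichedCorrection

/-! ### Exponential decay -/

/-- The factor by which the energy of an enriched correction outside the `k`-th layer of cells
decreases when `k` grows by one; `C` is the stability constant of the cutoffs used to prove it. -/
def decayRate (α β C : ℝ) : ℝ := β * √C / (β * √C + α)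

theorem decayRate_pos (hα : 0 < α) (hαβ : α ≤ β) (hC : 0 < C) : 0 < decayRate α β C := by
  have hβ : 0 < β := hα.trans_le hαβ
  unfold decayRate
  positivity

theorem decayRate_lt_one (hα : 0 < α) (hαβ : α ≤ β) : decayRate α β C < 1 := by
  have hβ : 0 < β := hα.trans_le hαβ
  rw [decayRate, div_lt_one (by positivity)]
  exact lt_add_of_pos_right _ hα

section Decay

variable [DecidableEq (Box (Fin d))]

theorem sum_sdiff_layer (hG : G ∈ T) (l : ℕ) (f : Box (Fin d) → ℝ) :
    ∑ K ∈ T \ layer T G l, f K =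
      ∑ K ∈ layer T G (l + 1) \ layer T G l, f K + ∑ K ∈ T \ layer T G (l + 1), f K := by
  have houter := Finset.sum_sdiff (f := f) (layer_subset hG l)
  have hinner := Finset.sum_sdiff (f := f) (layer_subset hG (l + 1))
  have hring := Finset.sum_sdiff (f := f) (layer_subset_succ hG l)
  linarith

namespace IsEnrichedCorrection

theorem sum_sdiff_layer_cellForm_eq_zero
    (hu : IsEnrichedCorrection T p A (⋃ K ∈ layer T G l, cell K) G v u)
    (hT : IsRectMesh Ω H κ T) (hA : IsCoefficient Ω α β A) (hα : 0 < α) (hG : G ∈ T) {k : ℕ}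
    (hw : IsFineCutoff T (layer T G k) p C u w) :
    ∑ K ∈ T \ layer T G k, cellForm A K u w = 0 := by
  have hl := layer_subset hG l
  have hwl : w ∈ fineSpaceOn Ω T p (⋃ K ∈ layer T G l, cell K) :=
    (hT.mem_fineSpaceOn hl).2 ⟨hw.mem, fun K hK hKl =>
      hw.eq_zero_of_eq_zero K hK (((hT.mem_fineSpaceOn hl).1 hu.1).2 K hK hKl)⟩
  have hload : ∫ x in openCell G, v x * fnOf w x = 0 :=
    integral_eq_zero_of_ae <| (hw.eq_zero G (self_mem_layer hG k)).mono fun x hx => by simp [hx]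
  have hzero : ∑ K ∈ layer T G k, cellForm A K u w = 0 := Finset.sum_eq_zero fun K hK =>
    hT.cellForm_eq_zero_right (layer_subset hG k hK) A u (hw.eq_zero K hK)
  have hsum := hu.sum_cellForm hT hA hα hG hl hwl
  rwa [hload, neg_zero, ← Finset.sum_sdiff (layer_subset hG k), hzero, add_zero] at hsum

theorem sum_sdiff_layer_succ_cellEnergy_le
    (hu : IsEnrichedCorrection T p A (⋃ K ∈ layer T G l, cell K) G v u)
    (hT : IsRectMesh Ω H κ T) (hA : IsCoefficient Ω α β A) (hα : 0 < α) (hαβ : α ≤ β)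
    (hG : G ∈ T) (hC : 0 ≤ C) {k : ℕ} (hw : IsFineCutoff T (layer T G k) p C u w) :
    ∑ K ∈ T \ layer T G (k + 1), cellEnergy K u ≤
      decayRate α β C * ∑ K ∈ T \ layer T G k, cellEnergy K u := by
  have hβ : 0 < β := hα.trans_le hαβ
  have hfar : α * ∑ K ∈ T \ layer T G (k + 1), cellEnergy K u ≤
      ∑ K ∈ T \ layer T G (k + 1), cellForm A K u w := by
    rw [Finset.mul_sum]
    refine Finset.sum_le_sum fun K hK => ?_
    obtain ⟨hKT, hKk⟩ := Finset.mem_sdiff.1 hK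
    rw [hT.cellForm_congr_right hKT A u
      (hw.eq_self K hKT fun L hL => disjoint_of_notMem_layer_succ hKT hKk hL)]
    exact hA.le_cellForm_self hα hT hKT u
  have hring : -(β * √C * ∑ K ∈ layer T G (k + 1) \ layer T G k, cellEnergy K u) ≤
      ∑ K ∈ layer T G (k + 1) \ layer T G k, cellForm A K u w := by
    rw [Finset.mul_sum, ← Finset.sum_neg_distrib]
    refine Finset.sum_le_sum fun K hK => ?_
    have hKT := layer_subset hG (k + 1) (Finset.sdiff_subset hK)
    have hbound := hw.abs_cellForm_le hA hα hαβ hT hC hKT u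
    rw [Real.mul_self_sqrt (cellEnergy_nonneg u)] at hbound
    exact neg_le_of_abs_le hbound
  have hsum := hu.sum_sdiff_layer_cellForm_eq_zero hT hA hα hG hw
  rw [sum_sdiff_layer hG] at hsum
  rw [decayRate, div_mul_eq_mul_div, le_div_iff₀ (by positivity), sum_sdiff_layer hG k]
  linarith

theorem sum_sdiff_layer_cellEnergy_le
    (hu : IsEnrichedCorrection T p A (⋃ K ∈ layer T G l, cell K) G v u)
    (hT : IsRectMesh Ω H κ T) (hΩ : IsOpen Ω) (hH : 0 < H) (hκ : 0 < κ)
    (hA : IsCoefficient Ω α β A) (hα : 0 < α) (hαβ : α ≤ β) (hG : G ∈ T) (k : ℕ) :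
    ∑ K ∈ T \ layer T G k, cellEnergy K u ≤
      decayRate α β (fineCutoffConst d p κ) ^ k * ∑ K ∈ T, cellEnergy K u := by
  have hC : 0 < fineCutoffConst d p κ := fineCutoffConst_pos
  have hrate := decayRate_pos hα hαβ hC
  induction k with
  | zero =>
    rw [pow_zero, one_mul]
    exact Finset.sum_le_sum_of_subset_of_nonneg Finset.sdiff_subset
      fun _ _ _ => cellEnergy_nonneg u
  | succ k ih =>
    obtain ⟨w, hw⟩ := hT.exists_isFineCutoff hΩ hH hκ (layer_subset hG k) hu.1.1
    rw [pow_succ', mul_assoc]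
    exact (hu.sum_sdiff_layer_succ_cellEnergy_le hT hA hα hαβ hG hC.le hw).trans (by gcongr)

theorem sum_cellForm_add_integral_eq
    (hu : IsEnrichedCorrection T p A (⋃ K ∈ layer T G (l + 1), cell K) G v u)
    (hT : IsRectMesh Ω H κ T) (hA : IsCoefficient Ω α β A) (hα : 0 < α) (hG : G ∈ T)
    (hw : w ∈ fineSpace Ω T p) (hw' : IsFineCutoff T (layer T G l) p C w w') :
    ∑ K ∈ T, cellForm A K u w + ∫ x in openCell G, v x * fnOf w x =
      ∑ K ∈ layer T G (l + 1) \ layer T G l, cellForm A K u w' := by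
  have hload : ∫ x in openCell G, v x * fnOf (w - w') x = ∫ x in openCell G, v x * fnOf w x := by
    refine integral_congr_ae ?_
    filter_upwards [hT.ae_openCell hG (Lp.coeFn_sub (fnOf w) (fnOf w')),
      hw'.eq_zero G (self_mem_layer hG l)] with x hsub hzero
    rw [fnOf_sub, hsub, Pi.sub_apply, hzero, sub_zero]
  have hsum := hu.sum_cellForm hT hA hα hG (layer_subset hG _) (hw'.sub_mem_fineSpaceOn hT hG hw)
  rw [hload, Finset.sum_congr rfl fun K hK => hA.cellForm_sub_right hα hT hK u w w',
    Finset.sum_sub_distrib] at hsum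
  have hinner : ∑ K ∈ layer T G l, cellForm A K u w' = 0 := Finset.sum_eq_zero fun K hK =>
    hT.cellForm_eq_zero_right (layer_subset hG l hK) A u (hw'.eq_zero K hK)
  have houter : ∑ K ∈ T \ layer T G (l + 1), cellForm A K u w' = 0 :=
    Finset.sum_eq_zero fun K hK => by
      obtain ⟨hKT, hKl⟩ := Finset.mem_sdiff.1 hK
      exact hT.cellForm_eq_zero_left hKT A w'
        (((hT.mem_fineSpaceOn (layer_subset hG _)).1 hu.1).2 K hKT hKl)
  have hsplit := Finset.sum_sdiff (f := fun K => cellForm A K u w') (layer_subset hG l)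
  rw [sum_sdiff_layer hG, hinner, houter] at hsplit
  linarith

theorem sum_cellForm_add_integral_le
    (hu : IsEnrichedCorrection T p A (⋃ K ∈ layer T G (l + 1), cell K) G v u)
    (hT : IsRectMesh Ω H κ T) (hA : IsCoefficient Ω α β A) (hα : 0 < α) (hαβ : α ≤ β)
    (hG : G ∈ T) (hC : 0 ≤ C) (hw : w ∈ fineSpace Ω T p)
    (hw' : IsFineCutoff T (layer T G l) p C w w') :
    ∑ K ∈ T, cellForm A K u w + ∫ x in openCell G, v x * fnOf w x ≤
      β * √C * (√(∑ K ∈ T \ layer T G l, cellEnergy K u) *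
        √(∑ K ∈ layer T G (l + 2), cellEnergy K w)) := by
  have hβ : 0 < β := hα.trans_le hαβ
  rw [hu.sum_cellForm_add_integral_eq hT hA hα hG hw hw']
  set R := layer T G (l + 1) \ layer T G l
  have hRl : R ⊆ layer T G (l + 1) := Finset.sdiff_subset
  have hRT : R ⊆ T \ layer T G l :=
    Finset.sdiff_subset_sdiff (layer_subset hG _) Finset.Subset.rfl
  calc ∑ K ∈ R, cellForm A K u w'
      ≤ ∑ K ∈ R, β * √C * (√(cellEnergy K u) * √(cellEnergy K w)) :=
        Finset.sum_le_sum fun K hK => (le_abs_self _).trans <|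
          hw'.abs_cellForm_le hA hα hαβ hT hC (layer_subset hG _ (hRl hK)) u
    _ = β * √C * ∑ K ∈ R, √(cellEnergy K u) * √(cellEnergy K w) := (Finset.mul_sum ..).symm
    _ ≤ β * √C * (√(∑ K ∈ R, cellEnergy K u) * √(∑ K ∈ R, cellEnergy K w)) := by
        gcongr
        exact Real.sum_sqrt_mul_sqrt_le _ (fun _ => cellEnergy_nonneg u)
          fun _ => cellEnergy_nonneg w
    _ ≤ _ := by
        gcongr
        · exact fun _ _ _ => cellEnergy_nonneg u
        · exact fun _ _ _ => cellEnergy_nonneg w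
        · exact hRl.trans (layer_subset_succ hG _)

end IsEnrichedCorrection

end Decay

/-- The constant `C₀` of the localization estimate. -/
def localizationConst (d p : ℕ) (α β κ : ℝ) : ℝ :=
  β * √(fineCutoffConst d p κ) * (poincareConst d κ / α) /
    √(decayRate α β (fineCutoffConst d p κ))

theorem localizationConst_pos (hd : 0 < d) (hκ : 0 < κ) (hα : 0 < α) (hαβ : α ≤ β) :
    0 < localizationConst d p α β κ := by
  have hβ : 0 < β := hα.trans_le hαβ
  have hC : 0 < fineCutoffConst d p κ := fineCutoffConst_pos
  have hrate := decayRate_pos hα hαβ hC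
  have : (0 : ℝ) < d := mod_cast hd
  unfold localizationConst poincareConst
  positivity

/-- The exponential decay constant `C` of the localization estimate. -/
def localizationExponent (d p : ℕ) (α β κ : ℝ) : ℝ :=
  -Real.log √(decayRate α β (fineCutoffConst d p κ))

theorem localizationExponent_pos (hα : 0 < α) (hαβ : α ≤ β) :
    0 < localizationExponent d p α β κ := by
  refine neg_pos.2 (Real.log_neg (Real.sqrt_pos.2 (decayRate_pos hα hαβ fineCutoffConst_pos)) ?_)
  rw [Real.sqrt_lt' one_pos, one_pow]
  exact decayRate_lt_one hα hαβ

theorem exp_neg_localizationExponent_mul (hα : 0 < α) (hαβ : α ≤ β) (l : ℕ) :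
    Real.exp (-localizationExponent d p α β κ * l) =
      √(decayRate α β (fineCutoffConst d p κ)) ^ l := by
  rw [localizationExponent, neg_neg, mul_comm, Real.exp_nat_mul,
    Real.exp_log (Real.sqrt_pos.2 (decayRate_pos hα hαβ fineCutoffConst_pos))]

theorem IsEnrichedCorrection.sqrt_sum_sdiff_layer_cellEnergy_le [DecidableEq (Box (Fin d))]
    {v : H10 Ω} (hu : IsEnrichedCorrection T p A (⋃ K ∈ layer T G l, cell K) G (fnOf v) u)
    (hT : IsRectMesh Ω H κ T) (hΩ : IsOpen Ω) (hH : 0 < H) (hκ : 0 < κ)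
    (hA : IsCoefficient Ω α β A) (hα : 0 < α) (hαβ : α ≤ β) (hG : G ∈ T) (k : ℕ) :
    √(∑ K ∈ T \ layer T G k, cellEnergy K u) ≤
      √(decayRate α β (fineCutoffConst d p κ)) ^ k *
        (poincareConst d κ / α * H ^ 2 * √(cellEnergy G v)) := by
  have hrate := decayRate_pos hα hαβ (fineCutoffConst_pos (d := d) (p := p) (κ := κ))
  have hpow : √(decayRate α β (fineCutoffConst d p κ) ^ k) =
      √(decayRate α β (fineCutoffConst d p κ)) ^ k := by
    rw [Real.sqrt_eq_iff_mul_self_eq (by positivity) (by positivity), ← mul_pow,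
      Real.mul_self_sqrt hrate.le]
  calc _ ≤ √(decayRate α β (fineCutoffConst d p κ) ^ k * ∑ K ∈ T, cellEnergy K u) :=
        Real.sqrt_le_sqrt (hu.sum_sdiff_layer_cellEnergy_le hT hΩ hH hκ hA hα hαβ hG k)
    _ = √(decayRate α β (fineCutoffConst d p κ)) ^ k * √(∑ K ∈ T, cellEnergy K u) := by
        rw [Real.sqrt_mul (by positivity), hpow]
    _ ≤ _ := by
        gcongr
        exact hu.sqrt_sum_cellEnergy_le hT hA hα hG (layer_subset hG l)

theorem IsEnrichedCorrection.energyOn_sub_le {v u' : H10 Ω}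
    (hu : IsEnrichedCorrection T p A (patch T (l + 1) (cell G)) G (fnOf v) u)
    (hu' : IsEnrichedCorrection T p A Ω G (fnOf v) u')
    (hT : IsRectMesh Ω H κ T) (hΩ : IsOpen Ω) (hH : 0 < H) (hκ : 0 < κ)
    (hA : IsCoefficient Ω α β A) (hα : 0 < α) (hαβ : α ≤ β) (hG : G ∈ T)
    (hw : w ∈ fineSpace Ω T p) :
    energyOn A Ω (u - u') w ≤ localizationConst d p α β κ * H ^ 2 *
      Real.exp (-localizationExponent d p α β κ * (l + 1 : ℕ)) *
        gradNorm (cell G) v * gradNorm (patch T (l + 2) (cell G)) w := by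
  classical
  have hβ : 0 < β := hα.trans_le hαβ
  have hC : 0 < fineCutoffConst d p κ := fineCutoffConst_pos
  have hrate := decayRate_pos hα hαβ hC
  rw [patch_eq_biUnion] at hu
  rw [hT.isEnrichedCorrection_self_iff hΩ hA hα] at hu'
  obtain ⟨w', hw'⟩ := hT.exists_isFineCutoff hΩ hH hκ (layer_subset hG l) hw
  have hglob := hu'.sum_cellForm hT hA hα hG Finset.Subset.rfl (hT.mem_fineSpaceOn_self.2 hw)
  calc energyOn A Ω (u - u') w
      = ∑ K ∈ T, cellForm A K u w + ∫ x in openCell G, fnOf v x * fnOf w x := by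
        rw [hA.energyOn_self hα hT,
          Finset.sum_congr rfl fun K hK => hA.cellForm_sub_left hα hT hK u u' w,
          Finset.sum_sub_distrib, hglob, sub_neg_eq_add]
    _ ≤ β * √(fineCutoffConst d p κ) * (√(∑ K ∈ T \ layer T G l, cellEnergy K u) *
          √(∑ K ∈ layer T G (l + 2), cellEnergy K w)) :=
        hu.sum_cellForm_add_integral_le hT hA hα hαβ hG hC.le hw hw'
    _ ≤ β * √(fineCutoffConst d p κ) * (√(decayRate α β (fineCutoffConst d p κ)) ^ l *
          (poincareConst d κ / α * H ^ 2 * √(cellEnergy G v)) *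
          √(∑ K ∈ layer T G (l + 2), cellEnergy K w)) := by
        gcongr
        exact hu.sqrt_sum_sdiff_layer_cellEnergy_le hT hΩ hH hκ hA hα hαβ hG l
    _ = _ := by
        rw [hT.gradNorm_cell hG, patch_eq_biUnion, hT.gradNorm_biUnion (layer_subset hG _),
          exp_neg_localizationExponent_mul hα hαβ, localizationConst, pow_succ]
        field_simp
        ring

theorem IsRectMesh.pos_of_mem (hT : IsRectMesh Ω H κ T) (hd : 0 < d) (hH : 0 < H) (hG : G ∈ T) :
    0 < κ :=
  pos_of_mul_pos_left (hH.trans_le (hT.le_side G hG ⟨0, hd⟩))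
    (sub_pos.2 (G.lower_lt_upper ⟨0, hd⟩)).le

end

theorem mainTheorem6_general (d : ℕ) (hd : 0 < d) (p : ℕ) (α β κ : ℝ) (hα : 0 < α)
    (hαβ : α ≤ β) :
    ∃ C₀ > 0, ∃ C > 0, ∀ Ω : Set (Euc d), IsOpen Ω →
      ∀ H : ℝ, 0 < H → ∀ T : Finset (BoxIntegral.Box (Fin d)),
      IsRectMesh Ω H κ T → ∀ A : Euc d → ℝ, IsCoefficient Ω α β A →
      ∀ G ∈ T, ∀ l : ℕ, 1 ≤ l →
        (∀ v : L2 Ω,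
          (∃! u, IsEnrichedCorrection T p A (patch T l (cell G)) G v u) ∧
          (∃! u, IsEnrichedCorrection T p A Ω G v u)) ∧
        ∀ v : H10 Ω, ∀ w ∈ fineSpace Ω T p,
          energyOn A Ω (locCorrection T p A l G (fnOf v) - globCorrection T p A G (fnOf v)) w ≤
            C₀ * H ^ 2 * Real.exp (-C * l) *
              gradNorm (cell G) v * gradNorm (patch T (l + 1) (cell G)) w := by
  rcases le_or_gt κ 0 with hκ | hκ
  · exact ⟨1, one_pos, 1, one_pos, fun Ω _ H hH T hT A _ G hG =>
      absurd (hT.pos_of_mem hd hH hG) hκ.not_gt⟩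
  refine ⟨localizationConst d p α β κ, localizationConst_pos hd hκ hα hαβ,
    localizationExponent d p α β κ, localizationExponent_pos hα hαβ, ?_⟩
  intro Ω hΩ H hH T hT A hA G hG l hl
  have hloc (v : L2 Ω) : ∃! u, IsEnrichedCorrection T p A (patch T l (cell G)) G v u := by
    rw [patch_eq_biUnion]
    exact hT.existsUnique_isEnrichedCorrection hA hα (layer_subset hG l) G v
  have hglob (v : L2 Ω) : ∃! u, IsEnrichedCorrection T p A Ω G v u := by
    simp only [hT.isEnrichedCorrection_self_iff hΩ hA hα]
    exact hT.existsUnique_isEnrichedCorrection hA hα Finset.Subset.rfl G v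
  refine ⟨fun v => ⟨hloc v, hglob v⟩, fun v w hw => ?_⟩
  have hu := Classical.epsilon_spec (hloc (fnOf v)).exists
  have hu' := Classical.epsilon_spec (hglob (fnOf v)).exists
  obtain ⟨m, rfl⟩ := Nat.exists_eq_add_of_le' hl
  exact hu.energyOn_sub_le hu' hT hΩ hH hκ hA hα hαβ hG hw

theorem mainTheorem6 (d : ℕ) (hd : 0 < d) (p : ℕ) (Ω : Set (Euc d)) (hΩ : IsOpen Ω)
    (hΩb : Bornology.IsBounded Ω) (α β κ : ℝ) (hα : 0 < α) (hαβ : α ≤ β) :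
    ∃ C₀ > 0, ∃ C > 0, ∀ H : ℝ, 0 < H → ∀ T : Finset (BoxIntegral.Box (Fin d)),
      IsRectMesh Ω H κ T → ∀ A : Euc d → ℝ, IsCoefficient Ω α β A →
      ∀ G ∈ T, ∀ l : ℕ, 1 ≤ l →
        (∀ v : L2 Ω,
          (∃! u, IsEnrichedCorrection T p A (patch T l (cell G)) G v u) ∧
          (∃! u, IsEnrichedCorrection T p A Ω G v u)) ∧
        ∀ v : H10 Ω, ∀ w ∈ fineSpace Ω T p,
          energyOn A Ω (locCorrection T p A l G (fnOf v) - globCorrection T p A G (fnOf v)) w ≤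
            C₀ * H ^ 2 * Real.exp (-C * l) *
              gradNorm (cell G) v * gradNorm (patch T (l + 1) (cell G)) w := by
  obtain ⟨C₀, hC₀, C, hC, h⟩ := mainTheorem6_general d hd p α β κ hα hαβ
  exact ⟨C₀, hC₀, C, hC, h Ω hΩ⟩
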